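/- **Setting.** Let $\mathcal R$ be the ring of formal power series in $\epsilon$ whose coefficients are complex polynomials in $v^{(m)},u^{(m)}$ ($m\ge 0$) and $e^{\pm u}$, with the total derivative $\partial_x$, the shift $\Lambda=e^{\epsilon\partial_x}$, and the grading $\deg v^{(m)}=1-m$, $\deg u^{(m)}=-m$, $\deg e^u=2$, $\deg\epsilon=1$. Let $L=\Lambda+v+e^u\Lambda^{-1}$, let $\mathrm{res}\sum_k Y_k\Lambda^k=Y_0$, $\left(\sum_k Y_k\Lambda^k\right)_+=\sum_{k\ge0}Y_k\Lambda^k$, and let $$\log L=\tfrac12\left(P\epsilon\partial_xP^{-1}-Q\epsilon\partial_xQ^{-1}\right)=\tfrac12\left(\epsilon Q_xQ^{-1}-\epsilon P_xP^{-1}\right),$$ where $P=1+\sum_{k\ge1}p_k\Lambda^{-k}$ and $Q=\sum_{k\ge0}q_k\Lambda^k$ are dressing operators, $L=P\Lambda P^{-1}=Q\Lambda^{-1}Q^{-1}$ (here $q_0$ is a formal exponential with $q_0(x)/q_0(x-\epsilon)=e^{u(x)}$); the coefficients of $\log L$ are elements of $\mathcal R$ that do not depend on the choice of $P$, $Q$.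 For $q\ge0$ put $c_0=0$, $c_q=1+\frac12+\dots+\frac1q$, $$A_{1,q}=\tfrac2{q!}\left[L^q(\log L-c_q)\right]_+,\qquad A_{2,q}=\tfrac1{(q+1)!}\left[L^{q+1}\right]_+,$$ and for $p\ge-1$ $$h_{1,p}=\tfrac2{(p+1)!}\,\mathrm{res}\left[L^{p+1}(\log L-c_{p+1})\right],\qquad h_{2,p}=\tfrac1{(p+2)!}\,\mathrm{res}\,L^{p+2}.$$ The extended Toda hierarchy is $\epsilon\,\partial L/\partial t^{\beta,q}=[A_{\beta,q},L]$ for $\beta=1,2$, $q\ge0$; these equations define derivations $\partial/\partial t^{\beta,q}$ of $\mathcal R$. With $\mu_1=-\frac12$, $\mu_2=\frac12$, let $\Omega_{\alpha,p;\beta,q}\in\mathcal R$ ($\alpha,\beta=1,2$; $p,q\ge0$) be the homogeneous element of degree $p+q+1+\mu_\alpha+\mu_\beta$ without additive constant (no monomial $c\,\epsilon^k$ with $c\in\mathbb C$ occurs in it) such that $$\tfrac1\epsilon(\Lambda-1)\,\Omega_{\alpha,p;\beta,q}=\frac{\partial h_{\alpha,p-1}}{\partial t^{\beta,q}} .$$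 Let $A$ be a ring of functions of $x$ and of all the times $t^{\alpha,p}$; more generally, let $A$ be any commutative $\mathbb C$-algebra with pairwise commuting derivations $\partial_x$ and $\partial/\partial t^{\alpha,p}$ ($\alpha=1,2$, $p\ge0$). Let $v,u\in A[[\epsilon]]$, together with an invertible $e^u\in A[[\epsilon]]$ satisfying $\partial e^u=e^u\,\partial u$ for each of these derivations $\partial$, be a solution of the extended Toda hierarchy. Let $\tau$ be a tau function of it: $\tau=\exp(\log\tau)$ is the formal exponential of a Laurent series $\log\tau\in A((\epsilon))$ such that, for all $\alpha,\beta=1,2$ and $p,q\ge0$, the value of $\Omega_{\alpha,p;\beta,q}$ at $(v,u)$ is $$\Omega_{\alpha,p;\beta,q}=\epsilon^2\frac{\partial^2\log\tau}{\partial t^{\alpha,p}\,\partial t^{\beta,q}},\qquad\text{and}\qquad \frac{\partial\log\tau}{\partial t^{1,0}}=\frac{\partial\log\tau}{\partial x}.$$ **Statement.** The values of the Hamiltonian densities at $(v,u)$ are $$h_{\alpha,p}=\epsilon(\Lambda-1)\frac{\partial\log\tau}{\partial t^{\alpha,p+1}},\qquad \alpha=1,2,\ p\ge-1 .$$ In particular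 $$v=\epsilon\frac{\partial}{\partial t^{2,0}}\log\frac{\tau(x+\epsilon)}{\tau(x)},\qquad u=\log\frac{\tau(x+\epsilon)\,\tau(x-\epsilon)}{\tau(x)^2}.$$ -/

import Mathlib

open scoped BigOperators

namespace ExtToda

/-! ### Formal power series and Laurent series in `ε`

Let `A` be a ring of functions with a derivation `∂`.  The formal parameter `ε` is the variable of
`PowerSeries A` (and of `LaurentSeries A`); operators on `A` act coefficientwise.  The shift
`Λ ^ s = exp (s ε ∂)`, `(Λ ^ s f)(x) = f (x + s ε)`, is given by its Taylor expansion. -/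

/-- A (linear) operator on `A` acting coefficientwise on power series in `ε`. -/
noncomputable def psMap {A : Type*} [CommRing A] (d : A → A) (f : PowerSeries A) : PowerSeries A :=
  PowerSeries.mk fun n => d (PowerSeries.coeff n f)

/-- A derivation of `A` acting coefficientwise on Laurent series in `ε`. -/
noncomputable def lsMap {A : Type*} [CommRing A] [Algebra ℂ A] (d : Derivation ℂ A A)
    (f : LaurentSeries A) : LaurentSeries A :=
  HahnSeries.map f d

/-- `Λ ^ s f = ∑ k, (s ε) ^ k / k! • ∂ ^ k f` for a power series `f` in `ε`. -/
noncomputable def psShift {A : Type*} [CommRing A] [Algebra ℂ A] (d : A → A) (s : ℤ)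
    (f : PowerSeries A) : PowerSeries A :=
  PowerSeries.mk fun n => ∑ kl ∈ Finset.HasAntidiagonal.antidiagonal n,
    ((s : ℂ) ^ kl.1 / (kl.1.factorial : ℂ)) • (d^[kl.1] (PowerSeries.coeff kl.2 f))

theorem lsShift_bddBelow {A : Type*} [CommRing A] [Algebra ℂ A] (d : Derivation ℂ A A) (s : ℤ)
    (f : LaurentSeries A) : BddBelow (Function.support fun n : ℤ =>
      ∑ᶠ k : ℕ, ((s : ℂ) ^ k / (k.factorial : ℂ)) • (d^[k] (f.coeff (n - k)))) := by
  refine ⟨f.order, fun n hn => ?_⟩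
  by_contra hlt
  apply hn
  have h0 : ∀ k : ℕ, f.coeff (n - k) = 0 := fun k =>
    HahnSeries.coeff_eq_zero_of_lt_order (by omega)
  have h1 : ∀ k : ℕ, (d^[k]) (0 : A) = 0 := fun k => by
    induction k with
    | zero => rfl
    | succ k ih => rw [Function.iterate_succ_apply', ih, map_zero]
  simp [h0, h1]

/-- `Λ ^ s f = ∑ k, (s ε) ^ k / k! • ∂ ^ k f` for a Laurent series `f` in `ε`
(for each power of `ε` only finitely many `k` contribute). -/
noncomputable def lsShift {A : Type*} [CommRing A] [Algebra ℂ A] (d : Derivation ℂ A A) (s : ℤ)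
    (f : LaurentSeries A) : LaurentSeries A :=
  HahnSeries.ofSuppBddBelow
    (fun n : ℤ => ∑ᶠ k : ℕ, ((s : ℂ) ^ k / (k.factorial : ℂ)) • (d^[k] (f.coeff (n - k))))
    (lsShift_bddBelow d s f)

/-- A power series in `ε` regarded as a Laurent series in `ε`. -/
noncomputable def toLS {A : Type*} [CommRing A] (f : PowerSeries A) : LaurentSeries A :=
  HahnSeries.ofPowerSeries ℤ A f

/-- The Laurent series `ε`. -/
noncomputable def lsEps (A : Type*) [CommRing A] : LaurentSeries A := HahnSeries.single 1 1

/-! ### Difference operators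

A difference operator `∑ k, F k Λ ^ k` is given by its coefficients `F : ℤ → S`; the action of
`Λ ^ k` on the coefficient ring `S` is `σ k`. -/

/-- `(F G) n = ∑ k, F k * Λ ^ k (G (n - k))`.  It is only used where for every `n` all but finitely
many terms vanish. -/
noncomputable def opMul {S : Type*} [CommRing S] (σ : ℤ → S → S) (F G : ℤ → S) : ℤ → S :=
  fun n => ∑ᶠ k : ℤ, F k * σ k (G (n - k))

/-- The operator `Λ ^ k`. -/
def opLambda {S : Type*} [CommRing S] (k : ℤ) : ℤ → S := fun n => if n = k then 1 else 0

/-- `F ^ q`. -/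
noncomputable def opPow {S : Type*} [CommRing S] (σ : ℤ → S → S) (F : ℤ → S) : ℕ → ℤ → S
  | 0 => opLambda 0
  | q + 1 => opMul σ F (opPow σ F q)

/-- The commutator `F G - G F`. -/
noncomputable def opComm {S : Type*} [CommRing S] (σ : ℤ → S → S) (F G : ℤ → S) : ℤ → S :=
  fun n => opMul σ F G n - opMul σ G F n

/-- `(∑ k, F k Λ ^ k)₊ = ∑ k ≥ 0, F k Λ ^ k`. -/
def opPos {S : Type*} [CommRing S] (F : ℤ → S) : ℤ → S := fun n => if 0 ≤ n then F n else 0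

/-- The Lax operator `L = Λ + v + e ^ u Λ ⁻¹`, with `E = e ^ u`. -/
def lax {S : Type*} [CommRing S] (v E : S) : ℤ → S :=
  fun n => if n = 1 then 1 else if n = 0 then v else if n = -1 then E else 0

/-! ### Differential polynomials -/

/-- The jet variables `v ^ (m)` and `u ^ (m)`. -/
inductive JetVar : Type
  | v (m : ℕ) : JetVar
  | u (m : ℕ) : JetVar

/-- Polynomials in `v ^ (m)`, `u ^ (m)` (`m ≥ 0`) and `e ^ u`, `e ^ (-u)`; the variable `T` of
Laurent polynomials is `e ^ u`. -/
abbrev DiffPoly : Type := LaurentPolynomial (MvPolynomial JetVar ℂ)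

/-- The ring `𝓡` of formal power series in `ε` with coefficients differential polynomials. -/
abbrev DiffSeries : Type := PowerSeries DiffPoly

/-- A jet variable as a differential polynomial. -/
noncomputable def jet (i : JetVar) : DiffPoly := LaurentPolynomial.C (MvPolynomial.X i)

/-- The unit `e ^ u`. -/
noncomputable def expU : DiffPolyˣ where
  val := LaurentPolynomial.T 1
  inv := LaurentPolynomial.T (-1)
  val_inv := by rw [← LaurentPolynomial.T_add]; simp
  inv_val := by rw [← LaurentPolynomial.T_add]; simp

/-- Substitution of `w i` for the jet variable `i` and of `E` for `e ^ u`. -/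
noncomputable def substJet {S : Type*} [CommRing S] [Algebra ℂ S] (w : JetVar → S) (E : Sˣ) :
    DiffPoly →+* S :=
  LaurentPolynomial.eval₂ (MvPolynomial.aeval w : MvPolynomial JetVar ℂ →ₐ[ℂ] S).toRingHom E

/-- The unit `e ^ u (1 + δ Y) = e ^ (u + δ Y)` of the dual numbers, `δ ^ 2 = 0`. -/
noncomputable def expUVar {S : Type*} [CommRing S] [Algebra DiffPoly S] (Y : S) :
    (DualNumber S)ˣ where
  val := TrivSqZeroExt.inl (algebraMap DiffPoly S expU.val) *
    (TrivSqZeroExt.inl 1 + TrivSqZeroExt.inr Y)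
  inv := TrivSqZeroExt.inl (algebraMap DiffPoly S expU.inv) *
    (TrivSqZeroExt.inl 1 - TrivSqZeroExt.inr Y)
  val_inv := by
    have h : algebraMap DiffPoly S expU.val * algebraMap DiffPoly S expU.inv = 1 := by
      rw [← map_mul, expU.val_inv, map_one]
    have h2 : (TrivSqZeroExt.inr Y : DualNumber S) * TrivSqZeroExt.inr Y = 0 := by simp
    have h3 : (TrivSqZeroExt.inl (algebraMap DiffPoly S expU.val) : DualNumber S) *
        TrivSqZeroExt.inl (algebraMap DiffPoly S expU.inv) = 1 := by
      rw [← TrivSqZeroExt.inl_mul, h, TrivSqZeroExt.inl_one]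
    rw [TrivSqZeroExt.inl_one]
    linear_combination (1 - TrivSqZeroExt.inr Y * TrivSqZeroExt.inr Y) * h3 - h2
  inv_val := by
    have h : algebraMap DiffPoly S expU.val * algebraMap DiffPoly S expU.inv = 1 := by
      rw [← map_mul, expU.val_inv, map_one]
    have h2 : (TrivSqZeroExt.inr Y : DualNumber S) * TrivSqZeroExt.inr Y = 0 := by simp
    have h3 : (TrivSqZeroExt.inl (algebraMap DiffPoly S expU.val) : DualNumber S) *
        TrivSqZeroExt.inl (algebraMap DiffPoly S expU.inv) = 1 := by
      rw [← TrivSqZeroExt.inl_mul, h, TrivSqZeroExt.inl_one]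
    rw [TrivSqZeroExt.inl_one]
    linear_combination (1 - TrivSqZeroExt.inr Y * TrivSqZeroExt.inr Y) * h3 - h2

/-- The derivation of differential polynomials (with values in `S`) that sends the jet variable `i`
to `W i` and `e ^ u` to `e ^ u * W (u ^ (0))`: the coefficient of `δ` in `f (w + δ W)`. -/
noncomputable def jetDeriv {S : Type*} [CommRing S] [Algebra ℂ S] [Algebra DiffPoly S]
    (W : JetVar → S) (f : DiffPoly) : S :=
  (substJet (S := DualNumber S)
    (fun i => TrivSqZeroExt.inl (algebraMap DiffPoly S (jet i)) + TrivSqZeroExt.inr (W i))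
    (expUVar (W (JetVar.u 0))) f).snd

/-- The total `x`-derivative of a differential polynomial. -/
noncomputable def totalDeriv : DiffPoly → DiffPoly :=
  jetDeriv fun i => match i with
    | JetVar.v m => jet (JetVar.v (m + 1))
    | JetVar.u m => jet (JetVar.u (m + 1))

/-- `∂ₓ` on `𝓡`. -/
noncomputable def dxR : DiffSeries → DiffSeries := psMap totalDeriv

/-- `Λ ^ s` on `𝓡`. -/
noncomputable def shiftR : ℤ → DiffSeries → DiffSeries := psShift totalDeriv

/-- The derivative of an element of `𝓡` along the evolutionary vector field
`∂v/∂t = X`, `∂u/∂t = Y`; it commutes with `∂ₓ` and is `ε`-linear and `ε`-adically continuous. -/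
noncomputable def evolve (X Y : DiffSeries) (f : DiffSeries) : DiffSeries :=
  PowerSeries.mk fun n => ∑ kl ∈ Finset.HasAntidiagonal.antidiagonal n,
    PowerSeries.coeff kl.2 (jetDeriv (S := DiffSeries)
      (fun i => match i with
        | JetVar.v m => dxR^[m] X
        | JetVar.u m => dxR^[m] Y)
      (PowerSeries.coeff kl.1 f))

/-- The degrees `deg v ^ (m) = 1 - m`, `deg u ^ (m) = -m`. -/
def jetDegree : JetVar → ℤ
  | JetVar.v m => 1 - m
  | JetVar.u m => -m

/-- `f ∈ 𝓡` is homogeneous of degree `d`, where moreover `deg e ^ u = 2` and `deg ε = 1`. -/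
def IsHomogeneous (f : DiffSeries) (d : ℚ) : Prop :=
  ∀ (k : ℕ) (n : ℤ) (m : JetVar →₀ ℕ),
    MvPolynomial.coeff m (AddMonoidAlgebra.coeff (PowerSeries.coeff k f) n) ≠ 0 →
      (((m.sum fun i e => (e : ℤ) * jetDegree i) + 2 * n + k : ℤ) : ℚ) = d

/-- `f ∈ 𝓡` has no additive constant: none of its monomials is a constant multiple of a power
of `ε`. -/
def NoConstantTerm (f : DiffSeries) : Prop :=
  ∀ k : ℕ, MvPolynomial.coeff 0 (AddMonoidAlgebra.coeff (PowerSeries.coeff k f) 0) = 0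

/-- The value in `A[[ε]]` of an element of `𝓡` at `v, u ∈ A[[ε]]`, with `E = e ^ u`. -/
noncomputable def evalR {A : Type*} [CommRing A] [Algebra ℂ A] (dx : Derivation ℂ A A)
    (v u : PowerSeries A) (E : (PowerSeries A)ˣ) (f : DiffSeries) : PowerSeries A :=
  PowerSeries.mk fun n => ∑ kl ∈ Finset.HasAntidiagonal.antidiagonal n,
    PowerSeries.coeff kl.2 (substJet
      (fun i => match i with
        | JetVar.v m => (psMap dx)^[m] v
        | JetVar.u m => (psMap dx)^[m] u)
      E (PowerSeries.coeff kl.1 f))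

/-! ### Dressing operators and the logarithm of the Lax operator -/

/-- The dressing operator `P = 1 + ∑ k ≥ 1, p k Λ ^ (-k)`, with inverse `P'`: `L = P Λ P⁻¹`. -/
structure IsDressingP {S : Type*} [CommRing S] (σ : ℤ → S → S) (L P P' : ℤ → S) : Prop where
  zero : P 0 = 1
  pos : ∀ k, 0 < k → P k = 0
  pos' : ∀ k, 0 < k → P' k = 0
  mul_inv : opMul σ P P' = opLambda 0
  inv_mul : opMul σ P' P = opLambda 0
  eq : L = opMul σ (opMul σ P (opLambda 1)) P'

/-- `q₀(x) / q₀(x + k ε)` for a function `q₀` with `q₀(x) / q₀(x - ε) = E(x)`, where `E' = E⁻¹`. -/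
noncomputable def q0Ratio {S : Type*} [CommRing S] (σ : ℤ → S → S) (E E' : S) : ℤ → S
  | Int.ofNat n => ∏ j ∈ Finset.range n, σ ((j : ℤ) + 1) E'
  | Int.negSucc n => ∏ j ∈ Finset.range (n + 1), σ (-(j : ℤ)) E

/-- `q₀ F q₀⁻¹`, whose `k`-th coefficient is `F k (x) * q₀(x) / q₀(x + k ε)`. -/
noncomputable def q0Conj {S : Type*} [CommRing S] (σ : ℤ → S → S) (E E' : S) (F : ℤ → S) : ℤ → S :=
  fun k => F k * q0Ratio σ E E' k

/-- The dressing operator `Q = q₀ (1 + ∑ k ≥ 1, q k Λ ^ k)`: `L = Q Λ⁻¹ Q⁻¹`.  The leading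
coefficient is the formal exponential `q₀ = exp φ` (in general `φ` has a pole in `ε`, so that only
`φ` and the ratios of shifts of `q₀` are series in `ε`), it satisfies `q₀(x) / q₀(x - ε) = e ^ u`;
`Q = q₀ R`, and `R'` is the inverse of `R`. -/
structure IsDressingQ {S : Type*} [CommRing S] (σ : ℤ → S → S) (u E E' : S) (L : ℤ → S)
    (φ : S) (R R' : ℤ → S) : Prop where
  log_ratio : φ - σ (-1) φ = u
  zero : R 0 = 1
  neg : ∀ k, k < 0 → R k = 0
  neg' : ∀ k, k < 0 → R' k = 0
  mul_inv : opMul σ R R' = opLambda 0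
  inv_mul : opMul σ R' R = opLambda 0
  eq : L = q0Conj σ E E' (opMul σ (opMul σ R (opLambda (-1))) R')

/-- `ε Pₓ P⁻¹`, so that `P ε ∂ₓ P⁻¹ = ε ∂ₓ - ε Pₓ P⁻¹`. -/
noncomputable def epsPxPinv {A : Type*} [CommRing A] [Algebra ℂ A] (dx : Derivation ℂ A A)
    (P P' : ℤ → LaurentSeries A) : ℤ → LaurentSeries A :=
  opMul (lsShift dx) (fun k => lsEps A * lsMap dx (P k)) P'

/-- `ε Qₓ Q⁻¹ = ε φₓ + q₀ (ε Rₓ R⁻¹) q₀⁻¹` for `Q = q₀ R`, `q₀ = exp φ`; thus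
`Q ε ∂ₓ Q⁻¹ = ε ∂ₓ - ε Qₓ Q⁻¹`. -/
noncomputable def epsQxQinv {A : Type*} [CommRing A] [Algebra ℂ A] (dx : Derivation ℂ A A)
    (E E' φ : LaurentSeries A) (R R' : ℤ → LaurentSeries A) : ℤ → LaurentSeries A :=
  fun k => lsEps A * lsMap dx φ * opLambda 0 k +
    q0Conj (lsShift dx) E E' (opMul (lsShift dx) (fun k => lsEps A * lsMap dx (R k)) R') k

/-- `G = ∑ k, g k Λ ^ k` with `g k = g k (w, w_x, w_xx, …; ε) ∈ 𝓡` is the logarithm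
`½ (P ε ∂ₓ P⁻¹ - Q ε ∂ₓ Q⁻¹)` of the Lax operator: for all formal power series `v`, `u` in `ε` over
a differential ring `A`, with `E = e ^ u`, and all dressing operators `P`, `Q` of
`L = Λ + v + e ^ u Λ⁻¹`, the coefficients of `½ (ε Qₓ Q⁻¹ - ε Pₓ P⁻¹)` are the values of the `g k`
at `v`, `u`. -/
def IsLogLax (G : ℤ → DiffSeries) : Prop :=
  ∀ (A : Type) [CommRing A] [Algebra ℂ A] (dx : Derivation ℂ A A)
    (v u : PowerSeries A) (E : (PowerSeries A)ˣ) (_ : psMap dx E.val = E.val * psMap dx u)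
    (P P' : ℤ → LaurentSeries A) (φ : LaurentSeries A) (R R' : ℤ → LaurentSeries A)
    (_ : IsDressingP (lsShift dx) (lax (toLS v) (toLS E.val)) P P')
    (_ : IsDressingQ (lsShift dx) (toLS u) (toLS E.val) (toLS E.inv)
      (lax (toLS v) (toLS E.val)) φ R R') (k : ℤ),
    toLS (evalR dx v u E (G k)) = (1 / 2 : ℂ) •
      (epsQxQinv dx (toLS E.val) (toLS E.inv) φ R R' k - epsPxPinv dx P P' k)

/-- `log L`. -/
noncomputable def logLax : ℤ → DiffSeries := Classical.epsilon IsLogLax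

/-! ### The extended Toda hierarchy -/

/-- The values `1`, `2` of the indices `α`, `β`. -/
inductive Label : Type
  | one : Label
  | two : Label

/-- `μ₁ = -1/2`, `μ₂ = 1/2`. -/
def mu : Label → ℚ
  | Label.one => -1 / 2
  | Label.two => 1 / 2

/-- The Lax operator with coefficients in `𝓡`. -/
noncomputable def laxR : ℤ → DiffSeries :=
  lax (PowerSeries.C (jet (JetVar.v 0))) (PowerSeries.C expU.val)

/-- `L ^ q (log L - c_q)` with `c_q = 1 + 1/2 + ⋯ + 1/q`, `c₀ = 0`. -/
noncomputable def laxPowLog (q : ℕ) : ℤ → DiffSeries :=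
  opMul shiftR (opPow shiftR laxR q)
    (fun k => logLax k - ((harmonic q : ℚ) : ℂ) • opLambda 0 k)

/-- `A_{1,q} = 2 / q! [L ^ q (log L - c_q)]₊`, `A_{2,q} = 1 / (q + 1)! [L ^ (q + 1)]₊`. -/
noncomputable def opA : Label → ℕ → ℤ → DiffSeries
  | Label.one, q => fun k => (2 / (q.factorial : ℂ)) • opPos (laxPowLog q) k
  | Label.two, q => fun k => (1 / ((q + 1).factorial : ℂ)) • opPos (opPow shiftR laxR (q + 1)) k

/-- Division by `ε` of an element of `𝓡` that is divisible by `ε`. -/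
noncomputable def divEps (f : DiffSeries) : DiffSeries :=
  PowerSeries.mk fun n => PowerSeries.coeff (n + 1) f

/-- The derivation `∂/∂t^{β,q}` of `𝓡` given by `ε ∂L/∂t^{β,q} = [A_{β,q}, L]`, that is, by
`ε ∂v/∂t = [A, L]₀` and `ε e ^ u ∂u/∂t = [A, L]₋₁`. -/
noncomputable def flow (β : Label) (q : ℕ) : DiffSeries → DiffSeries :=
  evolve (divEps (opComm shiftR (opA β q) laxR 0))
    (divEps (opComm shiftR (opA β q) laxR (-1) * PowerSeries.C expU.inv))

/-- `hamPred α p` is the Hamiltonian density `h_{α,p-1}`, `p ≥ 0`: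
`h_{1,p-1} = 2 / p! res [L ^ p (log L - c_p)]`, `h_{2,p-1} = 1 / (p + 1)! res L ^ (p + 1)`. -/
noncomputable def hamPred : Label → ℕ → DiffSeries
  | Label.one, p => (2 / (p.factorial : ℂ)) • laxPowLog p 0
  | Label.two, p => (1 / ((p + 1).factorial : ℂ)) • opPow shiftR laxR (p + 1) 0

/-- `f = Ω_{α,p;β,q}`: the homogeneous element of `𝓡` of degree `p + q + 1 + μ_α + μ_β` without
additive constant such that `(Λ - 1) Ω_{α,p;β,q} = ε ∂h_{α,p-1}/∂t^{β,q}`. -/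
structure IsOmega (α : Label) (p : ℕ) (β : Label) (q : ℕ) (f : DiffSeries) : Prop where
  eq : shiftR 1 f - f = PowerSeries.X * flow β q (hamPred α p)
  homogeneous : IsHomogeneous f (p + q + 1 + mu α + mu β)
  noConstant : NoConstantTerm f

/-- `Ω_{α,p;β,q}`. -/
noncomputable def Omega (α : Label) (p : ℕ) (β : Label) (q : ℕ) : DiffSeries :=
  Classical.epsilon (IsOmega α p β q)

/-- `(v, u)`, with `E = e ^ u`, is a solution of the extended Toda hierarchy in `A[[ε]]`, where `A`
is a ring of functions of `x` and of the times `t^{β,q}` with derivations `∂ₓ = dx` and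
`∂/∂t^{β,q} = dt β q`: the equations `ε ∂L/∂t^{β,q} = [A_{β,q}, L]` hold. -/
structure IsSolution {A : Type*} [CommRing A] [Algebra ℂ A] (dx : Derivation ℂ A A)
    (dt : Label → ℕ → Derivation ℂ A A) (v u : PowerSeries A) (E : (PowerSeries A)ˣ) : Prop where
  exp_dx : psMap dx E.val = E.val * psMap dx u
  exp_dt : ∀ β q, psMap (dt β q) E.val = E.val * psMap (dt β q) u
  lax_eq : ∀ β q k, PowerSeries.X * psMap (dt β q) (lax v E.val k) =
    evalR dx v u E (opComm shiftR (opA β q) laxR k)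

/-! ### Tau functions -/

/-- Formal exponentials `τ = exp ℓ` of Laurent series `ℓ` in `ε`, a multiplicative group. -/
abbrev FormalExp (A : Type*) [CommRing A] : Type _ := Multiplicative (LaurentSeries A)

/-- `log τ`. -/
def FormalExp.log {A : Type*} [CommRing A] (τ : FormalExp A) : LaurentSeries A :=
  Multiplicative.toAdd τ

/-- `τ(x + s ε)`. -/
noncomputable def FormalExp.shift {A : Type*} [CommRing A] [Algebra ℂ A] (dx : Derivation ℂ A A)
    (s : ℤ) (τ : FormalExp A) : FormalExp A :=
  Multiplicative.ofAdd (lsShift dx s (FormalExp.log τ))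

/-- `τ` is a tau function of the solution `(v, u)`:
`Ω_{α,p;β,q} = ε² ∂² log τ / ∂t^{α,p} ∂t^{β,q}` and `∂ log τ / ∂t^{1,0} = ∂ log τ / ∂x`. -/
structure IsTau {A : Type*} [CommRing A] [Algebra ℂ A] (dx : Derivation ℂ A A)
    (dt : Label → ℕ → Derivation ℂ A A) (v u : PowerSeries A) (E : (PowerSeries A)ˣ)
    (τ : FormalExp A) : Prop where
  omega_eq : ∀ α p β q, toLS (evalR dx v u E (Omega α p β q)) =
    lsEps A ^ 2 * lsMap (dt α p) (lsMap (dt β q) (FormalExp.log τ))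
  dt_one_zero : lsMap (dt Label.one 0) (FormalExp.log τ) = lsMap dx (FormalExp.log τ)

end ExtToda

/-!
The identity for the densities comes from the single flow `∂/∂t^{1,0}`.  This flow is `∂ₓ`, because
`2 (log L)₊ = ε Qₓ Q⁻¹` and `[ε Qₓ Q⁻¹, L] = ε Lₓ` (`flow_one_zero`).  Hence the condition on
`Ω_{α,p;1,0}` reads `(Λ - 1) Ω = ε ∂ₓ h_{α,p-1}`, and since `Λ - 1` kills only the constants of `𝓡`,
`Ω_{α,p;1,0} = (ε ∂ₓ / (Λ - 1)) h_{α,p-1}` (`Omega_one_zero`).  On the other hand the value of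
`Ω_{α,p;1,0}` is `ε² ∂ₓ ∂ log τ / ∂t^{α,p}`; applying the operator `(Λ - 1) / (ε ∂ₓ)`, a power series
in `ε ∂ₓ` with constant term `1`, gives `h_{α,p-1} = ε (Λ - 1) ∂ log τ / ∂t^{α,p}`.  The formulas for
`v` and `u` follow from `h_{2,-1} = v` and `h_{1,-1} = (ε ∂ₓ / (1 - Λ⁻¹)) u`.

Most of the work goes into facts on which this rests.

* `logLax` is specified by its values at all dressing operators, so its existence and uniqueness are
  needed (`logLax_eq`).  For existence, put `T F = L F Λ⁻¹ - F`.  From `L = P Λ P⁻¹` one gets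
  `T ^ j 1 = P ((Λ - 1) ^ j P⁻¹)`, with `Λ - 1` acting on coefficients, and therefore the logarithmic
  series `∑ (-1) ^ j / (j + 1) T ^ (j + 1) 1` converges `ε`-adically to `P (ε ∂ₓ P⁻¹) = -ε Pₓ P⁻¹`,
  because `log (exp z) = z` (`exists_coeff_sum_iterDiff`).  The left-hand side does not involve `P`,
  and its coefficients are differential polynomials.  The operator `Q` is reduced to the same
  computation by exchanging `Λ` and `Λ⁻¹`.  For uniqueness, dressing operators exist over
  `DiffPoly[[x]]`, where `d/dx` is surjective, and evaluation at the generic point is injective.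

* The kernel of the total derivative consists of the constants (`coeff_eq_zero_of_totalD`).

* The candidate for `Ω_{α,p;1,0}` has to be homogeneous without additive constant, hence so has
  `h_{α,p-1}`.  Both properties follow from a grading (`gradedSeries`) that also records that `ε`
  occurs only in monomials that contain a jet variable.
-/

namespace ExtToda

/-! ### Operators on series in `ε` -/

section Extend

variable {A B : Type*} [CommRing A] [CommRing B]

/-- The `ε`-linear, `ε`-adically continuous extension `∑ aₙ εⁿ ↦ ∑ φ(aₙ) εⁿ` of an additive map
`φ : A → B[[ε]]`. -/
noncomputable def extend (φ : A →+ PowerSeries B) : PowerSeries A →+ PowerSeries B where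
  toFun f := PowerSeries.mk fun n => ∑ kl ∈ Finset.HasAntidiagonal.antidiagonal n,
    PowerSeries.coeff kl.2 (φ (PowerSeries.coeff kl.1 f))
  map_zero' := by ext n; simp
  map_add' f g := by ext n; simp [Finset.sum_add_distrib]

theorem coeff_extend (φ : A →+ PowerSeries B) (f : PowerSeries A) (n : ℕ) :
    PowerSeries.coeff n (extend φ f) = ∑ kl ∈ Finset.HasAntidiagonal.antidiagonal n,
      PowerSeries.coeff kl.2 (φ (PowerSeries.coeff kl.1 f)) := by
  simp [extend]

theorem extend_X_mul (φ : A →+ PowerSeries B) (f : PowerSeries A) :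
    extend φ (PowerSeries.X * f) = PowerSeries.X * extend φ f := by
  ext n
  cases n with
  | zero => simp [coeff_extend]
  | succ n =>
    rw [coeff_extend, PowerSeries.coeff_succ_X_mul, coeff_extend,
      Finset.Nat.antidiagonal_succ, Finset.sum_cons, Finset.sum_map]
    simp [PowerSeries.coeff_succ_X_mul]

theorem extend_C (φ : A →+ PowerSeries B) (a : A) : extend φ (PowerSeries.C a) = φ a := by
  ext n
  rw [coeff_extend, Finset.sum_eq_single (0, n)]
  · simp
  · rintro ⟨k, l⟩ hkl hne
    have hk : k ≠ 0 := by
      rintro rfl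
      simp at hkl
      exact hne (by simp [hkl])
    simp [PowerSeries.coeff_C, hk]
  · simp

/-- Two additive maps that commute with multiplication by `ε` and agree on constants agree. -/
theorem eq_of_X_mul (F G : PowerSeries A →+ PowerSeries B)
    (hF : ∀ f, F (PowerSeries.X * f) = PowerSeries.X * F f)
    (hG : ∀ f, G (PowerSeries.X * f) = PowerSeries.X * G f)
    (h : ∀ a, F (PowerSeries.C a) = G (PowerSeries.C a)) (f : PowerSeries A) : F f = G f := by
  ext n
  induction n generalizing f with
  | zero =>
    rw [PowerSeries.eq_X_mul_shift_add_const f]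
    simp [hF, hG, h]
  | succ n ih =>
    rw [PowerSeries.eq_X_mul_shift_add_const f]
    simp only [map_add, hF, hG, h, PowerSeries.coeff_succ_X_mul, ih]

theorem extend_extend {D : Type*} [CommRing D] (φ : B →+ PowerSeries D) (ψ : A →+ PowerSeries B)
    (f : PowerSeries A) : extend φ (extend ψ f) = extend ((extend φ).comp ψ) f := by
  refine eq_of_X_mul ((extend φ).comp (extend ψ)) (extend ((extend φ).comp ψ)) ?_ ?_ ?_ f
  · intro f; simp [extend_X_mul]
  · intro f; exact extend_X_mul _ _
  · intro a; simp [extend_C]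

theorem extend_mul (φ : A →+* PowerSeries B) (f g : PowerSeries A) :
    extend φ.toAddMonoidHom (f * g) = extend φ.toAddMonoidHom f * extend φ.toAddMonoidHom g := by
  refine eq_of_X_mul ((extend φ.toAddMonoidHom).comp (AddMonoidHom.mulRight g))
    ((AddMonoidHom.mulRight (extend φ.toAddMonoidHom g)).comp (extend φ.toAddMonoidHom))
    ?_ ?_ ?_ f
  · intro f; simp [extend_X_mul, mul_assoc]
  · intro f; simp [extend_X_mul, mul_assoc]
  · intro a
    refine eq_of_X_mul ((extend φ.toAddMonoidHom).comp (AddMonoidHom.mulLeft (PowerSeries.C a)))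
      ((AddMonoidHom.mulLeft (extend φ.toAddMonoidHom (PowerSeries.C a))).comp
        (extend φ.toAddMonoidHom)) ?_ ?_ ?_ g
    · intro f; simp [extend_X_mul, mul_left_comm]
    · intro f; simp [extend_X_mul, mul_left_comm]
    · intro b
      simp only [AddMonoidHom.comp_apply, AddMonoidHom.coe_mulLeft, ← map_mul, extend_C]
      exact map_mul φ a b

/-- The extension of a ring homomorphism `A → B[[ε]]` to `A[[ε]]`. -/
noncomputable def extendHom (φ : A →+* PowerSeries B) : PowerSeries A →+* PowerSeries B :=
  { extend φ.toAddMonoidHom with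
    map_one' := by
      have := extend_C φ.toAddMonoidHom (1 : A)
      rw [map_one] at this
      exact this.trans (map_one φ)
    map_mul' := extend_mul φ }

end Extend

section PsOp

variable {A : Type*} [CommRing A] [Algebra ℂ A]

theorem iterate_map_smul' (d : Derivation ℂ A A) (k : ℕ) (r : ℂ) (a : A) :
    d^[k] (r • a) = r • d^[k] a := by
  induction k with
  | zero => rfl
  | succ k ih =>
    rw [Function.iterate_succ_apply', ih, Derivation.map_smul, Function.iterate_succ_apply']

theorem iterate_leibniz (d : Derivation ℂ A A) (n : ℕ) (a b : A) :
    d^[n] (a * b) = ∑ ij ∈ Finset.HasAntidiagonal.antidiagonal n,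
      n.choose ij.1 • (d^[ij.1] a * d^[ij.2] b) := by
  induction n with
  | zero => simp
  | succ n ih =>
    rw [Finset.sum_antidiagonal_choose_succ_nsmul (M := A) (fun i j => d^[i] a * d^[j] b) n]
    simp only [Function.iterate_succ_apply', ih, map_sum, map_nsmul, Derivation.leibniz,
      smul_eq_mul, smul_add, Finset.sum_add_distrib]
    congr 1
    refine Finset.sum_congr rfl fun ij hij => ?_
    rw [n.choose_symm_of_eq_add (Finset.HasAntidiagonal.mem_antidiagonal.1 hij).symm, mul_comm]

/-- `a ↦ ∑ cₖ εᵏ ∂ᵏ a`. -/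
noncomputable def symbolMap (d : Derivation ℂ A A) (c : PowerSeries ℂ) : A →+ PowerSeries A where
  toFun a := PowerSeries.mk fun k => PowerSeries.coeff k c • d^[k] a
  map_zero' := by ext n; simp [iterate_map_zero]
  map_add' a b := by ext n; simp [iterate_map_add]

/-- The operator `c(ε ∂) = ∑ cₖ (ε ∂)ᵏ` on `A[[ε]]`, for a formal power series `c(z) = ∑ cₖ zᵏ`. -/
noncomputable def psOp (d : Derivation ℂ A A) (c : PowerSeries ℂ) :
    PowerSeries A →+ PowerSeries A := extend (symbolMap d c)

theorem coeff_psOp (d : Derivation ℂ A A) (c : PowerSeries ℂ) (f : PowerSeries A) (n : ℕ) :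
    PowerSeries.coeff n (psOp d c f) = ∑ kl ∈ Finset.HasAntidiagonal.antidiagonal n,
      PowerSeries.coeff kl.1 c • d^[kl.1] (PowerSeries.coeff kl.2 f) := by
  rw [psOp, coeff_extend, ← Finset.Nat.sum_antidiagonal_swap]
  simp [symbolMap]

theorem psOp_X_mul (d : Derivation ℂ A A) (c : PowerSeries ℂ) (f : PowerSeries A) :
    psOp d c (PowerSeries.X * f) = PowerSeries.X * psOp d c f := extend_X_mul _ _

theorem psOp_X_pow_mul (d : Derivation ℂ A A) (c : PowerSeries ℂ) (k : ℕ) (f : PowerSeries A) :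
    psOp d c (PowerSeries.X ^ k * f) = PowerSeries.X ^ k * psOp d c f := by
  induction k with
  | zero => simp
  | succ k ih => rw [pow_succ', mul_assoc, psOp_X_mul, ih, mul_assoc]

theorem psOp_mul (d : Derivation ℂ A A) (c c' : PowerSeries ℂ) (f : PowerSeries A) :
    psOp d (c * c') f = psOp d c (psOp d c' f) := by
  rw [psOp, psOp, psOp, extend_extend]
  congr 2
  ext a n
  simp only [AddMonoidHom.comp_apply, coeff_extend]
  rw [← Finset.Nat.sum_antidiagonal_swap]
  simp only [symbolMap, AddMonoidHom.coe_mk, ZeroHom.coe_mk, PowerSeries.coeff_mk,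
    PowerSeries.coeff_mul, Finset.sum_smul, Prod.fst_swap, Prod.snd_swap, iterate_map_smul',
    smul_smul, ← Function.iterate_add_apply]
  refine Finset.sum_congr rfl fun kl h => ?_
  rw [Finset.HasAntidiagonal.mem_antidiagonal.1 h]

theorem psOp_add (d : Derivation ℂ A A) (c c' : PowerSeries ℂ) (f : PowerSeries A) :
    psOp d (c + c') f = psOp d c f + psOp d c' f := by
  ext n; simp [coeff_psOp, add_smul, Finset.sum_add_distrib]

theorem psOp_smul (d : Derivation ℂ A A) (r : ℂ) (c : PowerSeries ℂ) (f : PowerSeries A) :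
    psOp d (r • c) f = r • psOp d c f := by
  ext n; simp [coeff_psOp, mul_smul, Finset.smul_sum]

theorem psOp_one (d : Derivation ℂ A A) (f : PowerSeries A) : psOp d 1 f = f := by
  ext n
  rw [coeff_psOp, Finset.sum_eq_single (0, n)]
  · simp
  · rintro ⟨k, l⟩ hkl hne
    have hk : k ≠ 0 := by
      rintro rfl
      simp at hkl
      exact hne (by simp [hkl])
    simp [PowerSeries.coeff_one, hk]
  · simp

theorem psOp_X (d : Derivation ℂ A A) (f : PowerSeries A) :
    psOp d PowerSeries.X f = PowerSeries.X * psMap d f := by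
  refine eq_of_X_mul (psOp d PowerSeries.X)
    { toFun := fun f => PowerSeries.X * psMap d f
      map_zero' := by ext n; cases n <;> simp [psMap, PowerSeries.coeff_succ_X_mul]
      map_add' := fun f g => by ext n; cases n <;> simp [psMap, PowerSeries.coeff_succ_X_mul] }
    ?_ ?_ ?_ f
  · intro f; exact psOp_X_mul _ _ _
  · intro f
    simp only [AddMonoidHom.coe_mk, ZeroHom.coe_mk]
    congr 1
    ext n; cases n <;> simp [psMap, PowerSeries.coeff_succ_X_mul]
  · intro a
    simp only [AddMonoidHom.coe_mk, ZeroHom.coe_mk, psOp, extend_C]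
    ext n
    rcases n with _ | _ | n <;>
      simp [symbolMap, psMap, PowerSeries.coeff_succ_X_mul, PowerSeries.coeff_X,
        PowerSeries.coeff_C]

theorem psOp_map_smul (d : Derivation ℂ A A) (c : PowerSeries ℂ) (r : ℂ) (f : PowerSeries A) :
    psOp d c (r • f) = r • psOp d c f := by
  have h : ∀ g, psOp d (r • 1) g = r • g := fun g => by rw [psOp_smul, psOp_one]
  rw [← h, ← h, ← psOp_mul, ← psOp_mul, mul_comm]

theorem psOp_sub (d : Derivation ℂ A A) (c c' : PowerSeries ℂ) (f : PowerSeries A) :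
    psOp d (c - c') f = psOp d c f - psOp d c' f := by
  rw [eq_sub_iff_add_eq, ← psOp_add, sub_add_cancel]

theorem psOp_neg_derivation (d : Derivation ℂ A A) (c : PowerSeries ℂ) (f : PowerSeries A) :
    psOp (-d) c f = psOp d (PowerSeries.rescale (-1 : ℂ) c) f := by
  have h : ∀ (k : ℕ) (a : A), (-d)^[k] a = (-1 : ℂ) ^ k • d^[k] a := by
    intro k a
    induction k with
    | zero => simp
    | succ k ih =>
      rw [Function.iterate_succ_apply', ih, Derivation.map_smul, Function.iterate_succ_apply',
        Derivation.neg_apply, pow_succ, mul_smul, neg_smul, one_smul]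
  ext n
  rw [coeff_psOp, coeff_psOp]
  refine Finset.sum_congr rfl fun kl _ => ?_
  rw [h, PowerSeries.coeff_rescale, smul_smul, mul_comm]

/-- The power series `exp (s z)`. -/
noncomputable def expS (s : ℤ) : PowerSeries ℂ := PowerSeries.rescale (s : ℂ) (PowerSeries.exp ℂ)

theorem coeff_expS (s : ℤ) (k : ℕ) :
    PowerSeries.coeff k (expS s) = (s : ℂ) ^ k / (k.factorial : ℂ) := by
  simp [expS, PowerSeries.coeff_rescale, PowerSeries.coeff_exp, div_eq_mul_inv]

theorem expS_add (s t : ℤ) : expS (s + t) = expS s * expS t := by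
  have := PowerSeries.exp_mul_exp_eq_exp_add (A := ℂ) (s : ℂ) (t : ℂ)
  simp only [expS, this]
  push_cast
  rfl

theorem expS_zero : expS 0 = 1 := by
  ext n
  rw [coeff_expS, PowerSeries.coeff_one]
  cases n <;> simp

theorem rescale_expS (s : ℤ) : PowerSeries.rescale (-1 : ℂ) (expS s) = expS (-s) := by
  ext n
  rw [PowerSeries.coeff_rescale, coeff_expS, coeff_expS]
  push_cast
  rw [neg_pow (s : ℂ)]
  ring

theorem psShift_eq_psOp (d : Derivation ℂ A A) (s : ℤ) (f : PowerSeries A) :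
    psShift d s f = psOp d (expS s) f := by
  ext n
  rw [coeff_psOp, psShift, PowerSeries.coeff_mk]
  simp only [coeff_expS]

/-- The Taylor expansion `a ↦ exp (s ε ∂) a` as a ring homomorphism. -/
noncomputable def taylorHom (d : Derivation ℂ A A) (s : ℤ) : A →+* PowerSeries A :=
  { symbolMap d (expS s) with
    map_one' := by
      ext n
      rcases n with _ | n
      · simp [symbolMap, coeff_expS]
      · simp [symbolMap, coeff_expS, PowerSeries.coeff_one, iterate_map_zero]
    map_mul' := fun a b => by
      ext n
      simp only [symbolMap, ZeroHom.toFun_eq_coe, ZeroHom.coe_mk, PowerSeries.coeff_mk,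
        PowerSeries.coeff_mul, coeff_expS, iterate_leibniz, Finset.smul_sum]
      refine Finset.sum_congr rfl fun ij h => ?_
      rw [smul_mul_smul_comm, ← Nat.cast_smul_eq_nsmul ℂ, smul_smul]
      congr 1
      obtain rfl := Finset.HasAntidiagonal.mem_antidiagonal.1 h
      rw [Nat.cast_add_choose, pow_add]
      have h1 : ((ij.1 + ij.2).factorial : ℂ) ≠ 0 := by exact_mod_cast Nat.factorial_ne_zero _
      field_simp }

/-- `Λ ^ s` as a ring homomorphism of `A[[ε]]`. -/
noncomputable def psShiftHom (d : Derivation ℂ A A) (s : ℤ) : PowerSeries A →+* PowerSeries A :=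
  extendHom (taylorHom d s)

theorem psShiftHom_apply (d : Derivation ℂ A A) (s : ℤ) (f : PowerSeries A) :
    psShiftHom d s f = psShift d s f := by
  rw [psShift_eq_psOp]; rfl

theorem psMap_mul (d : Derivation ℂ A A) (f g : PowerSeries A) :
    psMap d (f * g) = f * psMap d g + g * psMap d f := by
  ext n
  simp only [psMap, PowerSeries.coeff_mk, map_add, PowerSeries.coeff_mul, map_sum,
    Derivation.leibniz, smul_eq_mul, Finset.sum_add_distrib]
  congr 1
  rw [← Finset.Nat.sum_antidiagonal_swap]
  simp

end PsOp

section LsOp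

variable {A : Type*} [CommRing A]

theorem toLS_mul (f g : PowerSeries A) : toLS (f * g) = toLS f * toLS g := map_mul _ _ _

theorem toLS_add (f g : PowerSeries A) : toLS (f + g) = toLS f + toLS g := map_add _ _ _

theorem toLS_injective : Function.Injective (toLS : PowerSeries A → LaurentSeries A) :=
  HahnSeries.ofPowerSeries_injective

theorem toLS_X : toLS (PowerSeries.X : PowerSeries A) = lsEps A := HahnSeries.ofPowerSeries_X

theorem coeff_single_mul_toLS (N : ℤ) (g : PowerSeries A) (n : ℕ) :
    (HahnSeries.single N (1 : A) * toLS g).coeff (n + N) = PowerSeries.coeff n g := by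
  rw [HahnSeries.coeff_single_mul_add, one_mul]
  exact HahnSeries.ofPowerSeries_apply_coeff g n

theorem coeff_single_mul_toLS_of_lt (N : ℤ) (g : PowerSeries A) (i : ℤ) (h : i < N) :
    (HahnSeries.single N (1 : A) * toLS g).coeff i = 0 := by
  have : i = (i - N) + N := by ring
  rw [this, HahnSeries.coeff_single_mul_add, one_mul]
  exact HahnSeries.embDomain_of_notMem_range (by rintro ⟨m, hm⟩; simp at hm; omega)

theorem exists_eq_single_mul (f : LaurentSeries A) (N : ℤ) (h : ∀ i < N, f.coeff i = 0) :
    ∃ g : PowerSeries A, f = HahnSeries.single N 1 * toLS g := by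
  refine ⟨PowerSeries.mk fun n => f.coeff (n + N), ?_⟩
  ext i
  by_cases hi : i < N
  · rw [h i hi, coeff_single_mul_toLS_of_lt _ _ _ hi]
  · obtain ⟨n, rfl⟩ : ∃ n : ℕ, i = n + N := ⟨(i - N).toNat, by omega⟩
    rw [coeff_single_mul_toLS, PowerSeries.coeff_mk]

theorem exists_lower_bound (f : LaurentSeries A) : ∃ N : ℤ, ∀ i < N, f.coeff i = 0 :=
  ⟨f.order, fun _ h => HahnSeries.coeff_eq_zero_of_lt_order h⟩

theorem exists_rep (f : LaurentSeries A) :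
    ∃ (N : ℤ) (g : PowerSeries A), f = HahnSeries.single N 1 * toLS g :=
  let ⟨N, h⟩ := exists_lower_bound f
  ⟨N, exists_eq_single_mul f N h⟩

theorem single_mul_toLS_injective (N : ℤ) {g g' : PowerSeries A}
    (h : HahnSeries.single N (1 : A) * toLS g = HahnSeries.single N 1 * toLS g') : g = g' := by
  ext n
  rw [← coeff_single_mul_toLS N g n, h, coeff_single_mul_toLS]

theorem single_add_mul_toLS (N : ℤ) (k : ℕ) (g : PowerSeries A) :
    HahnSeries.single (N + k) (1 : A) * toLS g =
      HahnSeries.single N 1 * toLS (PowerSeries.X ^ k * g) := by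
  rw [toLS_mul, ← mul_assoc, toLS, toLS, map_pow, HahnSeries.ofPowerSeries_X]
  simp

/-- Two Laurent series have a representation with a common power of `ε`. -/
theorem exists_rep₂ (f f' : LaurentSeries A) : ∃ (N : ℤ) (g g' : PowerSeries A),
    f = HahnSeries.single N 1 * toLS g ∧ f' = HahnSeries.single N 1 * toLS g' := by
  obtain ⟨N, h⟩ := exists_lower_bound f
  obtain ⟨N', h'⟩ := exists_lower_bound f'
  obtain ⟨g, hg⟩ := exists_eq_single_mul f (min N N') fun i hi => h i (by omega)
  obtain ⟨g', hg'⟩ := exists_eq_single_mul f' (min N N') fun i hi => h' i (by omega)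
  exact ⟨_, g, g', hg, hg'⟩

variable [Algebra ℂ A]

/-- The operator `c(ε ∂)` on `A((ε))`, on the representation `f = ε ^ N g` with `g ∈ A[[ε]]`. -/
noncomputable def lsOp (d : Derivation ℂ A A) (c : PowerSeries ℂ) (f : LaurentSeries A) :
    LaurentSeries A :=
  HahnSeries.single (exists_rep f).choose 1 * toLS (psOp d c (exists_rep f).choose_spec.choose)

theorem lsOp_single_mul (d : Derivation ℂ A A) (c : PowerSeries ℂ) (N : ℤ) (g : PowerSeries A) :
    lsOp d c (HahnSeries.single N 1 * toLS g) = HahnSeries.single N 1 * toLS (psOp d c g) := by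
  have key : ∀ (M M' : ℤ) (h h' : PowerSeries A), M ≤ M' →
      HahnSeries.single M (1 : A) * toLS h = HahnSeries.single M' 1 * toLS h' →
      HahnSeries.single M (1 : A) * toLS (psOp d c h) =
        HahnSeries.single M' 1 * toLS (psOp d c h') := by
    intro M M' h h' hM he
    obtain ⟨k, rfl⟩ := Int.le.dest hM
    rw [single_add_mul_toLS] at he ⊢
    rw [single_mul_toLS_injective _ he, psOp_X_pow_mul]
  have hs := (exists_rep (HahnSeries.single N (1 : A) * toLS g)).choose_spec.choose_spec
  rw [lsOp]
  rcases le_total (exists_rep (HahnSeries.single N (1 : A) * toLS g)).choose N with hle | hle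
  · exact key _ _ _ _ hle hs.symm
  · exact (key _ _ _ _ hle hs).symm

theorem lsOp_toLS (d : Derivation ℂ A A) (c : PowerSeries ℂ) (g : PowerSeries A) :
    lsOp d c (toLS g) = toLS (psOp d c g) := by
  have := lsOp_single_mul d c 0 g
  simpa using this

theorem lsOp_map_add (d : Derivation ℂ A A) (c : PowerSeries ℂ) (f f' : LaurentSeries A) :
    lsOp d c (f + f') = lsOp d c f + lsOp d c f' := by
  obtain ⟨N, g, g', rfl, rfl⟩ := exists_rep₂ f f'
  rw [← mul_add, ← toLS_add, lsOp_single_mul, lsOp_single_mul, lsOp_single_mul, map_add, toLS_add,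
    mul_add]

theorem lsOp_mul (d : Derivation ℂ A A) (c c' : PowerSeries ℂ) (f : LaurentSeries A) :
    lsOp d (c * c') f = lsOp d c (lsOp d c' f) := by
  obtain ⟨N, g, rfl⟩ := exists_rep f
  rw [lsOp_single_mul, lsOp_single_mul, lsOp_single_mul, psOp_mul]

theorem lsOp_add (d : Derivation ℂ A A) (c c' : PowerSeries ℂ) (f : LaurentSeries A) :
    lsOp d (c + c') f = lsOp d c f + lsOp d c' f := by
  obtain ⟨N, g, rfl⟩ := exists_rep f
  rw [lsOp_single_mul, lsOp_single_mul, lsOp_single_mul, psOp_add, toLS_add, mul_add]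

theorem lsOp_one (d : Derivation ℂ A A) (f : LaurentSeries A) : lsOp d 1 f = f := by
  obtain ⟨N, g, rfl⟩ := exists_rep f
  rw [lsOp_single_mul, psOp_one]

theorem lsOp_sub (d : Derivation ℂ A A) (c c' : PowerSeries ℂ) (f : LaurentSeries A) :
    lsOp d (c - c') f = lsOp d c f - lsOp d c' f := by
  rw [eq_sub_iff_add_eq, ← lsOp_add, sub_add_cancel]

theorem ls_mul_smul (r : ℂ) (f g : LaurentSeries A) : f * (r • g) = r • (f * g) := by
  have h : ∀ x : LaurentSeries A, r • x = HahnSeries.C (algebraMap ℂ A r) * x := fun x => by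
    ext i
    rw [HahnSeries.C_mul_eq_smul, HahnSeries.coeff_smul, HahnSeries.coeff_smul, Algebra.smul_def,
      smul_eq_mul]
  rw [h, h, mul_left_comm]

theorem toLS_smul (r : ℂ) (g : PowerSeries A) : toLS (r • g) = r • toLS g := by
  ext i
  by_cases hi : i < 0
  · have h1 := coeff_single_mul_toLS_of_lt 0 g i hi
    have h2 := coeff_single_mul_toLS_of_lt 0 (r • g) i hi
    simp at h1 h2
    simp [h1, h2]
  · obtain ⟨n, rfl⟩ : ∃ n : ℕ, i = n := ⟨i.toNat, by omega⟩
    have h1 := coeff_single_mul_toLS 0 g n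
    have h2 := coeff_single_mul_toLS 0 (r • g) n
    simp at h1 h2
    simp [h1, h2]

theorem lsOp_smul (d : Derivation ℂ A A) (r : ℂ) (c : PowerSeries ℂ) (f : LaurentSeries A) :
    lsOp d (r • c) f = r • lsOp d c f := by
  obtain ⟨N, g, rfl⟩ := exists_rep f
  rw [lsOp_single_mul, lsOp_single_mul, psOp_smul, toLS_smul, ls_mul_smul]

theorem lsMap_single_mul (d : Derivation ℂ A A) (N : ℤ) (g : PowerSeries A) :
    lsMap d (HahnSeries.single N 1 * toLS g) = HahnSeries.single N 1 * toLS (psMap d g) := by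
  ext i
  simp only [lsMap, HahnSeries.map_coeff]
  by_cases hi : i < N
  · simp [coeff_single_mul_toLS_of_lt _ _ _ hi]
  · obtain ⟨n, rfl⟩ : ∃ n : ℕ, i = n + N := ⟨(i - N).toNat, by omega⟩
    simp [coeff_single_mul_toLS, psMap]

theorem lsOp_X (d : Derivation ℂ A A) (f : LaurentSeries A) :
    lsOp d PowerSeries.X f = lsEps A * lsMap d f := by
  obtain ⟨N, g, rfl⟩ := exists_rep f
  rw [lsOp_single_mul, psOp_X, lsMap_single_mul, toLS_mul, toLS_X, mul_left_comm]

theorem lsOp_eps_mul (d : Derivation ℂ A A) (c : PowerSeries ℂ) (f : LaurentSeries A) :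
    lsOp d c (lsEps A * f) = lsEps A * lsOp d c f := by
  obtain ⟨N, g, rfl⟩ := exists_rep f
  rw [← toLS_X, mul_left_comm, ← toLS_mul, lsOp_single_mul, lsOp_single_mul, psOp_X_mul, toLS_mul,
    mul_left_comm]

theorem lsOp_neg_derivation (d : Derivation ℂ A A) (c : PowerSeries ℂ) (f : LaurentSeries A) :
    lsOp (-d) c f = lsOp d (PowerSeries.rescale (-1 : ℂ) c) f := by
  obtain ⟨N, g, rfl⟩ := exists_rep f
  rw [lsOp_single_mul, lsOp_single_mul, psOp_neg_derivation]

theorem lsShift_eq_lsOp (d : Derivation ℂ A A) (s : ℤ) (f : LaurentSeries A) :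
    lsShift d s f = lsOp d (expS s) f := by
  obtain ⟨N, g, rfl⟩ := exists_rep f
  rw [lsOp_single_mul]
  ext i
  rw [lsShift, HahnSeries.ofSuppBddBelow_coeff]
  by_cases hi : i < N
  · rw [coeff_single_mul_toLS_of_lt _ _ _ hi]
    refine finsum_eq_zero_of_forall_eq_zero fun k => ?_
    rw [coeff_single_mul_toLS_of_lt _ _ _ (by omega), iterate_map_zero, smul_zero]
  · obtain ⟨n, rfl⟩ : ∃ n : ℕ, i = n + N := ⟨(i - N).toNat, by omega⟩
    rw [coeff_single_mul_toLS, coeff_psOp, Finset.Nat.sum_antidiagonal_eq_sum_range_succ_mk,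
      finsum_eq_sum_of_support_subset (s := Finset.range n.succ)]
    · refine Finset.sum_congr rfl fun k hk => ?_
      have hk' : k ≤ n := by simpa [Nat.lt_succ_iff] using hk
      have : (n : ℤ) + N - k = ((n - k : ℕ) : ℤ) + N := by omega
      rw [this, coeff_single_mul_toLS, coeff_expS]
    · intro k hk
      by_contra hk'
      apply hk
      have hk' : n < k := by simpa [Nat.lt_succ_iff] using hk'
      simp only
      rw [coeff_single_mul_toLS_of_lt _ _ _ (by omega), iterate_map_zero, smul_zero]

theorem lsShift_toLS (d : Derivation ℂ A A) (s : ℤ) (f : PowerSeries A) :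
    lsShift d s (toLS f) = toLS (psShift d s f) := by
  rw [lsShift_eq_lsOp, lsOp_toLS, psShift_eq_psOp]

theorem lsShift_mul (d : Derivation ℂ A A) (s : ℤ) (f f' : LaurentSeries A) :
    lsShift d s (f * f') = lsShift d s f * lsShift d s f' := by
  obtain ⟨N, g, rfl⟩ := exists_rep f
  obtain ⟨N', g', rfl⟩ := exists_rep f'
  simp only [lsShift_eq_lsOp]
  rw [mul_mul_mul_comm, HahnSeries.single_mul_single, one_mul, ← toLS_mul, lsOp_single_mul,
    lsOp_single_mul, lsOp_single_mul, mul_mul_mul_comm, HahnSeries.single_mul_single, one_mul,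
    ← toLS_mul, ← psShift_eq_psOp, ← psShift_eq_psOp, ← psShift_eq_psOp, ← psShiftHom_apply,
    map_mul, psShiftHom_apply, psShiftHom_apply]

theorem lsMap_mul (d : Derivation ℂ A A) (f f' : LaurentSeries A) :
    lsMap d (f * f') = f * lsMap d f' + f' * lsMap d f := by
  obtain ⟨N, g, rfl⟩ := exists_rep f
  obtain ⟨N', g', rfl⟩ := exists_rep f'
  rw [mul_mul_mul_comm, HahnSeries.single_mul_single, one_mul, ← toLS_mul, lsMap_single_mul,
    lsMap_single_mul, lsMap_single_mul, psMap_mul, toLS_add, toLS_mul, toLS_mul]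
  have : HahnSeries.single (N + N') (1 : A) = HahnSeries.single N 1 * HahnSeries.single N' 1 := by
    simp
  rw [this]
  ring

theorem lsMap_lsOp (d d' : Derivation ℂ A A) (h : ∀ a, d (d' a) = d' (d a)) (c : PowerSeries ℂ)
    (f : LaurentSeries A) : lsMap d (lsOp d' c f) = lsOp d' c (lsMap d f) := by
  obtain ⟨N, g, rfl⟩ := exists_rep f
  rw [lsOp_single_mul, lsMap_single_mul, lsMap_single_mul, lsOp_single_mul]
  congr 2
  have hk : ∀ (k : ℕ) (a : A), d (d'^[k] a) = d'^[k] (d a) := by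
    intro k a
    induction k with
    | zero => rfl
    | succ k ih => rw [Function.iterate_succ_apply', h, ih, Function.iterate_succ_apply']
  ext n
  simp [psMap, coeff_psOp, hk]

end LsOp

/-! ### Derivations and evaluations of differential polynomials -/

theorem DiffPoly.induction {M : DiffPoly → Prop} (f : DiffPoly)
    (const : ∀ c : ℂ, M (algebraMap ℂ DiffPoly c)) (jets : ∀ i, M (jet i))
    (exp : M expU.val) (exp_inv : M expU.inv)
    (add : ∀ f g, M f → M g → M (f + g)) (mul : ∀ f g, M f → M g → M (f * g)) : M f := by
  have hC : ∀ a : MvPolynomial JetVar ℂ, M (LaurentPolynomial.C a) := by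
    intro a
    induction a using MvPolynomial.induction_on with
    | C c => exact const c
    | add p q hp hq => rw [map_add]; exact add _ _ hp hq
    | mul_X p i hp => rw [map_mul]; exact mul _ _ hp (jets i)
  induction f using LaurentPolynomial.induction_on with
  | h_C a => exact hC a
  | h_add hp hq => exact add _ _ hp hq
  | h_C_mul_T n a h =>
    rw [LaurentPolynomial.T_add, ← mul_assoc]
    exact mul _ _ h exp
  | h_C_mul_T_Z n a h =>
    rw [LaurentPolynomial.T_sub, ← mul_assoc]
    exact mul _ _ h exp_inv

section JetDeriv

variable {S : Type*} [CommRing S] [Algebra ℂ S] [Algebra DiffPoly S] [IsScalarTower ℂ DiffPoly S]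

theorem substJet_algebraMap {S : Type*} [CommRing S] [Algebra ℂ S] (w : JetVar → S) (E : Sˣ)
    (c : ℂ) : substJet w E (algebraMap ℂ DiffPoly c) = algebraMap ℂ S c := by
  have : algebraMap ℂ DiffPoly c = LaurentPolynomial.C (MvPolynomial.C c) := rfl
  rw [this, substJet, LaurentPolynomial.eval₂_C]
  exact (MvPolynomial.aeval w).commutes c

theorem substJet_jet {S : Type*} [CommRing S] [Algebra ℂ S] (w : JetVar → S) (E : Sˣ)
    (i : JetVar) : substJet w E (jet i) = w i := by
  rw [substJet, jet, LaurentPolynomial.eval₂_C]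
  exact MvPolynomial.aeval_X w i

theorem substJet_expU {S : Type*} [CommRing S] [Algebra ℂ S] (w : JetVar → S) (E : Sˣ) :
    substJet w E expU.val = E.val := by
  rw [substJet, expU, LaurentPolynomial.eval₂_T, zpow_one]

theorem substJet_expU_inv {S : Type*} [CommRing S] [Algebra ℂ S] (w : JetVar → S) (E : Sˣ) :
    substJet w E expU.inv = E.inv := by
  rw [substJet, expU, LaurentPolynomial.eval₂_T, zpow_neg, zpow_one]
  rfl

theorem fst_jetDeriv (W : JetVar → S) (f : DiffPoly) :
    (substJet (S := DualNumber S)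
      (fun i => TrivSqZeroExt.inl (algebraMap DiffPoly S (jet i)) + TrivSqZeroExt.inr (W i))
      (expUVar (W (JetVar.u 0))) f).fst = algebraMap DiffPoly S f := by
  induction f using DiffPoly.induction with
  | const c =>
    rw [substJet_algebraMap, ← IsScalarTower.algebraMap_apply]
    rfl
  | jets i => rw [substJet_jet]; simp
  | exp => rw [substJet_expU]; simp [expUVar]
  | exp_inv => rw [substJet_expU_inv]; simp [expUVar]
  | add f g hf hg => rw [map_add, map_add, TrivSqZeroExt.fst_add, hf, hg]
  | mul f g hf hg => rw [map_mul, map_mul, TrivSqZeroExt.fst_mul, hf, hg]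

omit [IsScalarTower ℂ DiffPoly S] in
theorem jetDeriv_add (W : JetVar → S) (f g : DiffPoly) :
    jetDeriv W (f + g) = jetDeriv W f + jetDeriv W g := by
  rw [jetDeriv, map_add, TrivSqZeroExt.snd_add]; rfl

theorem jetDeriv_mul (W : JetVar → S) (f g : DiffPoly) :
    jetDeriv W (f * g) = algebraMap DiffPoly S f * jetDeriv W g +
      algebraMap DiffPoly S g * jetDeriv W f := by
  rw [jetDeriv, map_mul, TrivSqZeroExt.snd_mul, fst_jetDeriv, fst_jetDeriv, smul_eq_mul,
    op_smul_eq_mul, mul_comm _ (algebraMap DiffPoly S g)]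
  rfl

omit [IsScalarTower ℂ DiffPoly S] in
theorem jetDeriv_algebraMap (W : JetVar → S) (c : ℂ) :
    jetDeriv W (algebraMap ℂ DiffPoly c) = 0 := by
  rw [jetDeriv, substJet_algebraMap]
  rfl

omit [IsScalarTower ℂ DiffPoly S] in
theorem jetDeriv_jet (W : JetVar → S) (i : JetVar) : jetDeriv W (jet i) = W i := by
  rw [jetDeriv, substJet_jet]
  simp

omit [IsScalarTower ℂ DiffPoly S] in
theorem jetDeriv_expU (W : JetVar → S) :
    jetDeriv W expU.val = algebraMap DiffPoly S expU.val * W (JetVar.u 0) := by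
  rw [jetDeriv, substJet_expU]
  simp [expUVar]

omit [IsScalarTower ℂ DiffPoly S] in
theorem jetDeriv_expU_inv (W : JetVar → S) :
    jetDeriv W expU.inv = -(algebraMap DiffPoly S expU.inv * W (JetVar.u 0)) := by
  rw [jetDeriv, substJet_expU_inv]
  simp [expUVar]

end JetDeriv

/-- `jetDeriv W` for `W i ∈ DiffPoly`, as a derivation. -/
noncomputable def jetD (W : JetVar → DiffPoly) : Derivation ℂ DiffPoly DiffPoly :=
  Derivation.mk'
    { toFun := jetDeriv W
      map_add' := jetDeriv_add W
      map_smul' := fun c f => by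
        rw [Algebra.smul_def, jetDeriv_mul, jetDeriv_algebraMap, mul_zero, add_zero,
          RingHom.id_apply, Algebra.smul_def]
        rfl }
    (fun f g => by
      simp only [LinearMap.coe_mk, AddHom.coe_mk, jetDeriv_mul]
      rfl)

theorem jetD_jet (W : JetVar → DiffPoly) (i : JetVar) : jetD W (jet i) = W i := jetDeriv_jet W i

theorem jetD_expU (W : JetVar → DiffPoly) :
    jetD W expU.val = expU.val * W (JetVar.u 0) := jetDeriv_expU W

theorem jetD_expU_inv (W : JetVar → DiffPoly) :
    jetD W expU.inv = -(expU.inv * W (JetVar.u 0)) := jetDeriv_expU_inv W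

theorem jetD_T (W : JetVar → DiffPoly) (k : ℤ) :
    jetD W (LaurentPolynomial.T k) = k • (LaurentPolynomial.T k * W (JetVar.u 0)) := by
  have h1 := jetD_expU W
  have h2 := jetD_expU_inv W
  change jetD W (LaurentPolynomial.T 1) = LaurentPolynomial.T 1 * _ at h1
  change jetD W (LaurentPolynomial.T (-1)) = -(LaurentPolynomial.T (-1) * _) at h2
  have hadd : ∀ {R : Type} [CommRing R] (a b c : R) (k : ℤ),
      a * (b * c) + b * (k • (a * c)) = (k + 1) • (a * b * c) := by
    intro R _ a b c k
    rw [zsmul_eq_mul, zsmul_eq_mul]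
    push_cast
    ring
  have hsub : ∀ {R : Type} [CommRing R] (a b c : R) (k : ℤ),
      a * -(b * c) + b * (k • (a * c)) = (k - 1) • (a * b * c) := by
    intro R _ a b c k
    rw [zsmul_eq_mul, zsmul_eq_mul]
    push_cast
    ring
  induction k using Int.induction_on with
  | zero => rw [LaurentPolynomial.T_zero, Derivation.map_one_eq_zero, zero_smul]
  | succ k ih =>
    rw [LaurentPolynomial.T_add, Derivation.leibniz, ih, h1, smul_eq_mul, smul_eq_mul, hadd]
  | pred k ih =>
    rw [LaurentPolynomial.T_sub, Derivation.leibniz, ih, h2, smul_eq_mul, smul_eq_mul, hsub]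

theorem derivation_algebraMap (D : Derivation ℂ DiffPoly DiffPoly) (c : ℂ) :
    D (algebraMap ℂ DiffPoly c) = 0 := D.map_algebraMap c

theorem derivation_expU_inv (D : Derivation ℂ DiffPoly DiffPoly) :
    D expU.inv = -(expU.inv * expU.inv * D expU.val) := by
  have h : D (expU.val * expU.inv) = 0 := by
    rw [expU.val_inv]; exact D.map_one_eq_zero
  rw [Derivation.leibniz, smul_eq_mul, smul_eq_mul] at h
  have h2 := expU.inv_val
  linear_combination expU.inv * h - D expU.inv * h2

theorem derivation_ext {D D' : Derivation ℂ DiffPoly DiffPoly} (h : ∀ i, D (jet i) = D' (jet i))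
    (hE : D expU.val = D' expU.val) (f : DiffPoly) : D f = D' f := by
  induction f using DiffPoly.induction with
  | const c => rw [derivation_algebraMap, derivation_algebraMap]
  | jets i => exact h i
  | exp => exact hE
  | exp_inv => rw [derivation_expU_inv, derivation_expU_inv, hE]
  | add f g hf hg => rw [map_add, map_add, hf, hg]
  | mul f g hf hg => rw [Derivation.leibniz, Derivation.leibniz, hf, hg]

/-- The jet variable `i` with one more `x`-derivative. -/
def JetVar.succ : JetVar → JetVar
  | JetVar.v m => JetVar.v (m + 1)
  | JetVar.u m => JetVar.u (m + 1)

/-- The total `x`-derivative as a derivation. -/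
noncomputable def totalD : Derivation ℂ DiffPoly DiffPoly := jetD fun i => jet i.succ

theorem totalDeriv_eq : totalDeriv = totalD := by
  funext f
  refine congrArg (fun W => jetDeriv W f) (funext fun i => ?_)
  cases i <;> rfl

theorem totalD_jet (i : JetVar) : totalD (jet i) = jet i.succ := jetD_jet _ _

theorem totalD_expU : totalD expU.val = expU.val * jet (JetVar.u 1) := jetD_expU _

theorem totalD_expU_inv : totalD expU.inv = -(expU.inv * jet (JetVar.u 1)) := jetD_expU_inv _

theorem shiftR_eq (s : ℤ) (f : DiffSeries) : shiftR s f = psShiftHom totalD s f := by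
  rw [psShiftHom_apply, shiftR, totalDeriv_eq]

theorem shiftR_eq_psOp (s : ℤ) (f : DiffSeries) : shiftR s f = psOp totalD (expS s) f := by
  rw [shiftR_eq, psShiftHom_apply, psShift_eq_psOp]

theorem dxR_eq (f : DiffSeries) : dxR f = psMap totalD f := by
  rw [dxR, totalDeriv_eq]

theorem iterate_dxR_C (m : ℕ) (a : DiffPoly) :
    dxR^[m] (PowerSeries.C a) = PowerSeries.C (totalD^[m] a) := by
  induction m with
  | zero => rfl
  | succ m ih =>
    rw [Function.iterate_succ_apply', ih, Function.iterate_succ_apply', dxR_eq]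
    ext n
    cases n <;> simp [psMap, PowerSeries.coeff_C]

theorem iterate_totalD_v (m k : ℕ) :
    totalD^[m] (jet (JetVar.v k)) = jet (JetVar.v (k + m)) := by
  induction m with
  | zero => rfl
  | succ m ih => rw [Function.iterate_succ_apply', ih, totalD_jet]; rfl

theorem iterate_totalD_u (m k : ℕ) :
    totalD^[m] (jet (JetVar.u k)) = jet (JetVar.u (k + m)) := by
  induction m with
  | zero => rfl
  | succ m ih => rw [Function.iterate_succ_apply', ih, totalD_jet]; rfl

theorem jetDeriv_C (W : JetVar → DiffPoly) (f : DiffPoly) :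
    jetDeriv (S := DiffSeries) (fun i => PowerSeries.C (W i)) f = PowerSeries.C (jetD W f) := by
  have hal : ∀ g : DiffPoly, algebraMap DiffPoly DiffSeries g = PowerSeries.C g := fun g => rfl
  induction f using DiffPoly.induction with
  | const c => rw [jetDeriv_algebraMap, derivation_algebraMap, map_zero]
  | jets i => rw [jetDeriv_jet, jetD_jet]
  | exp => rw [jetDeriv_expU, jetD_expU, map_mul, hal]
  | exp_inv => rw [jetDeriv_expU_inv, jetD_expU_inv, map_neg, map_mul, hal]
  | add f g hf hg => rw [jetDeriv_add, map_add, map_add, hf, hg]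
  | mul f g hf hg =>
    rw [jetDeriv_mul, Derivation.leibniz, hf, hg, hal, hal, smul_eq_mul, smul_eq_mul, map_add,
      map_mul, map_mul]

/-- The evolutionary vector field `∂v/∂t = vₓ`, `∂u/∂t = uₓ` is the total derivative. -/
theorem evolve_translation (f : DiffSeries) :
    evolve (PowerSeries.C (jet (JetVar.v 1))) (PowerSeries.C (jet (JetVar.u 1))) f = dxR f := by
  have hW : evolve (PowerSeries.C (jet (JetVar.v 1))) (PowerSeries.C (jet (JetVar.u 1))) f =
      PowerSeries.mk fun n => ∑ kl ∈ Finset.HasAntidiagonal.antidiagonal n,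
        PowerSeries.coeff kl.2 (jetDeriv (S := DiffSeries)
          (fun i => PowerSeries.C (jet i.succ)) (PowerSeries.coeff kl.1 f)) := by
    refine congrArg PowerSeries.mk (funext fun n => Finset.sum_congr rfl fun kl _ => ?_)
    refine congrArg (fun W => PowerSeries.coeff kl.2 (jetDeriv (S := DiffSeries) W _))
      (funext fun i => ?_)
    cases i with
    | v m => simp only [iterate_dxR_C, iterate_totalD_v, JetVar.succ, add_comm]
    | u m => simp only [iterate_dxR_C, iterate_totalD_u, JetVar.succ, add_comm]
  ext1 n
  rw [hW, PowerSeries.coeff_mk, Finset.sum_eq_single (n, 0)]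
  · simp only [jetDeriv_C, dxR_eq, psMap, PowerSeries.coeff_mk, totalD]
    simp
  · rintro ⟨k, l⟩ hkl hne
    have hl : l ≠ 0 := by
      rintro rfl
      simp at hkl
      exact hne (by simp [hkl])
    simp [jetDeriv_C, PowerSeries.coeff_C, hl]
  · simp

section Eval

variable {A : Type*} [CommRing A] [Algebra ℂ A]

/-- The values of the jet variables at `v`, `u`. -/
noncomputable def jetValue (dx : Derivation ℂ A A) (v u : PowerSeries A) : JetVar → PowerSeries A
  | JetVar.v m => (psMap dx)^[m] v
  | JetVar.u m => (psMap dx)^[m] u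

/-- `evalR` as a ring homomorphism. -/
noncomputable def evalHom (dx : Derivation ℂ A A) (v u : PowerSeries A) (E : (PowerSeries A)ˣ) :
    DiffSeries →+* PowerSeries A :=
  extendHom (substJet (jetValue dx v u) E)

theorem evalHom_apply (dx : Derivation ℂ A A) (v u : PowerSeries A) (E : (PowerSeries A)ˣ)
    (f : DiffSeries) : evalHom dx v u E f = evalR dx v u E f := by
  ext n
  rw [evalR, PowerSeries.coeff_mk]
  refine (coeff_extend _ _ _).trans (Finset.sum_congr rfl fun kl _ => ?_)
  refine congrArg (fun w => PowerSeries.coeff kl.2 (substJet w E _)) (funext fun i => ?_)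
  cases i <;> rfl

theorem evalHom_C (dx : Derivation ℂ A A) (v u : PowerSeries A) (E : (PowerSeries A)ˣ)
    (a : DiffPoly) : evalHom dx v u E (PowerSeries.C a) = substJet (jetValue dx v u) E a :=
  extend_C _ _

theorem evalHom_X_mul (dx : Derivation ℂ A A) (v u : PowerSeries A) (E : (PowerSeries A)ˣ)
    (f : DiffSeries) :
    evalHom dx v u E (PowerSeries.X * f) = PowerSeries.X * evalHom dx v u E f :=
  extend_X_mul _ _

theorem evalHom_smul (dx : Derivation ℂ A A) (v u : PowerSeries A) (E : (PowerSeries A)ˣ)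
    (r : ℂ) (f : DiffSeries) : evalHom dx v u E (r • f) = r • evalHom dx v u E f := by
  have h : ∀ g : DiffSeries, r • g = PowerSeries.C (algebraMap ℂ DiffPoly r) * g := fun g => by
    ext n
    rw [PowerSeries.coeff_C_mul, ← Algebra.smul_def]
    rfl
  rw [h, map_mul, evalHom_C, substJet_algebraMap, Algebra.smul_def]

theorem substJet_totalD (dx : Derivation ℂ A A) (v u : PowerSeries A) (E : (PowerSeries A)ˣ)
    (hE : psMap dx E.val = E.val * psMap dx u) (f : DiffPoly) :
    substJet (jetValue dx v u) E (totalD f) = psMap dx (substJet (jetValue dx v u) E f) := by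
  have hadd : ∀ f g : PowerSeries A, psMap dx (f + g) = psMap dx f + psMap dx g := fun f g => by
    ext n; simp [psMap]
  have hjet : ∀ i, jetValue dx v u (JetVar.succ i) = psMap dx (jetValue dx v u i) := by
    intro i
    cases i <;> simp [JetVar.succ, jetValue, Function.iterate_succ_apply']
  have hu : jetValue dx v u (JetVar.u 1) = psMap dx u := rfl
  induction f using DiffPoly.induction with
  | const c =>
    rw [derivation_algebraMap, map_zero, substJet_algebraMap]
    ext n
    rw [psMap, PowerSeries.coeff_mk, PowerSeries.algebraMap_apply, PowerSeries.coeff_C]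
    split_ifs <;> simp
  | jets i => rw [totalD_jet, substJet_jet, substJet_jet, hjet]
  | exp => rw [totalD_expU, map_mul, substJet_expU, substJet_jet, hE, hu]
  | exp_inv =>
    rw [totalD_expU_inv, map_neg, map_mul, substJet_expU_inv, substJet_jet, hu]
    have h1 : psMap dx (E.val * E.inv) = 0 := by
      rw [E.val_inv]
      ext n
      rw [psMap, PowerSeries.coeff_mk, PowerSeries.coeff_one]
      split_ifs <;> simp
    rw [psMap_mul, hE] at h1
    have h2 := E.inv_val
    linear_combination (-E.inv) * h1 + (psMap dx E.inv + E.inv * psMap dx u) * h2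
  | add f g hf hg => rw [map_add, map_add, map_add, hadd, hf, hg]
  | mul f g hf hg =>
    rw [Derivation.leibniz, smul_eq_mul, smul_eq_mul, map_add, map_mul, map_mul, map_mul,
      psMap_mul, hf, hg]

theorem evalHom_psOp (dx : Derivation ℂ A A) (v u : PowerSeries A) (E : (PowerSeries A)ˣ)
    (hE : psMap dx E.val = E.val * psMap dx u) (c : PowerSeries ℂ) (f : DiffSeries) :
    evalHom dx v u E (psOp totalD c f) = psOp dx c (evalHom dx v u E f) := by
  refine eq_of_X_mul ((evalHom dx v u E).toAddMonoidHom.comp (psOp totalD c))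
    ((psOp dx c).comp (evalHom dx v u E).toAddMonoidHom) ?_ ?_ ?_ f
  · intro f
    change evalHom dx v u E (psOp totalD c (PowerSeries.X * f)) = _
    rw [psOp_X_mul, evalHom_X_mul]
    rfl
  · intro f
    change psOp dx c (evalHom dx v u E (PowerSeries.X * f)) = _
    rw [evalHom_X_mul, psOp_X_mul]
    rfl
  · intro a
    change evalHom dx v u E (psOp totalD c (PowerSeries.C a)) =
      psOp dx c (evalHom dx v u E (PowerSeries.C a))
    have hk : ∀ (k : ℕ) (a : DiffPoly), substJet (jetValue dx v u) E (totalD^[k] a) =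
        (psMap dx)^[k] (substJet (jetValue dx v u) E a) := by
      intro k a
      induction k with
      | zero => rfl
      | succ k ih =>
        rw [Function.iterate_succ_apply', substJet_totalD dx v u E hE, ih,
          Function.iterate_succ_apply']
    have hc : ∀ (k n : ℕ) (g : PowerSeries A),
        PowerSeries.coeff n ((psMap dx)^[k] g) = dx^[k] (PowerSeries.coeff n g) := by
      intro k n g
      induction k with
      | zero => rfl
      | succ k ih =>
        rw [Function.iterate_succ_apply', Function.iterate_succ_apply', ← ih]
        simp [psMap]
    have hs : ∀ (r : ℂ) (a : DiffPoly), substJet (jetValue dx v u) E (r • a) =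
        r • substJet (jetValue dx v u) E a := by
      intro r a
      rw [Algebra.smul_def, map_mul, substJet_algebraMap, ← Algebra.smul_def]
    rw [evalHom_C, psOp, extend_C]
    ext n
    rw [coeff_psOp]
    refine (coeff_extend _ _ _).trans (Finset.sum_congr rfl fun kl _ => ?_)
    rw [← hc, ← hk]
    change PowerSeries.coeff kl.2 (substJet (jetValue dx v u) E (PowerSeries.coeff kl.1 _)) = _
    simp only [symbolMap, AddMonoidHom.coe_mk, ZeroHom.coe_mk, PowerSeries.coeff_mk]
    rw [hs]
    rfl

theorem evalHom_shiftR (dx : Derivation ℂ A A) (v u : PowerSeries A) (E : (PowerSeries A)ˣ)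
    (hE : psMap dx E.val = E.val * psMap dx u) (s : ℤ) (f : DiffSeries) :
    evalHom dx v u E (shiftR s f) = psShift dx s (evalHom dx v u E f) := by
  rw [shiftR_eq_psOp, evalHom_psOp dx v u E hE, psShift_eq_psOp]

end Eval

/-! ### The kernel of the total derivative -/

section Kernel

open Classical in
/-- The partial derivative with respect to the jet variable `i`, where `e ^ u` is regarded as
a function of `u`. -/
noncomputable def jetPartial (i : JetVar) : Derivation ℂ DiffPoly DiffPoly :=
  jetD fun j => if j = i then 1 else 0

theorem JetVar.succ_injective : Function.Injective JetVar.succ := by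
  intro i j h
  cases i <;> cases j <;> simp_all [JetVar.succ]

theorem JetVar.succ_ne_u_zero (i : JetVar) : i.succ ≠ JetVar.u 0 := by
  cases i <;> simp [JetVar.succ]

open Classical in
theorem jetPartial_succ_totalD (i : JetVar) (f : DiffPoly) :
    jetPartial i.succ (totalD f) - totalD (jetPartial i.succ f) = jetPartial i f := by
  have h := derivation_ext (D := ⁅jetPartial i.succ, totalD⁆) (D' := jetPartial i) ?_ ?_ f
  · rw [← h, Derivation.commutator_apply]
  · intro j
    rw [Derivation.commutator_apply, totalD_jet, jetPartial, jetD_jet, jetD_jet, jetPartial,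
      jetD_jet]
    have : totalD (if j = i.succ then (1 : DiffPoly) else 0) = 0 := by
      split_ifs
      · exact totalD.map_one_eq_zero
      · exact map_zero _
    rw [this, sub_zero]
    simp only [JetVar.succ_injective.eq_iff]
  · rw [Derivation.commutator_apply, totalD_expU, Derivation.leibniz, smul_eq_mul, smul_eq_mul,
      jetPartial, jetD_jet, jetD_expU, jetPartial, jetD_expU, if_neg i.succ_ne_u_zero.symm,
      mul_zero, mul_zero, map_zero, add_zero, sub_zero]
    congr 1
    have : (JetVar.u 1 = i.succ) ↔ (JetVar.u 0 = i) :=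
      JetVar.succ_injective.eq_iff (a := JetVar.u 0) (b := i)
    simp only [this]

theorem exists_jetPartial_iterate_succ_eq_zero (f : DiffPoly) :
    ∃ M : ℕ, ∀ m, M ≤ m → ∀ i, jetPartial (JetVar.succ^[m] i) f = 0 := by
  have hv : ∀ m k, JetVar.succ^[m] (JetVar.v k) = JetVar.v (k + m) := by
    intro m k
    induction m with
    | zero => rfl
    | succ m ih => rw [Function.iterate_succ_apply', ih]; rfl
  have hu : ∀ m k, JetVar.succ^[m] (JetVar.u k) = JetVar.u (k + m) := by
    intro m k
    induction m with
    | zero => rfl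
    | succ m ih => rw [Function.iterate_succ_apply', ih]; rfl
  have hu0 : ∀ m, 1 ≤ m → ∀ i, JetVar.u 0 ≠ JetVar.succ^[m] i := by
    intro m hm i
    cases i <;> simp [hv, hu]
    omega
  induction f using DiffPoly.induction with
  | const c => exact ⟨0, fun m _ i => derivation_algebraMap _ _⟩
  | jets j =>
    refine ⟨(match j with | JetVar.v k => k | JetVar.u k => k) + 1, fun m hm i => ?_⟩
    rw [jetPartial, jetD_jet, if_neg]
    cases j <;> cases i <;> simp [hv, hu] at hm ⊢ <;> omega
  | exp =>
    refine ⟨1, fun m hm i => ?_⟩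
    rw [jetPartial, jetD_expU, if_neg (hu0 m hm i), mul_zero]
  | exp_inv =>
    refine ⟨1, fun m hm i => ?_⟩
    rw [jetPartial, jetD_expU_inv, if_neg (hu0 m hm i), mul_zero, neg_zero]
  | add f g hf hg =>
    obtain ⟨M, hM⟩ := hf
    obtain ⟨M', hM'⟩ := hg
    refine ⟨max M M', fun m hm i => ?_⟩
    rw [map_add, hM m (by omega), hM' m (by omega), add_zero]
  | mul f g hf hg =>
    obtain ⟨M, hM⟩ := hf
    obtain ⟨M', hM'⟩ := hg
    refine ⟨max M M', fun m hm i => ?_⟩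
    rw [Derivation.leibniz, hM m (by omega), hM' m (by omega), smul_zero, smul_zero, add_zero]

/-- By descending induction on the order of the jet variable, using
`[∂/∂w^(m+1), ∂ₓ] = ∂/∂w^(m)`. -/
theorem jetPartial_eq_zero_of_totalD (f : DiffPoly) (hf : totalD f = 0) (i : JetVar) :
    jetPartial i f = 0 := by
  obtain ⟨M, hM⟩ := exists_jetPartial_iterate_succ_eq_zero f
  have h : ∀ n m, m + n = M → jetPartial (JetVar.succ^[m] i) f = 0 := by
    intro n
    induction n with
    | zero => intro m hm; exact hM m (by omega) i
    | succ n ih =>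
      intro m hm
      have h1 := ih (m + 1) (by omega)
      rw [Function.iterate_succ_apply'] at h1
      rw [← jetPartial_succ_totalD, h1, hf, map_zero, map_zero, sub_zero]
  exact h M 0 (by omega)

open Classical in
theorem coeff_jetPartial (i : JetVar) (f : DiffPoly) (n : ℤ) :
    (jetPartial i f).coeff n =
      MvPolynomial.pderiv i (f.coeff n) + if JetVar.u 0 = i then n • f.coeff n else 0 := by
  have hC : ∀ a : MvPolynomial JetVar ℂ, jetPartial i (LaurentPolynomial.C a) =
      LaurentPolynomial.C (MvPolynomial.pderiv i a) := by
    intro a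
    induction a using MvPolynomial.induction_on with
    | C c => rw [MvPolynomial.pderiv_C, map_zero]; exact derivation_algebraMap _ _
    | add p q hp hq => rw [map_add, map_add, hp, hq, map_add, map_add]
    | mul_X p j hp =>
      have hX : jetPartial i (LaurentPolynomial.C (MvPolynomial.X j)) =
          LaurentPolynomial.C (MvPolynomial.pderiv i (MvPolynomial.X j)) := by
        rw [MvPolynomial.pderiv_X, Pi.single_apply]
        refine (jetD_jet _ j).trans ?_
        split_ifs <;> simp
      rw [map_mul, Derivation.leibniz, Derivation.leibniz, hp, hX]
      simp
  have hT : ∀ k : ℤ, jetPartial i (LaurentPolynomial.T k) =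
      if JetVar.u 0 = i then k • LaurentPolynomial.T k else 0 := by
    intro k
    rw [jetPartial, jetD_T]
    split_ifs
    · rw [mul_one]
    · rw [mul_zero, smul_zero]
  induction f using LaurentPolynomial.induction_on' with
  | add p q hp hq =>
    rw [map_add, AddMonoidAlgebra.coeff_add, Finsupp.add_apply, hp, hq, AddMonoidAlgebra.coeff_add,
      Finsupp.add_apply, map_add]
    split_ifs
    · rw [smul_add]; ring
    · ring
  | C_mul_T k a =>
    rw [Derivation.leibniz, hC, hT, ← LaurentPolynomial.single_eq_C_mul_T]
    have h3 : (LaurentPolynomial.T k : DiffPoly) •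
        LaurentPolynomial.C (MvPolynomial.pderiv i a) =
          AddMonoidAlgebra.single k (MvPolynomial.pderiv i a) := by
      rw [smul_eq_mul, mul_comm, LaurentPolynomial.single_eq_C_mul_T]
    rw [h3]
    have h4 : (LaurentPolynomial.C a : DiffPoly) •
        (if JetVar.u 0 = i then k • (LaurentPolynomial.T k : DiffPoly) else 0) =
          if JetVar.u 0 = i then AddMonoidAlgebra.single k (k • a) else 0 := by
      split_ifs
      · rw [smul_eq_mul, mul_smul_comm, ← LaurentPolynomial.single_eq_C_mul_T,
          AddMonoidAlgebra.smul_single]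
      · rw [smul_zero]
    rw [h4, AddMonoidAlgebra.coeff_add, Finsupp.add_apply, add_comm,
      AddMonoidAlgebra.coeff_single, AddMonoidAlgebra.coeff_single]
    by_cases hk : k = n
    · subst hk
      rw [Finsupp.single_eq_same, Finsupp.single_eq_same]
      congr 1
      split_ifs
      · rw [AddMonoidAlgebra.coeff_single, Finsupp.single_eq_same]
      · rfl
    · rw [Finsupp.single_eq_of_ne' hk, Finsupp.single_eq_of_ne' hk, map_zero, smul_zero]
      congr 1
      split_ifs
      · rw [AddMonoidAlgebra.coeff_single, Finsupp.single_eq_of_ne' hk]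
      · rfl

/-- The kernel of the total derivative consists of the constants. -/
theorem coeff_eq_zero_of_totalD (f : DiffPoly) (hf : totalD f = 0) (n : ℤ) (m : JetVar →₀ ℕ)
    (h : MvPolynomial.coeff m (f.coeff n) ≠ 0) : m = 0 ∧ n = 0 := by
  classical
  have hp : ∀ i, MvPolynomial.pderiv i (f.coeff n) +
      (if JetVar.u 0 = i then n • f.coeff n else 0) = 0 := by
    intro i
    rw [← coeff_jetPartial, jetPartial_eq_zero_of_totalD f hf]
    rfl
  generalize f.coeff n = p at h hp
  have hc : ∀ i (m : JetVar →₀ ℕ), MvPolynomial.coeff (m + Finsupp.single i 1) p * (m i + 1) +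
      (if JetVar.u 0 = i then n * MvPolynomial.coeff m p else 0) = 0 := by
    intro i m
    have := congrArg (MvPolynomial.coeff m) (hp i)
    rw [MvPolynomial.coeff_add, MvPolynomial.coeff_pderiv, MvPolynomial.coeff_zero] at this
    split_ifs at this ⊢
    · rw [← this, MvPolynomial.coeff_smul, zsmul_eq_mul]
    · rw [add_zero, ← this, MvPolynomial.coeff_zero, add_zero]
  have hn : n = 0 := by
    by_contra hn
    have hall : ∀ k : ℕ, MvPolynomial.coeff (m + k • Finsupp.single (JetVar.u 0) 1) p ≠ 0 := by
      intro k
      induction k with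
      | zero => simpa using h
      | succ k ih =>
        have h1 := hc (JetVar.u 0) (m + k • Finsupp.single (JetVar.u 0) 1)
        rw [if_pos rfl] at h1
        intro h2
        rw [succ_nsmul, ← add_assoc] at h2
        rw [h2, zero_mul, zero_add] at h1
        exact (mul_ne_zero (by exact_mod_cast hn) ih) h1
    have hfin := p.support.finite_toSet
    refine Set.infinite_of_injective_forall_mem (f := fun k : ℕ =>
      m + k • Finsupp.single (JetVar.u 0) 1) ?_ (fun k => ?_) hfin
    · intro k k' hk
      have := congrArg (fun g : JetVar →₀ ℕ => g (JetVar.u 0)) hk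
      simpa using this
    · exact MvPolynomial.mem_support_iff.2 (hall k)
  refine ⟨?_, hn⟩
  by_contra hm
  obtain ⟨i, hi⟩ : ∃ i, m i ≠ 0 := by
    by_contra hcon
    push Not at hcon
    exact hm (Finsupp.ext hcon)
  obtain ⟨m', rfl⟩ : ∃ m', m = m' + Finsupp.single i 1 :=
    ⟨m - Finsupp.single i 1, (tsub_add_cancel_of_le (by
      rw [Finsupp.single_le_iff]; omega)).symm⟩
  have h1 := hc i m'
  rw [hn] at h1
  simp only [Int.cast_zero, zero_mul, ite_self, add_zero, mul_eq_zero] at h1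
  rcases h1 with h1 | h1
  · exact h h1
  · exact Nat.cast_add_one_ne_zero _ h1

end Kernel

/-! ### The algebra of difference operators -/

/-- `σ` is an action of `ℤ` on the ring `S` by ring automorphisms. -/
structure IsShiftAction {S : Type*} [CommRing S] (σ : ℤ → S → S) : Prop where
  map_add : ∀ k x y, σ k (x + y) = σ k x + σ k y
  map_mul : ∀ k x y, σ k (x * y) = σ k x * σ k y
  map_one : ∀ k, σ k 1 = 1
  zero : ∀ x, σ 0 x = x
  comp : ∀ j k x, σ j (σ k x) = σ (j + k) x

theorem opMul_lambda_left {S : Type*} [CommRing S] (σ : ℤ → S → S) (j : ℤ) (F : ℤ → S) (n : ℤ) :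
    opMul σ (opLambda j) F n = σ j (F (n - j)) := by
  rw [opMul, finsum_eq_single _ j]
  · simp [opLambda]
  · intro k hk; simp [opLambda, hk]

namespace IsShiftAction

variable {S : Type*} [CommRing S] {σ : ℤ → S → S} (hσ : IsShiftAction σ)
include hσ

theorem map_zero (k : ℤ) : σ k 0 = 0 := by
  have := hσ.map_add k 0 0
  simpa using this

theorem map_sub (k : ℤ) (x y : S) : σ k (x - y) = σ k x - σ k y := by
  rw [eq_sub_iff_add_eq, ← hσ.map_add, sub_add_cancel]

theorem map_sum (k : ℤ) {ι : Type*} (s : Finset ι) (f : ι → S) :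
    σ k (∑ i ∈ s, f i) = ∑ i ∈ s, σ k (f i) :=
  _root_.map_sum (AddMonoidHom.mk' (σ k) (hσ.map_add k)) f s

theorem opMul_lambda_right (j : ℤ) (F : ℤ → S) (n : ℤ) :
    opMul σ F (opLambda j) n = F (n - j) := by
  rw [opMul, finsum_eq_single _ (n - j)]
  · simp [opLambda, hσ.map_one]
  · intro k hk
    have : n - k ≠ j := by omega
    simp [opLambda, this, hσ.map_zero]

theorem opMul_lax_left (v w : S) (F : ℤ → S) (n : ℤ) :
    opMul σ (lax v w) F n = σ 1 (F (n - 1)) + v * F n + w * σ (-1) (F (n + 1)) := by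
  rw [opMul, finsum_eq_sum_of_support_subset (s := {1, 0, -1})]
  · rw [Finset.sum_insert (by decide), Finset.sum_insert (by decide), Finset.sum_singleton]
    simp [lax, hσ.zero]
    ring
  · intro k hk
    by_contra hk'
    simp at hk'
    exact hk (by simp [lax, hk'])

theorem opMul_lax_right (v w : S) (F : ℤ → S) (n : ℤ) :
    opMul σ F (lax v w) n = F (n - 1) + F n * σ n v + F (n + 1) * σ (n + 1) w := by
  rw [opMul, finsum_eq_sum_of_support_subset (s := {n - 1, n, n + 1})]
  · rw [Finset.sum_insert (by simp; omega), Finset.sum_insert (by simp), Finset.sum_singleton]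
    simp [lax, hσ.map_one]
    ring
  · intro k hk
    by_contra hk'
    simp at hk'
    apply hk
    have h1 : n - k ≠ 1 := by omega
    have h2 : n - k ≠ 0 := by omega
    have h3 : n - k ≠ -1 := by omega
    simp [lax, h1, h2, h3, hσ.map_zero]

theorem opMul_eq_sum {F G : ℤ → S} {a b : ℤ} (hF : ∀ k, a < k → F k = 0)
    (hG : ∀ k, b < k → G k = 0) (n : ℤ) (s : Finset ℤ) (hs : Finset.Icc (n - b) a ⊆ s) :
    opMul σ F G n = ∑ k ∈ s, F k * σ k (G (n - k)) := by
  rw [opMul]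
  refine finsum_eq_sum_of_support_subset _ fun k hk => hs ?_
  by_contra hk'
  simp only [Finset.mem_Icc, not_and_or, not_le] at hk'
  apply hk
  rcases hk' with h | h
  · simp only
    rw [hG _ (by omega), hσ.map_zero, mul_zero]
  · simp only
    rw [hF _ h, zero_mul]

theorem opMul_eq_zero {F G : ℤ → S} {a b : ℤ} (hF : ∀ k, a < k → F k = 0)
    (hG : ∀ k, b < k → G k = 0) (n : ℤ) (h : a + b < n) : opMul σ F G n = 0 := by
  rw [hσ.opMul_eq_sum hF hG n ∅, Finset.sum_empty]
  rw [Finset.Icc_eq_empty (by omega)]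

/-- Associativity for operators with finitely many positive powers of `Λ`. -/
theorem opMul_assoc {F G H : ℤ → S} {a b c : ℤ} (hF : ∀ k, a < k → F k = 0)
    (hG : ∀ k, b < k → G k = 0) (hH : ∀ k, c < k → H k = 0) :
    opMul σ (opMul σ F G) H = opMul σ F (opMul σ G H) := by
  funext n
  rw [hσ.opMul_eq_sum (fun k => hσ.opMul_eq_zero hF hG k) hH n _ subset_rfl,
    hσ.opMul_eq_sum hF (fun k => hσ.opMul_eq_zero hG hH k) n _ subset_rfl]
  have h1 : ∀ k ∈ Finset.Icc (n - c) (a + b), opMul σ F G k * σ k (H (n - k)) =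
      ∑ j ∈ Finset.Icc (n - (b + c)) a, F j * σ j (G (k - j)) * σ k (H (n - k)) := by
    intro k hk
    rw [Finset.mem_Icc] at hk
    rw [hσ.opMul_eq_sum hF hG k (Finset.Icc (n - (b + c)) a)
      (Finset.Icc_subset_Icc (by omega) le_rfl), Finset.sum_mul]
  have h2 : ∀ j ∈ Finset.Icc (n - (b + c)) a, F j * σ j (opMul σ G H (n - j)) =
      ∑ k ∈ Finset.Icc (n - c) (a + b), F j * σ j (G (k - j)) * σ k (H (n - k)) := by
    intro j hj
    rw [Finset.mem_Icc] at hj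
    rw [hσ.opMul_eq_sum hG hH (n - j) (Finset.Icc (n - c - j) (a + b - j))
      (Finset.Icc_subset_Icc (by omega) (by omega)), hσ.map_sum, Finset.mul_sum]
    refine Finset.sum_nbij' (fun l => l + j) (fun k => k - j) ?_ ?_ ?_ ?_ ?_
    · intro l hl; simp at hl ⊢; omega
    · intro k hk; simp at hk ⊢; omega
    · intro l _; simp
    · intro l _; simp
    · intro l _
      rw [hσ.map_mul, hσ.comp, add_sub_cancel_right, add_comm l j, mul_assoc, sub_sub]
  rw [Finset.sum_congr rfl h1, Finset.sum_congr rfl h2, Finset.sum_comm]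

end IsShiftAction

theorem opMul_comp_neg {S : Type*} [CommRing S] (σ : ℤ → S → S) (F G : ℤ → S) (n : ℤ) :
    opMul (fun k => σ (-k)) (fun k => F (-k)) (fun k => G (-k)) n = opMul σ F G (-n) := by
  rw [opMul, opMul, ← finsum_comp_equiv (Equiv.neg ℤ)]
  refine finsum_congr fun k => ?_
  simp only [Equiv.neg_apply]
  rw [neg_neg, show -(n - -k) = -n - k by ring]

theorem isShiftAction_lsShift {A : Type*} [CommRing A] [Algebra ℂ A] (dx : Derivation ℂ A A) :
    IsShiftAction (lsShift dx) where
  map_add k x y := by rw [lsShift_eq_lsOp, lsOp_map_add, ← lsShift_eq_lsOp, ← lsShift_eq_lsOp]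
  map_mul k x y := lsShift_mul dx k x y
  map_one k := by
    have h : (1 : LaurentSeries A) = toLS 1 := (map_one (HahnSeries.ofPowerSeries ℤ A)).symm
    rw [h, lsShift_toLS, ← psShiftHom_apply, map_one]
  zero x := by rw [lsShift_eq_lsOp, expS_zero, lsOp_one]
  comp j k x := by rw [lsShift_eq_lsOp, lsShift_eq_lsOp, lsShift_eq_lsOp, expS_add, lsOp_mul]

theorem lsShift_neg_derivation {A : Type*} [CommRing A] [Algebra ℂ A] (dx : Derivation ℂ A A)
    (k : ℤ) (f : LaurentSeries A) : lsShift (-dx) k f = lsShift dx (-k) f := by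
  rw [lsShift_eq_lsOp, lsShift_eq_lsOp, lsOp_neg_derivation, rescale_expS]

theorem isShiftAction_shiftR : IsShiftAction shiftR where
  map_add k x y := by rw [shiftR_eq, shiftR_eq, shiftR_eq, map_add]
  map_mul k x y := by rw [shiftR_eq, shiftR_eq, shiftR_eq, map_mul]
  map_one k := by rw [shiftR_eq, map_one]
  zero x := by rw [shiftR_eq_psOp, expS_zero, psOp_one]
  comp j k x := by rw [shiftR_eq_psOp, shiftR_eq_psOp, shiftR_eq_psOp, expS_add, psOp_mul]

/-! ### Iterated differences and the logarithm -/

section IterDiff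

variable {S : Type*} [CommRing S]

/-- For `L = Λ + v + w Λ⁻¹`, the coefficients of `T ^ j 1`, where `T F = L F Λ⁻¹ - F`. -/
noncomputable def iterDiff (σ : ℤ → S → S) (v w : S) : ℕ → ℤ → S
  | 0, n => opLambda 0 n
  | j + 1, n => σ 1 (iterDiff σ v w j n) + v * iterDiff σ v w j (n + 1) +
      w * σ (-1) (iterDiff σ v w j (n + 2)) - iterDiff σ v w j n

theorem map_iterDiff {S' : Type*} [CommRing S'] (Φ : S →+* S') (σ : ℤ → S → S)
    (σ' : ℤ → S' → S') (h : ∀ k x, Φ (σ k x) = σ' k (Φ x)) (v w : S) (j : ℕ) (n : ℤ) :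
    Φ (iterDiff σ v w j n) = iterDiff σ' (Φ v) (Φ w) j n := by
  induction j generalizing n with
  | zero =>
    simp only [iterDiff, opLambda]
    split_ifs <;> simp
  | succ j ih => simp only [iterDiff, map_sub, map_add, map_mul, h, ih]

/-- If `L = P Λ P⁻¹` then `T ^ j 1 = P ((Λ - 1) ^ j P⁻¹)`, with `Λ - 1` acting on coefficients. -/
theorem iterDiff_eq_dressing {σ : ℤ → S → S} (hσ : IsShiftAction σ) {v w : S} {P P' : ℤ → S}
    (h : IsDressingP σ (lax v w) P P') (j : ℕ) (n : ℤ) :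
    iterDiff σ v w j n = opMul σ P (fun m => (fun x => σ 1 x - x)^[j] (P' m)) n := by
  have hL : ∀ k, (1 : ℤ) < k → lax v w k = 0 := fun k hk => by
    have h1 : k ≠ 1 := by omega
    have h2 : k ≠ 0 := by omega
    have h3 : k ≠ -1 := by omega
    simp [lax, h1, h2, h3]
  have hΛ : ∀ k, (1 : ℤ) < k → (opLambda 1 : ℤ → S) k = 0 := fun k hk => by
    have h1 : k ≠ 1 := by omega
    simp [opLambda, h1]
  have hLP : opMul σ (lax v w) P = opMul σ P (opLambda 1) := by
    rw [h.eq, hσ.opMul_assoc (fun k => hσ.opMul_eq_zero h.pos hΛ k) h.pos' h.pos, h.inv_mul]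
    funext n
    rw [hσ.opMul_lambda_right, sub_zero]
  have hstep : ∀ Q : ℤ → S, (∀ k, 0 < k → Q k = 0) → ∀ n,
      σ 1 (opMul σ P Q n) + v * opMul σ P Q (n + 1) + w * σ (-1) (opMul σ P Q (n + 2)) =
        opMul σ P (fun m => σ 1 (Q m)) n := by
    intro Q hQ n
    have h1 := congrFun (hσ.opMul_assoc hL h.pos hQ) (n + 1)
    rw [hLP, hσ.opMul_lax_left, add_sub_cancel_right, show n + 1 + 1 = n + 2 by ring,
      hσ.opMul_assoc h.pos hΛ hQ] at h1
    rw [← h1, opMul, opMul]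
    refine finsum_congr fun k => ?_
    rw [opMul_lambda_left, show n + 1 - k - 1 = n - k by ring]
  induction j generalizing n with
  | zero =>
    simp only [iterDiff, Function.iterate_zero, id_eq]
    rw [h.mul_inv]
  | succ j ih =>
    have hQ : ∀ k, 0 < k → (fun x => σ 1 x - x)^[j] (P' k) = 0 := by
      intro k hk
      rw [h.pos' k hk]
      exact Function.iterate_fixed (by simp [hσ.map_zero]) j
    simp only [iterDiff, ih, Function.iterate_succ_apply']
    rw [hstep _ hQ, hσ.opMul_eq_sum h.pos (b := 0) (fun k hk => by rw [hQ k hk, hσ.map_zero]) n _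
      subset_rfl, hσ.opMul_eq_sum h.pos hQ n _ subset_rfl,
      hσ.opMul_eq_sum h.pos (b := 0)
        (fun k hk => by rw [hQ k hk, hσ.map_zero, sub_zero]) n _ subset_rfl,
      ← Finset.sum_sub_distrib]
    exact Finset.sum_congr rfl fun k _ => by rw [hσ.map_sub, mul_sub]

end IterDiff

/-- The coefficients of `log (1 + g) = ∑ ℓⱼ g ^ (j + 1)`. -/
noncomputable def logCoeff (j : ℕ) : ℂ := (-1) ^ j / (j + 1)

/-- The truncated series `∑ ℓⱼ (exp z - 1) ^ (j + 1)` of `log (exp z) = z`. -/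
noncomputable def logTrunc (J : ℕ) : PowerSeries ℂ :=
  ∑ j ∈ Finset.range J, logCoeff j • (expS 1 - 1) ^ (j + 1)

theorem X_dvd_expS_sub_one : (PowerSeries.X : PowerSeries ℂ) ∣ expS 1 - 1 := by
  rw [PowerSeries.X_dvd_iff, map_sub, ← PowerSeries.coeff_zero_eq_constantCoeff_apply, coeff_expS]
  simp

theorem X_pow_dvd_logTrunc_sub_X (J : ℕ) :
    (PowerSeries.X : PowerSeries ℂ) ^ (J + 1) ∣ logTrunc J - PowerSeries.X := by
  have hd : ∀ f : PowerSeries ℂ, PowerSeries.constantCoeff f = 0 →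
      PowerSeries.X ^ J ∣ PowerSeries.derivative ℂ f → PowerSeries.X ^ (J + 1) ∣ f := by
    intro f h0 h
    rw [PowerSeries.X_pow_dvd_iff] at h ⊢
    intro m hm
    cases m with
    | zero => simpa using h0
    | succ m =>
      have := h m (by omega)
      rw [PowerSeries.coeff_derivative] at this
      exact (mul_eq_zero.1 this).resolve_right (Nat.cast_add_one_ne_zero m)
  have hg0 : PowerSeries.constantCoeff (expS 1 - 1) = 0 :=
    PowerSeries.X_dvd_iff.1 X_dvd_expS_sub_one
  have hg : PowerSeries.derivative ℂ (expS 1 - 1) = 1 + (expS 1 - 1) := by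
    ext n
    rw [PowerSeries.coeff_derivative]
    simp only [map_sub, map_add, coeff_expS, PowerSeries.coeff_one]
    have h1 : ((n + 1).factorial : ℂ) ≠ 0 := by exact_mod_cast Nat.factorial_ne_zero _
    have h2 : (n.factorial : ℂ) ≠ 0 := by exact_mod_cast Nat.factorial_ne_zero _
    simp [Nat.factorial_succ]
    field_simp
  refine hd _ ?_ ?_
  · simp [logTrunc, hg0]
  · have : PowerSeries.derivative ℂ (logTrunc J - PowerSeries.X) = -(-(expS 1 - 1)) ^ J := by
      have hsum : PowerSeries.derivative ℂ (logTrunc J) =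
          (∑ j ∈ Finset.range J, (-(expS 1 - 1)) ^ j) * (1 + (expS 1 - 1)) := by
        rw [logTrunc, map_sum, Finset.sum_mul]
        refine Finset.sum_congr rfl fun j _ => ?_
        rw [Derivation.map_smul, Derivation.leibniz_pow, hg, add_tsub_cancel_right, smul_eq_mul,
          neg_pow (expS 1 - 1)]
        have hj : (j + 1 : ℂ) ≠ 0 := Nat.cast_add_one_ne_zero j
        rw [← Nat.cast_smul_eq_nsmul ℂ, smul_smul, logCoeff]
        push_cast
        rw [div_mul_cancel₀ _ hj, PowerSeries.smul_eq_C_mul]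
        simp [mul_assoc]
      have hgeom := geom_sum_mul (-(expS 1 - 1) : PowerSeries ℂ) J
      rw [map_sub, hsum]
      have hX : PowerSeries.derivative ℂ (PowerSeries.X : PowerSeries ℂ) = 1 := by simp
      rw [hX]
      linear_combination -hgeom
    rw [this, dvd_neg, neg_pow]
    exact (pow_dvd_pow_of_dvd X_dvd_expS_sub_one J).mul_left _

section Dressing

variable {A : Type*} [CommRing A] [Algebra ℂ A]

theorem X_pow_dvd_psOp (d : Derivation ℂ A A) {J : ℕ} {c : PowerSeries ℂ}
    (hc : PowerSeries.X ^ J ∣ c) (f : PowerSeries A) : PowerSeries.X ^ J ∣ psOp d c f := by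
  rw [PowerSeries.X_pow_dvd_iff] at hc ⊢
  intro m hm
  rw [coeff_psOp]
  refine Finset.sum_eq_zero fun kl hkl => ?_
  have := Finset.HasAntidiagonal.mem_antidiagonal.1 hkl
  rw [hc kl.1 (by omega), zero_smul]

theorem exists_coeff_mul_lsOp_eq_zero (d : Derivation ℂ A A) (f h : LaurentSeries A) (i : ℤ) :
    ∃ J₀ : ℕ, ∀ J, J₀ ≤ J → ∀ c, PowerSeries.X ^ J ∣ c → (f * lsOp d c h).coeff i = 0 := by
  obtain ⟨N, g, rfl⟩ := exists_rep f
  obtain ⟨M, g', rfl⟩ := exists_rep h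
  refine ⟨(i - (N + M)).toNat + 1, fun J hJ c hc => ?_⟩
  rw [lsOp_single_mul, mul_mul_mul_comm, HahnSeries.single_mul_single, one_mul, ← toLS_mul]
  by_cases hi : i < N + M
  · exact coeff_single_mul_toLS_of_lt _ _ _ hi
  · obtain ⟨n, rfl⟩ : ∃ n : ℕ, i = n + (N + M) := ⟨(i - (N + M)).toNat, by omega⟩
    rw [coeff_single_mul_toLS]
    exact PowerSeries.X_pow_dvd_iff.1 ((X_pow_dvd_psOp d hc g').mul_left g) n (by omega)

theorem iterate_lsShift_sub (d : Derivation ℂ A A) (j : ℕ) (f : LaurentSeries A) :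
    (fun x => lsShift d 1 x - x)^[j] f = lsOp d ((expS 1 - 1) ^ j) f := by
  induction j with
  | zero => rw [pow_zero, lsOp_one]; rfl
  | succ j ih =>
    rw [Function.iterate_succ_apply', ih, pow_succ', lsOp_mul, lsOp_sub, lsOp_one,
      lsShift_eq_lsOp]

theorem lsMap_add (d : Derivation ℂ A A) (f g : LaurentSeries A) :
    lsMap d (f + g) = lsMap d f + lsMap d g := by
  ext i; simp [lsMap]

theorem lsMap_sum (d : Derivation ℂ A A) {ι : Type*} (s : Finset ι) (f : ι → LaurentSeries A) :
    lsMap d (∑ i ∈ s, f i) = ∑ i ∈ s, lsMap d (f i) :=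
  map_sum (AddMonoidHom.mk' (lsMap d) (lsMap_add d)) f s

theorem lsMap_zero (d : Derivation ℂ A A) : lsMap d 0 = 0 := by
  ext i; simp [lsMap]

theorem lsMap_opLambda (d : Derivation ℂ A A) (j n : ℤ) : lsMap d (opLambda j n) = 0 := by
  rw [opLambda]
  split_ifs
  · have := lsMap_mul d 1 1
    rw [mul_one, one_mul] at this
    exact left_eq_add.1 this
  · exact lsMap_zero d

theorem lsMap_lsShift (d : Derivation ℂ A A) (s : ℤ) (f : LaurentSeries A) :
    lsMap d (lsShift d s f) = lsShift d s (lsMap d f) := by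
  rw [lsShift_eq_lsOp, lsShift_eq_lsOp, lsMap_lsOp d d fun _ => rfl]

theorem lsShift_eps_mul (d : Derivation ℂ A A) (s : ℤ) (f : LaurentSeries A) :
    lsShift d s (lsEps A * f) = lsEps A * lsShift d s f := by
  rw [lsShift_eq_lsOp, lsShift_eq_lsOp, lsOp_eps_mul]

/-- `-ε Pₓ P⁻¹ = P (ε ∂ₓ P⁻¹)`, by differentiating `P P⁻¹ = 1`. -/
theorem neg_epsPxPinv (d : Derivation ℂ A A) {P P' : ℤ → LaurentSeries A}
    (hP : ∀ k, 0 < k → P k = 0) (hP' : ∀ k, 0 < k → P' k = 0)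
    (h : opMul (lsShift d) P P' = opLambda 0) (n : ℤ) :
    -epsPxPinv d P P' n = ∑ k ∈ Finset.Icc n 0,
      P k * lsShift d k (lsOp d PowerSeries.X (P' (n - k))) := by
  have hσ := isShiftAction_lsShift d
  have h1 := congrArg (lsMap d) (congrFun h n)
  rw [lsMap_opLambda, hσ.opMul_eq_sum hP hP' n (Finset.Icc n 0) (by rw [sub_zero]), lsMap_sum] at h1
  rw [epsPxPinv, hσ.opMul_eq_sum (a := 0) (fun k hk => by rw [hP k hk, lsMap_zero, mul_zero]) hP' n
    (Finset.Icc n 0) (by rw [sub_zero]), neg_eq_iff_add_eq_zero, ← Finset.sum_add_distrib]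
  rw [← mul_zero (lsEps A), ← h1, Finset.mul_sum]
  refine Finset.sum_congr rfl fun k _ => ?_
  rw [lsMap_mul, lsMap_lsShift, lsOp_X, lsShift_eps_mul]
  ring

/-- `-ε Pₓ P⁻¹` is the sum of the logarithmic series `∑ ℓⱼ T ^ (j + 1) 1`, which converges
`ε`-adically. -/
theorem exists_coeff_sum_iterDiff (d : Derivation ℂ A A) {v w : LaurentSeries A}
    {P P' : ℤ → LaurentSeries A} (h : IsDressingP (lsShift d) (lax v w) P P') (n i : ℤ) :
    ∃ J₀ : ℕ, ∀ J, J₀ ≤ J →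
      (∑ j ∈ Finset.range J, logCoeff j • iterDiff (lsShift d) v w (j + 1) n).coeff i =
        (-epsPxPinv d P P' n).coeff i := by
  have hσ := isShiftAction_lsShift d
  choose J₀ hJ₀ using fun k : ℤ => exists_coeff_mul_lsOp_eq_zero d (P k) (P' (n - k)) i
  refine ⟨(Finset.Icc n 0).sup J₀, fun J hJ => ?_⟩
  have hb : ∀ j, iterDiff (lsShift d) v w j n = ∑ k ∈ Finset.Icc n 0,
      P k * lsOp d (expS k * (expS 1 - 1) ^ j) (P' (n - k)) := by
    intro j
    rw [iterDiff_eq_dressing hσ h, hσ.opMul_eq_sum h.pos (b := 0) _ n (Finset.Icc n 0)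
      (by rw [sub_zero])]
    · refine Finset.sum_congr rfl fun k _ => ?_
      rw [iterate_lsShift_sub, lsShift_eq_lsOp, ← lsOp_mul]
    · intro k hk
      rw [h.pos' k hk]
      exact Function.iterate_fixed (by simp [hσ.map_zero]) j
  have hsum : ∑ j ∈ Finset.range J, logCoeff j • iterDiff (lsShift d) v w (j + 1) n =
      ∑ k ∈ Finset.Icc n 0, P k * lsOp d (expS k * logTrunc J) (P' (n - k)) := by
    simp only [hb, Finset.smul_sum]
    rw [Finset.sum_comm]
    refine Finset.sum_congr rfl fun k _ => ?_
    rw [logTrunc, Finset.mul_sum]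
    clear hJ
    induction J with
    | zero =>
      have h0 := lsOp_sub d 0 0 (P' (n - k))
      rw [sub_self, sub_self] at h0
      simp [h0]
    | succ J ih =>
      rw [Finset.sum_range_succ, Finset.sum_range_succ, lsOp_add, mul_add, ih, mul_smul_comm,
        lsOp_smul, ls_mul_smul]
  rw [hsum, neg_epsPxPinv d h.pos h.pos' h.mul_inv, ← sub_eq_zero, ← HahnSeries.coeff_sub,
    ← Finset.sum_sub_distrib, HahnSeries.coeff_sum]
  refine Finset.sum_eq_zero fun k hk => ?_
  rw [lsShift_eq_lsOp, ← lsOp_mul, ← mul_sub, ← lsOp_sub, ← mul_sub]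
  exact hJ₀ k J ((Finset.le_sup hk).trans hJ) _
    (((pow_dvd_pow _ (Nat.le_succ J)).trans (X_pow_dvd_logTrunc_sub_X J)).mul_left _)

end Dressing

/-! ### Existence of dressing operators -/

section Existence

variable {S : Type*} [CommRing S]

/-- The coefficients of the right inverse of `∑ p k Λ ^ (-k)`, `p 0 = 1`. -/
noncomputable def invSeq (σ : ℤ → S → S) (p : ℕ → S) : ℕ → S
  | k => (if k = 0 then 1 else 0) -
      ∑ i : Fin k, p (k - i) * σ (-((k - i : ℕ) : ℤ)) (invSeq σ p i)
termination_by k => k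
decreasing_by exact i.2

theorem exists_right_inverse {σ : ℤ → S → S} (hσ : IsShiftAction σ) (P : ℤ → S)
    (hP : ∀ k, 0 < k → P k = 0) (hP0 : P 0 = 1) :
    ∃ Q : ℤ → S, (∀ k, 0 < k → Q k = 0) ∧ Q 0 = 1 ∧ opMul σ P Q = opLambda 0 := by
  let q := invSeq σ fun k => P (-(k : ℤ))
  have hq : ∀ k, q k + ∑ i ∈ Finset.range k, P (-((k - i : ℕ) : ℤ)) *
      σ (-((k - i : ℕ) : ℤ)) (q i) = if k = 0 then 1 else 0 := by
    intro k
    have : q k = _ := invSeq.eq_1 σ _ k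
    rw [this, Finset.sum_range fun i => P (-((k - i : ℕ) : ℤ)) * σ (-((k - i : ℕ) : ℤ)) (q i)]
    exact sub_add_cancel _ _
  have hQ : ∀ k, 0 < k → (fun k : ℤ => if 0 < k then 0 else q (-k).toNat) k = 0 :=
    fun k hk => if_pos hk
  refine ⟨_, hQ, ?_, ?_⟩
  · have := hq 0
    simpa using this
  · funext n
    rcases lt_or_ge 0 n with hn | hn
    · rw [hσ.opMul_eq_zero hP hQ n (by omega), opLambda, if_neg (by omega)]
    · obtain ⟨k, rfl⟩ : ∃ k : ℕ, n = -k := ⟨(-n).toNat, by omega⟩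
      let e : ℕ ↪ ℤ := ⟨fun i => -((k : ℤ) - i), fun i j (h : -((k : ℤ) - i) = -((k : ℤ) - j)) => by
        omega⟩
      have he : ∀ i, e i = -((k : ℤ) - i) := fun _ => rfl
      rw [hσ.opMul_eq_sum hP hQ _ ((Finset.range (k + 1)).map e), Finset.sum_map]
      · have h1 := hq k
        rw [Finset.sum_range_succ, add_comm]
        simp only [he, sub_self, neg_zero, hP0, hσ.zero, one_mul]
        rw [sub_zero, if_neg (by omega), neg_neg, Int.toNat_natCast, opLambda]
        have h2 : ((-(k : ℤ) = 0) ↔ k = 0) := by omega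
        simp only [h2]
        rw [← h1]
        congr 1
        refine Finset.sum_congr rfl fun i hi => ?_
        have hi' : i < k := Finset.mem_range.1 hi
        have h3 : ((k - i : ℕ) : ℤ) = (k : ℤ) - i := by omega
        have h4 : -(-(k : ℤ) - -((k : ℤ) - i)) = i := by ring
        rw [if_neg (by omega), h3, h4, Int.toNat_natCast]
      · intro j hj
        simp only [Finset.mem_Icc] at hj
        simp only [Finset.mem_map, Finset.mem_range, he]
        exact ⟨(j + k).toNat, by omega, by omega⟩

/-- Unipotent operators are invertible. -/
theorem exists_inverse {σ : ℤ → S → S} (hσ : IsShiftAction σ) (P : ℤ → S)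
    (hP : ∀ k, 0 < k → P k = 0) (hP0 : P 0 = 1) :
    ∃ Q : ℤ → S, (∀ k, 0 < k → Q k = 0) ∧ opMul σ P Q = opLambda 0 ∧
      opMul σ Q P = opLambda 0 := by
  obtain ⟨Q, hQ, hQ0, hPQ⟩ := exists_right_inverse hσ P hP hP0
  obtain ⟨R, hR, -, hQR⟩ := exists_right_inverse hσ Q hQ hQ0
  refine ⟨Q, hQ, hPQ, ?_⟩
  have h := hσ.opMul_assoc hP hQ hR
  rw [hPQ, hQR] at h
  have h1 : R = P := by
    funext n
    have := congrFun h n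
    rw [opMul_lambda_left, hσ.opMul_lambda_right, hσ.zero, sub_zero] at this
    exact this
  rw [← h1, hQR]

/-- If `Λ - 1` is surjective then `L = Λ + v + w Λ⁻¹` has a dressing operator: `L P = P Λ` reads
`(Λ - 1) pₖ = -(v pₖ₋₁ + w Λ⁻¹ pₖ₋₂)`. -/
theorem exists_isDressingP {σ : ℤ → S → S} (hσ : IsShiftAction σ)
    (hsurj : ∀ y, ∃ x, σ 1 x - x = y) (v w : S) :
    ∃ P P' : ℤ → S, IsDressingP σ (lax v w) P P' := by
  choose g hg using hsurj
  -- the pair `(pₖ, pₖ₊₁)` with `p₋₁ = 0` is built by recursion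
  let pp : ℕ → S × S := fun k => Nat.rec (0, 1)
    (fun _ x => (x.2, g (-(v * x.2 + w * σ (-1) x.1)))) k
  have hpp1 : ∀ k, (pp (k + 1)).1 = (pp k).2 := fun k => rfl
  have hpp2 : ∀ k, (pp (k + 1)).2 = g (-(v * (pp k).2 + w * σ (-1) (pp k).1)) := fun k => rfl
  let P : ℤ → S := fun k => if 0 < k then 0 else (pp (-k).toNat).2
  have hP : ∀ k, 0 < k → P k = 0 := fun k hk => if_pos hk
  have hPneg : ∀ k : ℕ, P (-(k : ℤ)) = (pp k).2 := fun k => by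
    simp only [P]
    rw [if_neg (by omega), neg_neg, Int.toNat_natCast]
  have hPneg' : ∀ k : ℕ, P (-(k : ℤ) + 1) = (pp k).1 := fun k => by
    cases k with
    | zero => exact hP _ (by simp)
    | succ k =>
      rw [hpp1, ← hPneg]
      congr 1
      push_cast
      ring
  have hP0 : P 0 = 1 := hPneg 0
  obtain ⟨P', hP', h1, h2⟩ := exists_inverse hσ P hP hP0
  refine ⟨P, P', hP0, hP, hP', h1, h2, ?_⟩
  have hLP : opMul σ (lax v w) P = opMul σ P (opLambda 1) := by
    funext n
    rw [hσ.opMul_lax_left, hσ.opMul_lambda_right]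
    rcases lt_trichotomy 1 n with hn | rfl | hn
    · rw [hP (n - 1) (by omega), hP n (by omega), hP (n + 1) (by omega), hσ.map_zero, hσ.map_zero]
      ring
    · rw [sub_self, hP0, hP 1 (by omega), hP (1 + 1) (by omega), hσ.map_zero, hσ.map_one]
      ring
    · obtain ⟨k, rfl⟩ : ∃ k : ℕ, n = -k := ⟨(-n).toNat, by omega⟩
      have h3 := hg (-(v * (pp k).2 + w * σ (-1) (pp k).1))
      have h4 : -(k : ℤ) - 1 = -((k + 1 : ℕ) : ℤ) := by push_cast; ring
      rw [← hpp2, ← hPneg (k + 1), ← h4, ← hPneg k, ← hPneg' k] at h3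
      linear_combination h3
  have hL : ∀ k, (1 : ℤ) < k → lax v w k = 0 := fun k hk => by
    have h1 : k ≠ 1 := by omega
    have h2 : k ≠ 0 := by omega
    have h3 : k ≠ -1 := by omega
    simp [lax, h1, h2, h3]
  rw [← hLP, hσ.opMul_assoc hL hP hP', h1]
  funext n
  rw [hσ.opMul_lambda_right, sub_zero]

end Existence

/-! ### The logarithmic series in `A[[ε]]` -/

section LogSeries

variable {A : Type*} [CommRing A] [Algebra ℂ A]

theorem isShiftAction_psShift (d : Derivation ℂ A A) : IsShiftAction (psShift d) where
  map_add k x y := by rw [← psShiftHom_apply, ← psShiftHom_apply, ← psShiftHom_apply, map_add]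
  map_mul k x y := by rw [← psShiftHom_apply, ← psShiftHom_apply, ← psShiftHom_apply, map_mul]
  map_one k := by rw [← psShiftHom_apply, map_one]
  zero x := by rw [psShift_eq_psOp, expS_zero, psOp_one]
  comp j k x := by rw [psShift_eq_psOp, psShift_eq_psOp, psShift_eq_psOp, expS_add, psOp_mul]

theorem shiftR_eq_psShift : shiftR = psShift totalD := by
  funext s f
  rw [shiftR_eq, psShiftHom_apply]

theorem psShift_neg_derivation (d : Derivation ℂ A A) (s : ℤ) (f : PowerSeries A) :
    psShift (-d) s f = psShift d (-s) f := by
  rw [psShift_eq_psOp, psShift_eq_psOp, psOp_neg_derivation, rescale_expS]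

theorem X_pow_dvd_psOp_of_dvd (d : Derivation ℂ A A) (c : PowerSeries ℂ) {a : ℕ}
    {f : PowerSeries A} (h : PowerSeries.X ^ a ∣ f) : PowerSeries.X ^ a ∣ psOp d c f := by
  obtain ⟨g, rfl⟩ := h
  rw [psOp_X_pow_mul]
  exact dvd_mul_right _ _

/-- The coefficient of `Λ ^ n` in `T ^ j 1` is divisible by `ε ^ (j + n)`. -/
theorem X_pow_dvd_iterDiff (d : Derivation ℂ A A) (v w : PowerSeries A) (j : ℕ) (n : ℤ) (a : ℕ)
    (h : (a : ℤ) ≤ j + n) : PowerSeries.X ^ a ∣ iterDiff (psShift d) v w j n := by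
  induction j generalizing n a with
  | zero =>
    rw [iterDiff, opLambda]
    split_ifs with hn
    · obtain rfl : a = 0 := by omega
      simp
    · exact dvd_zero _
  | succ j ih =>
    cases a with
    | zero => simp
    | succ a =>
      have h1 : PowerSeries.X ^ (a + 1) ∣
          psShift d 1 (iterDiff (psShift d) v w j n) - iterDiff (psShift d) v w j n := by
        obtain ⟨g, hg⟩ := ih n a (by omega)
        rw [psShift_eq_psOp, hg, psOp_X_pow_mul, ← mul_sub, pow_succ]
        refine mul_dvd_mul_left _ ?_
        have h2 := psOp_sub d (expS 1) 1 g
        rw [psOp_one] at h2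
        rw [← h2]
        have h3 := X_pow_dvd_psOp d (J := 1) (c := expS 1 - 1)
          (by rw [pow_one]; exact X_dvd_expS_sub_one) g
        rwa [pow_one] at h3
      have h2 := (ih (n + 1) (a + 1) (by push_cast at h ⊢; omega)).mul_left v
      have h3 := (X_pow_dvd_psOp_of_dvd d (expS (-1))
        (ih (n + 2) (a + 1) (by push_cast at h ⊢; omega))).mul_left w
      rw [← psShift_eq_psOp] at h3
      have h4 := dvd_add (dvd_add h1 h2) h3
      rw [iterDiff]
      convert h4 using 1
      ring

/-- The coefficient of `Λ ^ (-k)` in `∑ ℓⱼ T ^ (j + 1) 1`; by `X_pow_dvd_iterDiff`, the terms that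
are left out do not contribute to the coefficient of `ε ^ n`. -/
noncomputable def logSeries (d : Derivation ℂ A A) (v w : PowerSeries A) (k : ℕ) : PowerSeries A :=
  PowerSeries.mk fun n => ∑ j ∈ Finset.range (n + k),
    logCoeff j • PowerSeries.coeff n (iterDiff (psShift d) v w (j + 1) (-(k : ℤ)))

theorem X_pow_dvd_sum_sub_logSeries (d : Derivation ℂ A A) (v w : PowerSeries A) (k n J : ℕ)
    (hJ : n + k ≤ J) : PowerSeries.X ^ (n + 1) ∣
      (∑ j ∈ Finset.range J, logCoeff j • iterDiff (psShift d) v w (j + 1) (-(k : ℤ))) -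
        logSeries d v w k := by
  rw [PowerSeries.X_pow_dvd_iff]
  intro m hm
  rw [map_sub, map_sum, logSeries, PowerSeries.coeff_mk, sub_eq_zero]
  symm
  simp only [PowerSeries.coeff_smul]
  refine Finset.sum_subset (Finset.range_subset_range.2 (by omega)) fun j _ hj => ?_
  rw [Finset.mem_range, not_lt] at hj
  rw [PowerSeries.X_pow_dvd_iff.1 (X_pow_dvd_iterDiff d v w (j + 1) (-(k : ℤ)) (m + 1)
    (by push_cast; omega)) m (by omega), smul_zero]

end LogSeries

section LogEval

variable {A : Type*} [CommRing A] [Algebra ℂ A]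

theorem toLS_evalHom_logSeries (dx : Derivation ℂ A A) (v u : PowerSeries A)
    (E : (PowerSeries A)ˣ) (D : Derivation ℂ DiffPoly DiffPoly) (d : Derivation ℂ A A)
    (hD : ∀ s f, evalHom dx v u E (psShift D s f) = psShift d s (evalHom dx v u E f))
    (v₀ w₀ : DiffSeries) {P P' : ℤ → LaurentSeries A}
    (h : IsDressingP (lsShift d)
      (lax (toLS (evalHom dx v u E v₀)) (toLS (evalHom dx v u E w₀))) P P') (k : ℕ) :
    toLS (evalHom dx v u E (logSeries D v₀ w₀ k)) = -epsPxPinv d P P' (-(k : ℤ)) := by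
  let Φ : DiffSeries →+* LaurentSeries A := (HahnSeries.ofPowerSeries ℤ A).comp (evalHom dx v u E)
  have hΦ : ∀ f, Φ f = toLS (evalHom dx v u E f) := fun f => rfl
  have hmap : ∀ j n, toLS (evalHom dx v u E (iterDiff (psShift D) v₀ w₀ j n)) =
      iterDiff (lsShift d) (toLS (evalHom dx v u E v₀)) (toLS (evalHom dx v u E w₀)) j n := by
    intro j n
    refine map_iterDiff Φ _ _ (fun k x => ?_) _ _ _ _
    rw [hΦ, hΦ, hD, lsShift_toLS]
  ext i
  obtain ⟨J₀, hJ₀⟩ := exists_coeff_sum_iterDiff d h (-(k : ℤ)) i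
  rw [← hJ₀ (max J₀ (i.toNat + k)) (le_max_left _ _)]
  simp only [← hmap]
  have hsum : ∀ J, ∑ j ∈ Finset.range J, logCoeff j •
      toLS (evalHom dx v u E (iterDiff (psShift D) v₀ w₀ (j + 1) (-(k : ℤ)))) =
      toLS (evalHom dx v u E (∑ j ∈ Finset.range J,
        logCoeff j • iterDiff (psShift D) v₀ w₀ (j + 1) (-(k : ℤ)))) := by
    intro J
    rw [← hΦ, map_sum]
    refine Finset.sum_congr rfl fun j _ => ?_
    rw [hΦ, evalHom_smul, toLS_smul]
  rw [hsum]
  obtain ⟨g, hg⟩ := X_pow_dvd_sum_sub_logSeries D v₀ w₀ k i.toNat (max J₀ (i.toNat + k))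
    (le_max_right _ _)
  rw [sub_eq_iff_eq_add] at hg
  rw [hg, map_add, toLS_add, HahnSeries.coeff_add]
  have hX : evalHom dx v u E (PowerSeries.X ^ (i.toNat + 1) * g) =
      PowerSeries.X ^ (i.toNat + 1) * evalHom dx v u E g := by
    generalize i.toNat + 1 = m
    induction m with
    | zero => simp
    | succ m ih => rw [pow_succ', mul_assoc, evalHom_X_mul, ih, pow_succ', mul_assoc]
  have h1 := single_add_mul_toLS 0 (i.toNat + 1) (evalHom dx v u E g)
  rw [HahnSeries.single_zero_one, one_mul] at h1
  rw [hX, ← h1, coeff_single_mul_toLS_of_lt _ _ _ (by push_cast; omega), zero_add]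

end LogEval

/-! ### The logarithm of the Lax operator -/

/-- The power series `(exp z - 1) / z`. -/
noncomputable def expDiv : PowerSeries ℂ :=
  PowerSeries.mk fun n => PowerSeries.coeff (n + 1) (expS 1)

theorem X_mul_expDiv : PowerSeries.X * expDiv = expS 1 - 1 := by
  ext n
  cases n with
  | zero => rw [map_sub, coeff_expS]; simp
  | succ n => simp [expDiv, PowerSeries.coeff_succ_X_mul, PowerSeries.coeff_one]

theorem constantCoeff_expDiv : PowerSeries.constantCoeff expDiv = 1 := by
  rw [← PowerSeries.coeff_zero_eq_constantCoeff_apply, expDiv, PowerSeries.coeff_mk, coeff_expS]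
  simp

theorem expDiv_mul_inv : expDiv * expDiv⁻¹ = 1 :=
  PowerSeries.mul_inv_cancel _ (by rw [constantCoeff_expDiv]; exact one_ne_zero)

/-- The power series `z / (1 - exp (-z))`. -/
noncomputable def todd : PowerSeries ℂ := expS 1 * expDiv⁻¹

theorem todd_mul : todd * (1 - expS (-1)) = PowerSeries.X := by
  have h : expS 1 * expS (-1) = 1 := by rw [← expS_add, ← expS_zero]; rfl
  rw [todd]
  linear_combination (PowerSeries.X) * expDiv_mul_inv - expDiv⁻¹ * h - expDiv⁻¹ * X_mul_expDiv

/-- The coefficients of `log L`.  Those of `Λ ^ (-k)` come from `-½ ε Pₓ P⁻¹`; those of `Λ ^ k` come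
from `½ ε Qₓ Q⁻¹`, in the same way after exchanging `Λ` and `Λ⁻¹`, that is, reversing the sign
of `∂ₓ`, and conjugating by `q₀`. -/
noncomputable def logExplicit (k : ℤ) : DiffSeries :=
  if k < 0 then
    (1 / 2 : ℂ) • logSeries totalD (PowerSeries.C (jet (JetVar.v 0))) (PowerSeries.C expU.val)
      (-k).toNat
  else if k = 0 then (1 / 2 : ℂ) • psOp totalD todd (PowerSeries.C (jet (JetVar.u 0)))
  else
    (1 / 2 : ℂ) • (logSeries (-totalD) (PowerSeries.C (jet (JetVar.v 0)))
      (shiftR 1 (PowerSeries.C expU.val)) k.toNat *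
        q0Ratio shiftR (PowerSeries.C expU.val) (PowerSeries.C expU.inv) k)

theorem q0Ratio_zero {S : Type*} [CommRing S] (σ : ℤ → S → S) (E E' : S) :
    q0Ratio σ E E' 0 = 1 := Finset.prod_range_zero _

theorem q0Ratio_one {S : Type*} [CommRing S] (σ : ℤ → S → S) (E E' : S) :
    q0Ratio σ E E' 1 = σ 1 E' := by
  have : q0Ratio σ E E' 1 = ∏ j ∈ Finset.range 1, σ ((j : ℤ) + 1) E' := rfl
  rw [this]
  simp

theorem q0Ratio_neg_one {S : Type*} [CommRing S] {σ : ℤ → S → S} (hσ : IsShiftAction σ)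
    (E E' : S) : q0Ratio σ E E' (-1) = E := by
  have : q0Ratio σ E E' (-1) = ∏ j ∈ Finset.range 1, σ (-(j : ℤ)) E := rfl
  rw [this]
  simp [hσ.zero]

theorem q0Ratio_mul_swap {S : Type*} [CommRing S] {σ : ℤ → S → S} (hσ : IsShiftAction σ)
    {E E' : S} (h : E * E' = 1) (k : ℤ) : q0Ratio σ E E' k * q0Ratio σ E' E k = 1 := by
  have h' : E' * E = 1 := by rw [mul_comm, h]
  cases k with
  | ofNat n =>
    rw [q0Ratio, q0Ratio, ← Finset.prod_mul_distrib]
    refine Finset.prod_eq_one fun j _ => ?_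
    rw [← hσ.map_mul, h', hσ.map_one]
  | negSucc n =>
    rw [q0Ratio, q0Ratio, ← Finset.prod_mul_distrib]
    refine Finset.prod_eq_one fun j _ => ?_
    rw [← hσ.map_mul, h, hσ.map_one]

theorem map_q0Ratio {S S' : Type*} [CommRing S] [CommRing S'] (Φ : S →+* S') (σ : ℤ → S → S)
    (σ' : ℤ → S' → S') (h : ∀ k x, Φ (σ k x) = σ' k (Φ x)) (E E' : S) (k : ℤ) :
    Φ (q0Ratio σ E E' k) = q0Ratio σ' (Φ E) (Φ E') k := by
  cases k with
  | ofNat n => rw [q0Ratio, q0Ratio, map_prod]; simp only [h]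
  | negSucc n => rw [q0Ratio, q0Ratio, map_prod]; simp only [h]

/-- Conjugated by `q₀⁻¹` and with `Λ`, `Λ⁻¹` exchanged, `Λ + v + E Λ⁻¹` becomes
`Λ + v + (Λ E) Λ⁻¹`. -/
theorem lax_eq_q0Conj_iff {S : Type*} [CommRing S] {σ : ℤ → S → S} (hσ : IsShiftAction σ)
    {v E E' : S} (h : E * E' = 1) (F : ℤ → S) :
    lax v E = q0Conj σ E E' F ↔ lax v (σ 1 E) = fun k => F (-k) := by
  have h1 : σ 1 E * σ 1 E' = 1 := by rw [← hσ.map_mul, h, hσ.map_one]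
  have key : lax v E = q0Conj σ E E' fun k => lax v (σ 1 E) (-k) := by
    funext k
    rw [q0Conj]
    by_cases k1 : k = 1
    · subst k1
      simp [lax, q0Ratio_one, h1]
    by_cases k0 : k = 0
    · subst k0
      simp [lax, q0Ratio_zero]
    by_cases k2 : k = -1
    · subst k2
      simp [lax, q0Ratio_neg_one hσ]
    have hk : -k ≠ 1 ∧ -k ≠ 0 ∧ -k ≠ -1 := by omega
    simp only [lax, k0, k1, k2, hk.1, hk.2.1, hk.2.2, if_false, zero_mul]
  constructor
  · intro hF
    rw [key] at hF
    funext k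
    have h2 := congrFun hF (-k)
    simp only [q0Conj, neg_neg] at h2
    have h3 := q0Ratio_mul_swap hσ h (-k)
    linear_combination q0Ratio σ E' E (-k) * h2 - (lax v (σ 1 E) k - F (-k)) * h3
  · intro hF
    rw [key, hF]
    simp only [neg_neg]

section Logarithm

variable {A : Type*} [CommRing A] [Algebra ℂ A]

theorem epsPxPinv_eq_zero (d : Derivation ℂ A A) {P P' : ℤ → LaurentSeries A}
    (hP : ∀ k, 0 < k → P k = 0) (hP0 : P 0 = 1) (hP' : ∀ k, 0 < k → P' k = 0) (n : ℤ)
    (hn : 0 ≤ n) : epsPxPinv d P P' n = 0 := by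
  have h : ∀ k, -1 < k → lsEps A * lsMap d (P k) = 0 := by
    intro k hk
    rcases (show (0 : ℤ) ≤ k by omega).eq_or_lt with rfl | hk
    · have := lsMap_opLambda d 0 0
      rw [opLambda, if_pos rfl] at this
      rw [hP0, this, mul_zero]
    · rw [hP k hk, lsMap_zero, mul_zero]
  exact (isShiftAction_lsShift d).opMul_eq_zero h hP' n (by omega)

theorem lsShift_neg_derivation' (d : Derivation ℂ A A) :
    lsShift (-d) = fun k => lsShift d (-k) := by
  funext k f
  exact lsShift_neg_derivation d k f

/-- The operator `ε Rₓ R⁻¹` after exchanging `Λ` and `Λ⁻¹`. -/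
theorem opMul_eps_eq_neg_epsPxPinv (d : Derivation ℂ A A) (R R' : ℤ → LaurentSeries A) (n : ℤ) :
    opMul (lsShift d) (fun k => lsEps A * lsMap d (R k)) R' n =
      -epsPxPinv (-d) (fun k => R (-k)) (fun k => R' (-k)) (-n) := by
  rw [epsPxPinv, lsShift_neg_derivation', ← neg_neg n, ← opMul_comp_neg, opMul, opMul,
    ← finsum_neg_distrib]
  refine finsum_congr fun k => ?_
  have h : ∀ f : LaurentSeries A, lsMap (-d) f = -lsMap d f := fun f => by
    ext i; simp [lsMap]
  rw [h, neg_neg]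
  ring

theorem opLambda_neg {S : Type*} [CommRing S] (j : ℤ) :
    (opLambda j : ℤ → S) = fun k => opLambda (-j) (-k) := by
  funext k
  simp [opLambda]

/-- Dressing operators `Q = q₀ R` of `L = Λ + v + E Λ⁻¹` correspond to dressing operators of the
first kind, for the derivation `-∂`, of `Λ + v + (Λ E) Λ⁻¹`. -/
theorem isDressingP_reflect_iff (d : Derivation ℂ A A) {u v E E' φ : LaurentSeries A}
    (hE : E * E' = 1) (hφ : φ - lsShift d (-1) φ = u) (R R' : ℤ → LaurentSeries A) :
    IsDressingP (lsShift (-d)) (lax v (lsShift d 1 E)) (fun k => R (-k)) (fun k => R' (-k)) ↔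
      IsDressingQ (lsShift d) u E E' (lax v E) φ R R' := by
  have hσ := isShiftAction_lsShift d
  have hmul : ∀ F G : ℤ → LaurentSeries A, opMul (lsShift (-d)) (fun k => F (-k)) (fun k => G (-k)) =
      fun n => opMul (lsShift d) F G (-n) := by
    intro F G
    funext n
    rw [lsShift_neg_derivation', opMul_comp_neg]
  have hrefl : ∀ F G : ℤ → LaurentSeries A, (fun n => F (-n)) = (fun n => G (-n)) ↔ F = G := by
    intro F G
    constructor
    · intro h
      funext n
      simpa using congrFun h (-n)
    · rintro rfl; rfl
  have h0 : (opLambda 0 : ℤ → LaurentSeries A) = fun n => opLambda 0 (-n) := by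
    simpa using opLambda_neg (S := LaurentSeries A) 0
  have heq : (lax v (lsShift d 1 E) = opMul (lsShift (-d)) (opMul (lsShift (-d))
        (fun k => R (-k)) (opLambda 1)) (fun k => R' (-k))) ↔
      lax v E = q0Conj (lsShift d) E E'
        (opMul (lsShift d) (opMul (lsShift d) R (opLambda (-1))) R') := by
    rw [lax_eq_q0Conj_iff hσ hE, opLambda_neg 1, hmul, hmul]
  constructor
  · intro h
    refine ⟨hφ, by simpa using h.zero, fun k hk => by simpa using h.pos (-k) (by omega),
      fun k hk => by simpa using h.pos' (-k) (by omega), ?_, ?_, heq.1 h.eq⟩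
    · rw [← hrefl, ← hmul, ← h0]; exact h.mul_inv
    · rw [← hrefl, ← hmul, ← h0]; exact h.inv_mul
  · intro h
    refine ⟨by simpa using h.zero, fun k hk => h.neg _ (by omega), fun k hk => h.neg' _ (by omega),
      ?_, ?_, heq.2 h.eq⟩
    · rw [hmul, h.mul_inv, ← h0]
    · rw [hmul, h.inv_mul, ← h0]

theorem evalHom_v (dx : Derivation ℂ A A) (v u : PowerSeries A) (E : (PowerSeries A)ˣ) :
    evalHom dx v u E (PowerSeries.C (jet (JetVar.v 0))) = v := by
  rw [evalHom_C, substJet_jet]; rfl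

theorem evalHom_u (dx : Derivation ℂ A A) (v u : PowerSeries A) (E : (PowerSeries A)ˣ) :
    evalHom dx v u E (PowerSeries.C (jet (JetVar.u 0))) = u := by
  rw [evalHom_C, substJet_jet]; rfl

theorem evalHom_expU (dx : Derivation ℂ A A) (v u : PowerSeries A) (E : (PowerSeries A)ˣ) :
    evalHom dx v u E (PowerSeries.C expU.val) = E.val := by
  rw [evalHom_C, substJet_expU]

theorem evalHom_expU_inv (dx : Derivation ℂ A A) (v u : PowerSeries A) (E : (PowerSeries A)ˣ) :
    evalHom dx v u E (PowerSeries.C expU.inv) = E.inv := by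
  rw [evalHom_C, substJet_expU_inv]

omit [Algebra ℂ A] in
theorem toLS_unit (E : (PowerSeries A)ˣ) : toLS E.val * toLS E.inv = 1 := by
  rw [← toLS_mul, E.val_inv]
  exact map_one (HahnSeries.ofPowerSeries ℤ A)

theorem toLS_evalHom_logExplicit (dx : Derivation ℂ A A) (v u : PowerSeries A)
    (E : (PowerSeries A)ˣ) (hE : psMap dx E.val = E.val * psMap dx u)
    {P P' : ℤ → LaurentSeries A} {φ : LaurentSeries A} {R R' : ℤ → LaurentSeries A}
    (hP : IsDressingP (lsShift dx) (lax (toLS v) (toLS E.val)) P P')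
    (hQ : IsDressingQ (lsShift dx) (toLS u) (toLS E.val) (toLS E.inv)
      (lax (toLS v) (toLS E.val)) φ R R') (k : ℤ) :
    toLS (evalHom dx v u E (logExplicit k)) = (1 / 2 : ℂ) •
      (epsQxQinv dx (toLS E.val) (toLS E.inv) φ R R' k - epsPxPinv dx P P' k) := by
  have hR := (isDressingP_reflect_iff dx (toLS_unit E) hQ.log_ratio R R').2 hQ
  have hQk : epsQxQinv dx (toLS E.val) (toLS E.inv) φ R R' k =
      lsOp dx PowerSeries.X φ * opLambda 0 k +
        -epsPxPinv (-dx) (fun k => R (-k)) (fun k => R' (-k)) (-k) *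
          q0Ratio (lsShift dx) (toLS E.val) (toLS E.inv) k := by
    rw [epsQxQinv, q0Conj, opMul_eps_eq_neg_epsPxPinv, lsOp_X]
  rw [hQk, logExplicit]
  rcases lt_trichotomy k 0 with hk | rfl | hk
  · rw [if_pos hk, epsPxPinv_eq_zero _ hR.pos hR.zero hR.pos' (-k) (by omega), evalHom_smul,
      toLS_smul, toLS_evalHom_logSeries dx v u E totalD dx (P := P) (P' := P')]
    · rw [show (-((-k).toNat : ℤ)) = k by omega, opLambda, if_neg (by omega)]
      simp
    · intro s f
      rw [← evalHom_shiftR dx v u E hE, shiftR_eq_psShift]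
    · rw [evalHom_v, evalHom_expU]
      exact hP
  · rw [if_neg (by omega), if_pos rfl, neg_zero,
      epsPxPinv_eq_zero _ hR.pos hR.zero hR.pos' 0 le_rfl,
      epsPxPinv_eq_zero _ hP.pos hP.zero hP.pos' 0 le_rfl, evalHom_smul, toLS_smul,
      evalHom_psOp dx v u E hE, evalHom_u, ← lsOp_toLS, ← hQ.log_ratio, lsShift_eq_lsOp]
    have h1 := lsOp_sub dx 1 (expS (-1)) φ
    rw [lsOp_one] at h1
    rw [← h1, ← lsOp_mul, todd_mul, opLambda, if_pos rfl]
    simp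
  · rw [if_neg (by omega), if_neg (by omega),
      epsPxPinv_eq_zero _ hP.pos hP.zero hP.pos' k (by omega), evalHom_smul, toLS_smul, map_mul,
      toLS_mul, toLS_evalHom_logSeries dx v u E (-totalD) (-dx) (P := fun k => R (-k))
        (P' := fun k => R' (-k))]
    · have h1 := map_q0Ratio ((HahnSeries.ofPowerSeries ℤ A).comp (evalHom dx v u E)) shiftR
        (lsShift dx) (fun s f => by
          change toLS (evalHom dx v u E (shiftR s f)) = lsShift dx s (toLS (evalHom dx v u E f))
          rw [evalHom_shiftR dx v u E hE, lsShift_toLS]) (PowerSeries.C expU.val)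
        (PowerSeries.C expU.inv) k
      change toLS (evalHom dx v u E _) = q0Ratio _ (toLS (evalHom dx v u E _))
        (toLS (evalHom dx v u E _)) k at h1
      rw [h1, evalHom_expU, evalHom_expU_inv, show ((k.toNat : ℤ)) = k by omega, opLambda,
        if_neg (by omega), mul_zero, zero_add, sub_zero]
    · intro s f
      rw [psShift_neg_derivation, psShift_neg_derivation, ← evalHom_shiftR dx v u E hE,
        shiftR_eq_psShift]
    · rw [evalHom_v, evalHom_shiftR dx v u E hE, evalHom_expU, ← lsShift_toLS]
      exact hR

end Logarithm

theorem isLogLax_logExplicit : IsLogLax logExplicit := by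
  intro A _ _ dx v u E hE P P' φ R R' hP hQ k
  rw [← evalHom_apply]
  exact toLS_evalHom_logExplicit dx v u E hE hP hQ k

/-! ### The generic point -/

section GenericPoint

/-- `d/dx` on `A[[x]]`. -/
noncomputable def ddx (A : Type*) [CommRing A] [Algebra ℂ A] :
    Derivation ℂ (PowerSeries A) (PowerSeries A) :=
  (PowerSeries.derivative A).restrictScalars ℂ

theorem coeff_ddx {A : Type*} [CommRing A] [Algebra ℂ A] (f : PowerSeries A) (n : ℕ) :
    PowerSeries.coeff n (ddx A f) = PowerSeries.coeff (n + 1) f * (n + 1) :=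
  PowerSeries.coeff_derivative f n

theorem ddx_surjective {A : Type*} [CommRing A] [Algebra ℂ A] :
    Function.Surjective (ddx A) := by
  intro g
  refine ⟨PowerSeries.mk fun n => ((n : ℂ)⁻¹) • PowerSeries.coeff (n - 1) g, ?_⟩
  ext n
  rw [coeff_ddx, PowerSeries.coeff_mk, add_tsub_cancel_right, smul_mul_assoc, mul_comm]
  have h : ((n : A) + 1) = algebraMap ℂ A ((n + 1 : ℕ) : ℂ) := by simp
  rw [h, ← Algebra.smul_def, smul_smul, inv_mul_cancel₀ (Nat.cast_ne_zero.2 (Nat.succ_ne_zero n)),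
    one_smul]

theorem ddx_taylorHom {A : Type*} [CommRing A] [Algebra ℂ A] (d : Derivation ℂ A A) (a : A) :
    ddx A (taylorHom d 1 a) = taylorHom d 1 (d a) := by
  have h : ∀ (b : A) (n : ℕ), PowerSeries.coeff n (taylorHom d 1 b) =
      ((1 : ℂ) / (n.factorial : ℂ)) • d^[n] b := by
    intro b n
    change PowerSeries.coeff n (symbolMap d (expS 1) b) = _
    simp [symbolMap, coeff_expS]
  ext n
  rw [coeff_ddx, h, h, smul_mul_assoc, mul_comm]
  have h2 : ((n : A) + 1) = algebraMap ℂ A ((n + 1 : ℕ) : ℂ) := by simp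
  rw [h2, ← Algebra.smul_def, smul_smul, Function.iterate_succ_apply]
  congr 1
  have h3 : ((n + 1 : ℕ) : ℂ) ≠ 0 := Nat.cast_ne_zero.2 (Nat.succ_ne_zero n)
  have h4 : (n.factorial : ℂ) ≠ 0 := by exact_mod_cast Nat.factorial_ne_zero _
  rw [Nat.factorial_succ]
  push_cast at h3 ⊢
  field_simp

theorem coeff_zero_taylorHom {A : Type*} [CommRing A] [Algebra ℂ A] (d : Derivation ℂ A A) (a : A) :
    PowerSeries.coeff 0 (taylorHom d 1 a) = a := by
  change PowerSeries.coeff 0 (symbolMap d (expS 1) a) = _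
  simp [symbolMap, coeff_expS]

theorem lsOp_X_surjective {A : Type*} [CommRing A] [Algebra ℂ A] {d : Derivation ℂ A A}
    (hd : Function.Surjective d) : Function.Surjective (lsOp d PowerSeries.X) := by
  intro f
  obtain ⟨N, g, rfl⟩ := exists_rep f
  choose s hs using hd
  refine ⟨HahnSeries.single (N - 1) 1 * toLS (PowerSeries.mk fun n => s (PowerSeries.coeff n g)), ?_⟩
  have h1 := single_add_mul_toLS (N - 1) 1 g
  rw [Nat.cast_one, sub_add_cancel, pow_one] at h1
  rw [lsOp_single_mul, psOp_X, h1]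
  congr 3
  ext n
  rw [psMap, PowerSeries.coeff_mk, PowerSeries.coeff_mk, hs]

theorem lsShift_sub_surjective {A : Type*} [CommRing A] [Algebra ℂ A] {d : Derivation ℂ A A}
    (hd : Function.Surjective d) (y : LaurentSeries A) : ∃ x, lsShift d 1 x - x = y := by
  obtain ⟨z, rfl⟩ := lsOp_X_surjective hd y
  refine ⟨lsOp d expDiv⁻¹ z, ?_⟩
  have h1 := lsOp_sub d (expS 1) 1 (lsOp d expDiv⁻¹ z)
  rw [lsOp_one] at h1
  rw [lsShift_eq_lsOp, ← h1, ← lsOp_mul, ← X_mul_expDiv, mul_assoc, expDiv_mul_inv, mul_one]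

/-- Over a differential ring with surjective derivation all dressing operators exist. -/
theorem exists_dressing {A : Type*} [CommRing A] [Algebra ℂ A] {d : Derivation ℂ A A}
    (hd : Function.Surjective d) (v u : LaurentSeries A) {E E' : LaurentSeries A}
    (hE : E * E' = 1) :
    ∃ (P P' : ℤ → LaurentSeries A) (φ : LaurentSeries A) (R R' : ℤ → LaurentSeries A),
      IsDressingP (lsShift d) (lax v E) P P' ∧
        IsDressingQ (lsShift d) u E E' (lax v E) φ R R' := by
  have hd' : Function.Surjective (-d : Derivation ℂ A A) := fun a => by
    obtain ⟨b, hb⟩ := hd (-a)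
    exact ⟨b, by rw [Derivation.neg_apply, hb, neg_neg]⟩
  obtain ⟨P, P', hP⟩ := exists_isDressingP (isShiftAction_lsShift d) (lsShift_sub_surjective hd) v E
  obtain ⟨R, R', hR⟩ := exists_isDressingP (isShiftAction_lsShift (-d))
    (lsShift_sub_surjective hd') v (lsShift d 1 E)
  obtain ⟨φ, hφ⟩ := lsShift_sub_surjective hd' (-u)
  rw [lsShift_neg_derivation] at hφ
  refine ⟨P, P', φ, fun k => R (-k), fun k => R' (-k), hP, ?_⟩
  refine (isDressingP_reflect_iff d hE (by linear_combination -hφ) _ _).1 ?_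
  simpa only [neg_neg] using hR

/-- The values of the differential polynomials at the generic point `v(x)`, `u(x)` of the
differential ring `DiffPoly[[x]]` are their Taylor series. -/
theorem exists_generic_point : ∃ (v u : PowerSeries (PowerSeries DiffPoly))
    (E : (PowerSeries (PowerSeries DiffPoly))ˣ),
    psMap (ddx DiffPoly) E.val = E.val * psMap (ddx DiffPoly) u ∧
      Function.Injective (evalHom (ddx DiffPoly) v u E) := by
  let θ : DiffPoly →+* PowerSeries DiffPoly := taylorHom totalD 1
  have hθ : ∀ a, ddx DiffPoly (θ a) = θ (totalD a) := ddx_taylorHom totalD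
  have hpsC : ∀ a : PowerSeries DiffPoly, psMap (ddx DiffPoly) (PowerSeries.C a) =
      PowerSeries.C (ddx DiffPoly a) := by
    intro a
    ext1 n
    cases n <;> simp [psMap, PowerSeries.coeff_C]
  have hiter : ∀ m a, (psMap (ddx DiffPoly))^[m] (PowerSeries.C (θ a)) =
      PowerSeries.C (θ (totalD^[m] a)) := by
    intro m a
    induction m with
    | zero => rfl
    | succ m ih =>
      rw [Function.iterate_succ_apply', ih, hpsC, hθ, Function.iterate_succ_apply']
  let E := Units.map ((PowerSeries.C (R := PowerSeries DiffPoly)).comp θ).toMonoidHom expU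
  have hE : E.val = PowerSeries.C (θ expU.val) := rfl
  have hE' : E.inv = PowerSeries.C (θ expU.inv) := rfl
  refine ⟨PowerSeries.C (θ (jet (JetVar.v 0))), PowerSeries.C (θ (jet (JetVar.u 0))), E, ?_, ?_⟩
  · rw [hE, hpsC, hpsC, hθ, hθ, totalD_expU, totalD_jet, map_mul, map_mul]
    rfl
  · have hsub : ∀ a, substJet (jetValue (ddx DiffPoly) (PowerSeries.C (θ (jet (JetVar.v 0))))
        (PowerSeries.C (θ (jet (JetVar.u 0))))) E a = PowerSeries.C (θ a) := by
      intro a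
      induction a using DiffPoly.induction with
      | const c =>
        rw [substJet_algebraMap]
        have h1 : θ (algebraMap ℂ DiffPoly c) = algebraMap ℂ (PowerSeries DiffPoly) c := by
          ext1 n
          rw [PowerSeries.algebraMap_apply, PowerSeries.coeff_C]
          change PowerSeries.coeff n (symbolMap totalD (expS 1) _) = _
          cases n with
          | zero => simp [symbolMap, coeff_expS]
          | succ n =>
            simp only [symbolMap, AddMonoidHom.coe_mk, ZeroHom.coe_mk, PowerSeries.coeff_mk]
            rw [Function.iterate_succ_apply, derivation_algebraMap, iterate_map_zero, smul_zero,
              if_neg (Nat.succ_ne_zero n)]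
        rw [h1, PowerSeries.algebraMap_apply]
      | jets i =>
        rw [substJet_jet]
        cases i with
        | v m => rw [jetValue, hiter, iterate_totalD_v, zero_add]
        | u m => rw [jetValue, hiter, iterate_totalD_u, zero_add]
      | exp => rw [substJet_expU, hE]
      | exp_inv => rw [substJet_expU_inv, hE']
      | add f g hf hg => rw [map_add, map_add, map_add, hf, hg]
      | mul f g hf hg => rw [map_mul, map_mul, map_mul, hf, hg]
    have hev : ∀ f, evalHom (ddx DiffPoly) (PowerSeries.C (θ (jet (JetVar.v 0))))
        (PowerSeries.C (θ (jet (JetVar.u 0)))) E f = PowerSeries.map θ f := by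
      intro f
      refine eq_of_X_mul (evalHom _ _ _ E).toAddMonoidHom (PowerSeries.map θ).toAddMonoidHom
        (fun f => evalHom_X_mul _ _ _ _ f) (fun f => ?_) (fun a => ?_) f
      · change PowerSeries.map θ _ = PowerSeries.X * PowerSeries.map θ f
        rw [map_mul, PowerSeries.map_X]
      · change evalHom _ _ _ E _ = PowerSeries.map θ _
        rw [evalHom_C, hsub, PowerSeries.map_C]
    intro f g hfg
    rw [hev, hev] at hfg
    ext1 n
    have h1 := congrArg (fun h => PowerSeries.coeff 0 (PowerSeries.coeff n h)) hfg
    simp only [PowerSeries.coeff_map] at h1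
    exact (coeff_zero_taylorHom totalD _).symm.trans (h1.trans (coeff_zero_taylorHom totalD _))

/-- The conditions on `log L` determine it, because they can be read off at the generic point. -/
theorem logLax_eq : logLax = logExplicit := by
  have h : IsLogLax logLax := Classical.epsilon_spec ⟨_, isLogLax_logExplicit⟩
  obtain ⟨v, u, E, hE, hinj⟩ := exists_generic_point
  obtain ⟨P, P', φ, R, R', hP, hQ⟩ := exists_dressing (d := ddx DiffPoly) ddx_surjective (toLS v)
    (toLS u) (toLS_unit E)
  funext k
  apply hinj
  apply toLS_injective
  rw [evalHom_apply, evalHom_apply, h _ (ddx DiffPoly) v u E hE P P' φ R R' hP hQ k,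
    isLogLax_logExplicit _ (ddx DiffPoly) v u E hE P P' φ R R' hP hQ k]

end GenericPoint

/-! ### The grading -/

section Grading

/-- The monomial with exponents `m` in the jet variables and `n` in `e ^ u`. -/
noncomputable def mono (m : JetVar →₀ ℕ) (n : ℤ) : DiffPoly :=
  AddMonoidAlgebra.single n (MvPolynomial.monomial m (1 : ℂ))

/-- The degree of a monomial in the jet variables. -/
noncomputable def jetDeg (m : JetVar →₀ ℕ) : ℤ := m.sum fun i e => (e : ℤ) * jetDegree i

theorem jetDeg_add (m m' : JetVar →₀ ℕ) : jetDeg (m + m') = jetDeg m + jetDeg m' :=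
  Finsupp.sum_add_index' (by simp) (by intros; push_cast; ring)

theorem jetDeg_zero : jetDeg 0 = 0 := Finsupp.sum_zero_index

theorem jetDeg_single (i : JetVar) : jetDeg (Finsupp.single i 1) = jetDegree i := by
  rw [jetDeg, Finsupp.sum_single_index] <;> simp

theorem mono_mul (m m' : JetVar →₀ ℕ) (n n' : ℤ) :
    mono m n * mono m' n' = mono (m + m') (n + n') := by
  rw [mono, mono, AddMonoidAlgebra.single_mul_single, MvPolynomial.monomial_mul, one_mul]
  rfl

theorem mono_zero (n : ℤ) : mono 0 n = LaurentPolynomial.T n := rfl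

theorem mono_single (i : JetVar) : mono (Finsupp.single i 1) 0 = jet i := rfl

/-- The span of the monomials of degree `e`, where those without jet variables are only allowed
if `b` holds. -/
noncomputable def gradedPart (e : ℤ) (b : Prop) : Submodule ℂ DiffPoly :=
  Submodule.span ℂ {f | ∃ m n, f = mono m n ∧ jetDeg m + 2 * n = e ∧ (m = 0 → b)}

theorem mono_mem_gradedPart (m : JetVar →₀ ℕ) (n e : ℤ) (b : Prop) (h : jetDeg m + 2 * n = e)
    (hb : m = 0 → b) : mono m n ∈ gradedPart e b :=
  Submodule.subset_span ⟨m, n, rfl, h, hb⟩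

theorem gradedPart_mono {e e' : ℤ} {b b' : Prop} (he : e = e') (h : b → b') {f : DiffPoly}
    (hf : f ∈ gradedPart e b) : f ∈ gradedPart e' b' := by
  subst he
  refine Submodule.span_mono ?_ hf
  rintro _ ⟨m, n, rfl, h1, h2⟩
  exact ⟨m, n, rfl, h1, fun h3 => h (h2 h3)⟩

theorem mul_mem_gradedPart {e e' : ℤ} {b b' : Prop} {f g : DiffPoly} (hf : f ∈ gradedPart e b)
    (hg : g ∈ gradedPart e' b') : f * g ∈ gradedPart (e + e') (b ∧ b') := by
  have h := Submodule.mul_mem_mul hf hg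
  rw [gradedPart, gradedPart, Submodule.span_mul_span] at h
  refine Submodule.span_mono ?_ h
  rintro _ ⟨_, ⟨m, n, rfl, h1, h2⟩, _, ⟨m', n', rfl, h1', h2'⟩, rfl⟩
  refine ⟨m + m', n + n', mono_mul m m' n n', by rw [jetDeg_add]; linarith, fun h0 => ?_⟩
  rw [add_eq_zero] at h0
  exact ⟨h2 h0.1, h2' h0.2⟩

theorem jetDegree_succ (i : JetVar) : jetDegree i.succ = jetDegree i - 1 := by
  cases i <;> (simp only [JetVar.succ, jetDegree]; push_cast; ring)

theorem totalD_mono_mem (m : JetVar →₀ ℕ) (n : ℤ) :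
    totalD (mono m n) ∈ gradedPart (jetDeg m + 2 * n - 1) False := by
  have hT : ∀ n, totalD (mono 0 n) ∈ gradedPart (2 * n - 1) False := by
    intro n
    rw [mono_zero, totalD, jetD_T, ← Int.cast_smul_eq_zsmul ℂ, ← mono_zero]
    refine Submodule.smul_mem _ _ ?_
    rw [← mono_single, mono_mul]
    refine mono_mem_gradedPart _ _ _ _ ?_ (by simp)
    rw [zero_add, jetDeg_single, jetDegree_succ, jetDegree]
    simp
    ring
  have hadd : ∀ m m', (∀ n, totalD (mono m n) ∈ gradedPart (jetDeg m + 2 * n - 1) False) →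
      (∀ n, totalD (mono m' n) ∈ gradedPart (jetDeg m' + 2 * n - 1) False) →
      ∀ n, totalD (mono (m + m') n) ∈ gradedPart (jetDeg (m + m') + 2 * n - 1) False := by
    intro m m' h h' n
    have h1 : mono (m + m') n = mono m n * mono m' 0 := by rw [mono_mul, add_zero]
    rw [h1, Derivation.leibniz, jetDeg_add]
    refine Submodule.add_mem _ ?_ ?_
    · exact gradedPart_mono (by ring) And.right
        (mul_mem_gradedPart (mono_mem_gradedPart m n _ True rfl fun _ => trivial) (h' 0))
    · exact gradedPart_mono (by ring) And.right
        (mul_mem_gradedPart (mono_mem_gradedPart m' 0 _ True rfl fun _ => trivial) (h n))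
  induction m using Finsupp.induction_linear generalizing n with
  | zero => rw [jetDeg_zero, zero_add]; exact hT n
  | add m m' h h' => exact hadd m m' h h' n
  | single i k =>
    have h1 : ∀ n, totalD (mono (Finsupp.single i 1) n) ∈
        gradedPart (jetDeg (Finsupp.single i 1) + 2 * n - 1) False := by
      intro n
      have h2 : mono (Finsupp.single i 1) n = mono 0 n * jet i := by
        rw [← mono_single, mono_mul, zero_add, add_zero]
      rw [h2, Derivation.leibniz, totalD_jet, jetDeg_single]
      refine Submodule.add_mem _ ?_ ?_
      · rw [← mono_single, smul_eq_mul, mono_mul]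
        refine mono_mem_gradedPart _ _ _ _ ?_ (by simp)
        rw [zero_add, jetDeg_single, jetDegree_succ]
        ring
      · refine gradedPart_mono (b := True ∧ False) ?_ And.right (mul_mem_gradedPart (e := jetDegree i)
          ?_ (hT n))
        · ring
        · rw [← mono_single]
          exact mono_mem_gradedPart _ _ _ _ (by rw [jetDeg_single]; ring) fun _ => trivial
    induction k generalizing n with
    | zero => rw [Finsupp.single_zero, jetDeg_zero, zero_add]; exact hT n
    | succ k ih => rw [Finsupp.single_add]; exact hadd _ _ ih h1 n

theorem totalD_mem_gradedPart {e : ℤ} {b : Prop} {f : DiffPoly} (hf : f ∈ gradedPart e b) :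
    totalD f ∈ gradedPart (e - 1) False := by
  rw [gradedPart] at hf
  induction hf using Submodule.span_induction with
  | mem x hx =>
    obtain ⟨m, n, rfl, rfl, -⟩ := hx
    exact totalD_mono_mem m n
  | zero => rw [map_zero]; exact Submodule.zero_mem _
  | add x y _ _ hx hy => rw [map_add]; exact Submodule.add_mem _ hx hy
  | smul r x _ hx => rw [Derivation.map_smul]; exact Submodule.smul_mem _ _ hx

theorem iterate_totalD_mem_gradedPart {e : ℤ} {b : Prop} {f : DiffPoly} (hf : f ∈ gradedPart e b)
    (k : ℕ) : totalD^[k] f ∈ gradedPart (e - k) (k = 0 ∧ b) := by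
  cases k with
  | zero => exact gradedPart_mono (by simp) (fun h => ⟨rfl, h⟩) hf
  | succ k =>
    refine gradedPart_mono (e := e - k - 1) (b := False) (by push_cast; ring) False.elim ?_
    induction k with
    | zero => exact gradedPart_mono (by simp) id (totalD_mem_gradedPart hf)
    | succ k ih =>
      rw [Function.iterate_succ_apply']
      exact gradedPart_mono (by push_cast; ring) id (totalD_mem_gradedPart ih)

theorem of_mem_gradedPart {e : ℤ} {b : Prop} {f : DiffPoly} (hf : f ∈ gradedPart e b) (n : ℤ)
    (m : JetVar →₀ ℕ) (h : MvPolynomial.coeff m (f.coeff n) ≠ 0) :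
    jetDeg m + 2 * n = e ∧ (m = 0 → b) := by
  classical
  rw [gradedPart] at hf
  induction hf using Submodule.span_induction with
  | mem x hx =>
    obtain ⟨m', n', rfl, h1, h2⟩ := hx
    rw [mono, AddMonoidAlgebra.coeff_single, Finsupp.single_apply] at h
    split_ifs at h with hn
    · rw [MvPolynomial.coeff_monomial] at h
      split_ifs at h with hm
      · subst hn hm
        exact ⟨h1, h2⟩
      · exact absurd rfl h
    · rw [MvPolynomial.coeff_zero] at h
      exact absurd rfl h
  | zero => exact absurd (by simp) h
  | add x y _ _ hx hy =>
    rw [AddMonoidAlgebra.coeff_add, Finsupp.add_apply, MvPolynomial.coeff_add] at h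
    by_cases h0 : MvPolynomial.coeff m (x.coeff n) = 0
    · rw [h0, zero_add] at h
      exact hy h
    · exact hx h0
  | smul r x _ hx =>
    rw [AddMonoidAlgebra.coeff_smul_apply, MvPolynomial.coeff_smul] at h
    exact hx fun h0 => h (by rw [h0, smul_zero])

/-- The elements of `𝓡` of degree `d` in which a power of `e ^ u` without jet variables only occurs
in the coefficient of `ε ^ 0`, and there only if `b` holds.  The restriction reflects that at
constant `v`, `u` all shifts are trivial, so that `ε` disappears. -/
def gradedSeries (d : ℤ) (b : Prop) : Submodule ℂ DiffSeries where
  carrier := {f | ∀ k : ℕ, PowerSeries.coeff k f ∈ gradedPart (d - k) (k = 0 ∧ b)}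
  zero_mem' k := by rw [map_zero]; exact Submodule.zero_mem _
  add_mem' hf hg k := by rw [map_add]; exact Submodule.add_mem _ (hf k) (hg k)
  smul_mem' r f hf k := by
    rw [PowerSeries.coeff_smul]
    exact Submodule.smul_mem _ _ (hf k)

theorem gradedSeries_mono {d d' : ℤ} {b b' : Prop} (hd : d = d') (h : b → b') {f : DiffSeries}
    (hf : f ∈ gradedSeries d b) : f ∈ gradedSeries d' b' := fun k =>
  gradedPart_mono (by rw [hd]) (And.imp_right h) (hf k)

theorem mul_mem_gradedSeries {d d' : ℤ} {f g : DiffSeries} (hf : f ∈ gradedSeries d True)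
    (hg : g ∈ gradedSeries d' True) : f * g ∈ gradedSeries (d + d') True := by
  intro k
  rw [PowerSeries.coeff_mul]
  refine Submodule.sum_mem _ fun ij hij => ?_
  have h := Finset.HasAntidiagonal.mem_antidiagonal.1 hij
  refine gradedPart_mono ?_ ?_ (mul_mem_gradedPart (hf ij.1) (hg ij.2))
  · rw [← h]; push_cast; ring
  · rintro ⟨⟨h1, -⟩, h2, -⟩
    exact ⟨by omega, trivial⟩

theorem psOp_mem_gradedSeries {d : ℤ} {b : Prop} {f : DiffSeries} (hf : f ∈ gradedSeries d b)
    (c : PowerSeries ℂ) : psOp totalD c f ∈ gradedSeries d b := by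
  intro n
  rw [coeff_psOp]
  refine Submodule.sum_mem _ fun kl hkl => Submodule.smul_mem _ _ ?_
  have h := Finset.HasAntidiagonal.mem_antidiagonal.1 hkl
  refine gradedPart_mono ?_ ?_ (iterate_totalD_mem_gradedPart (hf kl.2) kl.1)
  · rw [← h]; push_cast; ring
  · rintro ⟨h1, h2, h3⟩
    exact ⟨by omega, h3⟩

theorem shiftR_mem_gradedSeries {d : ℤ} {b : Prop} {f : DiffSeries} (hf : f ∈ gradedSeries d b)
    (s : ℤ) : shiftR s f ∈ gradedSeries d b := by
  rw [shiftR_eq_psOp]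
  exact psOp_mem_gradedSeries hf _

theorem C_mem_gradedSeries {d : ℤ} {b : Prop} {a : DiffPoly} (ha : a ∈ gradedPart d b) :
    (PowerSeries.C a : DiffSeries) ∈ gradedSeries d b := by
  intro k
  rw [PowerSeries.coeff_C]
  split_ifs with hk
  · subst hk
    exact gradedPart_mono (by simp) (fun h => ⟨rfl, h⟩) ha
  · exact Submodule.zero_mem _

theorem one_mem_gradedSeries : (1 : DiffSeries) ∈ gradedSeries 0 True := by
  rw [← map_one PowerSeries.C]
  refine C_mem_gradedSeries ?_
  rw [← LaurentPolynomial.T_zero, ← mono_zero]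
  exact mono_mem_gradedPart _ _ _ _ (by rw [jetDeg_zero]; rfl) fun _ => trivial

theorem jet_mem_gradedSeries (i : JetVar) (b : Prop) :
    (PowerSeries.C (jet i) : DiffSeries) ∈ gradedSeries (jetDegree i) b := by
  refine C_mem_gradedSeries ?_
  rw [← mono_single]
  exact mono_mem_gradedPart _ _ _ _ (by rw [jetDeg_single]; ring) (by simp)

theorem expU_mem_gradedSeries : (PowerSeries.C expU.val : DiffSeries) ∈ gradedSeries 2 True := by
  refine C_mem_gradedSeries ?_
  change LaurentPolynomial.T 1 ∈ _
  rw [← mono_zero]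
  exact mono_mem_gradedPart _ _ _ _ (by rw [jetDeg_zero]; rfl) fun _ => trivial

theorem expU_inv_mem_gradedSeries :
    (PowerSeries.C expU.inv : DiffSeries) ∈ gradedSeries (-2) True := by
  refine C_mem_gradedSeries ?_
  change LaurentPolynomial.T (-1) ∈ _
  rw [← mono_zero]
  exact mono_mem_gradedPart _ _ _ _ (by rw [jetDeg_zero]; rfl) fun _ => trivial

theorem opLambda_mem_gradedSeries (j k : ℤ) :
    (opLambda j k : DiffSeries) ∈ gradedSeries (j - k) True := by
  rw [opLambda]
  split_ifs with h
  · rw [h, sub_self]; exact one_mem_gradedSeries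
  · exact Submodule.zero_mem _

theorem opMul_mem_gradedSeries {F G : ℤ → DiffSeries} {a b : ℤ}
    (hF : ∀ k, F k ∈ gradedSeries (a - k) True) (hG : ∀ k, G k ∈ gradedSeries (b - k) True)
    (n : ℤ) : opMul shiftR F G n ∈ gradedSeries (a + b - n) True := by
  rw [opMul]
  refine finsum_induction (· ∈ gradedSeries (a + b - n) True) (Submodule.zero_mem _)
    (fun _ _ => Submodule.add_mem _) fun k => ?_
  exact gradedSeries_mono (by ring) id
    (mul_mem_gradedSeries (hF k) (shiftR_mem_gradedSeries (hG (n - k)) k))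

theorem iterDiff_mem_gradedSeries {σ : ℤ → DiffSeries → DiffSeries}
    (hσ : ∀ s d f, f ∈ gradedSeries d True → σ s f ∈ gradedSeries d True) {v w : DiffSeries}
    (hv : v ∈ gradedSeries 1 True) (hw : w ∈ gradedSeries 2 True) (j : ℕ) (n : ℤ) :
    iterDiff σ v w j n ∈ gradedSeries (-n) True := by
  induction j generalizing n with
  | zero =>
    rw [iterDiff, ← zero_sub]
    exact opLambda_mem_gradedSeries 0 n
  | succ j ih =>
    rw [iterDiff]
    refine Submodule.sub_mem _ (Submodule.add_mem _ (Submodule.add_mem _ (hσ _ _ _ (ih n)) ?_) ?_)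
      (ih n)
    · exact gradedSeries_mono (by ring) id (mul_mem_gradedSeries hv (ih (n + 1)))
    · exact gradedSeries_mono (by ring) id (mul_mem_gradedSeries hw (hσ _ _ _ (ih (n + 2))))

theorem logSeries_mem_gradedSeries {D : Derivation ℂ DiffPoly DiffPoly}
    (hD : ∀ s d f, f ∈ gradedSeries d True → psShift D s f ∈ gradedSeries d True) {v w : DiffSeries}
    (hv : v ∈ gradedSeries 1 True) (hw : w ∈ gradedSeries 2 True) (k : ℕ) :
    logSeries D v w k ∈ gradedSeries k True := by
  intro n
  rw [logSeries, PowerSeries.coeff_mk]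
  refine Submodule.sum_mem _ fun j _ => Submodule.smul_mem _ _ ?_
  exact gradedSeries_mono (neg_neg _) id
    (iterDiff_mem_gradedSeries hD hv hw (j + 1) (-(k : ℤ))) n

theorem prod_mem_gradedSeries {d : ℤ} {f : ℕ → DiffSeries} (hf : ∀ j, f j ∈ gradedSeries d True)
    (n : ℕ) : ∏ j ∈ Finset.range n, f j ∈ gradedSeries (n * d) True := by
  induction n with
  | zero => simpa using one_mem_gradedSeries
  | succ n ih =>
    rw [Finset.prod_range_succ]
    exact gradedSeries_mono (by push_cast; ring) id (mul_mem_gradedSeries ih (hf n))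

theorem q0Ratio_mem_gradedSeries (k : ℤ) :
    q0Ratio shiftR (PowerSeries.C expU.val) (PowerSeries.C expU.inv) k ∈
      gradedSeries (-2 * k) True := by
  cases k with
  | ofNat n =>
    rw [q0Ratio]
    exact gradedSeries_mono (by simp; ring) id (prod_mem_gradedSeries
      (fun j => shiftR_mem_gradedSeries expU_inv_mem_gradedSeries _) n)
  | negSucc n =>
    rw [q0Ratio]
    exact gradedSeries_mono (by rw [Int.negSucc_eq]; push_cast; ring) id (prod_mem_gradedSeries
      (fun j => shiftR_mem_gradedSeries expU_mem_gradedSeries _) (n + 1))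

theorem logLax_mem_gradedSeries (k : ℤ) : logLax k ∈ gradedSeries (-k) True := by
  have hv : (PowerSeries.C (jet (JetVar.v 0)) : DiffSeries) ∈ gradedSeries 1 True :=
    jet_mem_gradedSeries (JetVar.v 0) True
  rw [logLax_eq, logExplicit]
  split_ifs with h1 h2
  · refine Submodule.smul_mem _ _ (gradedSeries_mono (by omega) id
      (logSeries_mem_gradedSeries (fun s d f hf => ?_) hv expU_mem_gradedSeries (-k).toNat))
    rw [← shiftR_eq_psShift]
    exact shiftR_mem_gradedSeries hf s
  · rw [h2]
    exact Submodule.smul_mem _ _ (psOp_mem_gradedSeries (jet_mem_gradedSeries (JetVar.u 0) True) _)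
  · refine Submodule.smul_mem _ _ (gradedSeries_mono (d := k.toNat + -2 * k) (by omega) id
      (mul_mem_gradedSeries (logSeries_mem_gradedSeries (fun s d f hf => ?_) hv
        (shiftR_mem_gradedSeries expU_mem_gradedSeries 1) k.toNat) (q0Ratio_mem_gradedSeries k)))
    rw [psShift_neg_derivation, ← shiftR_eq_psShift]
    exact shiftR_mem_gradedSeries hf (-s)

theorem laxR_mem_gradedSeries (k : ℤ) : laxR k ∈ gradedSeries (1 - k) True := by
  rw [laxR, lax]
  split_ifs with h1 h2 h3
  · rw [h1]; exact one_mem_gradedSeries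
  · rw [h2]; exact jet_mem_gradedSeries (JetVar.v 0) True
  · rw [h3]; exact expU_mem_gradedSeries
  · exact Submodule.zero_mem _

theorem opPow_laxR_mem_gradedSeries (q : ℕ) (n : ℤ) :
    opPow shiftR laxR q n ∈ gradedSeries (q - n) True := by
  induction q generalizing n with
  | zero => exact opLambda_mem_gradedSeries 0 n
  | succ q ih =>
    rw [opPow]
    exact gradedSeries_mono (by push_cast; ring) id
      (opMul_mem_gradedSeries laxR_mem_gradedSeries ih n)

theorem laxPowLog_mem_gradedSeries (q : ℕ) (n : ℤ) : laxPowLog q n ∈ gradedSeries (q - n) True := by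
  rw [laxPowLog]
  refine gradedSeries_mono (d := q + 0 - n) (by ring) id
    (opMul_mem_gradedSeries (opPow_laxR_mem_gradedSeries q) (fun k => ?_) n)
  exact Submodule.sub_mem _ (gradedSeries_mono (by ring) id (logLax_mem_gradedSeries k))
    (Submodule.smul_mem _ _ (opLambda_mem_gradedSeries 0 k))

theorem isHomogeneous_of_mem {d : ℤ} {b : Prop} {f : DiffSeries} (hf : f ∈ gradedSeries d b) :
    IsHomogeneous f d := by
  intro k n m h
  have h1 := (of_mem_gradedPart (hf k) n m h).1
  rw [jetDeg] at h1
  have h2 : (m.sum fun i e => (e : ℤ) * jetDegree i) + 2 * n + k = d := by omega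
  rw [h2]

theorem noConstantTerm_of_mem {d : ℤ} {b : Prop} {f : DiffSeries} (hf : f ∈ gradedSeries d b)
    (h : d ≠ 0 ∨ ¬b) : NoConstantTerm f := by
  intro k
  by_contra h1
  obtain ⟨h2, h3⟩ := of_mem_gradedPart (hf k) 0 0 h1
  obtain ⟨hk, hb⟩ := h3 rfl
  rw [jetDeg_zero, hk] at h2
  rcases h with h | h
  · exact h (by push_cast at h2; linarith)
  · exact h hb

end Grading

/-! ### The flow `∂/∂t^{1,0}` -/

section Flow

theorem iterDiff_nonneg {A : Type*} [CommRing A] [Algebra ℂ A] (d : Derivation ℂ A A)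
    (v w : PowerSeries A) (j : ℕ) (n : ℤ) (hn : 0 ≤ n) :
    iterDiff (psShift d) v w j n = if j = 0 then opLambda 0 n else 0 := by
  have hσ := isShiftAction_psShift d
  induction j generalizing n with
  | zero => rfl
  | succ j ih =>
    rw [iterDiff, ih n hn, ih (n + 1) (by omega), ih (n + 2) (by omega), if_neg (Nat.succ_ne_zero j)]
    have h1 : (opLambda 0 (n + 1) : PowerSeries A) = 0 := if_neg (by omega)
    have h2 : (opLambda 0 (n + 2) : PowerSeries A) = 0 := if_neg (by omega)
    rw [h1, h2, ite_self, hσ.map_zero, mul_zero, mul_zero, add_zero, add_zero, sub_eq_zero, opLambda]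
    split_ifs
    · exact hσ.map_one 1
    · exact hσ.map_zero 1
    · exact hσ.map_zero 1

/-- The coefficient of `Λ⁻¹` in the logarithm: `(Λ - 1) w₁ = ε ∂ v`. -/
theorem psOp_logSeries_one {A : Type*} [CommRing A] [Algebra ℂ A] (d : Derivation ℂ A A)
    (v w : PowerSeries A) :
    psOp d (expS 1 - 1) (logSeries d v w 1) = psOp d PowerSeries.X v := by
  have hσ := isShiftAction_psShift d
  have hx : ∀ j, iterDiff (psShift d) v w (j + 1) (-((1 : ℕ) : ℤ)) =
      psOp d ((expS 1 - 1) ^ j) v := by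
    intro j
    induction j with
    | zero =>
      rw [iterDiff, iterDiff_nonneg d v w 0 (-((1 : ℕ) : ℤ) + 1) (by norm_num),
        iterDiff_nonneg d v w 0 (-((1 : ℕ) : ℤ) + 2) (by norm_num),
        pow_zero, psOp_one]
      have h1 : iterDiff (psShift d) v w 0 (-((1 : ℕ) : ℤ)) = 0 := by simp [iterDiff, opLambda]
      rw [h1, hσ.map_zero]
      simp [opLambda, hσ.map_zero]
    | succ j ih =>
      rw [iterDiff, iterDiff_nonneg d v w (j + 1) (-((1 : ℕ) : ℤ) + 1) (by norm_num),
        iterDiff_nonneg d v w (j + 1) (-((1 : ℕ) : ℤ) + 2) (by norm_num), ih,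
        if_neg (Nat.succ_ne_zero j),
        if_neg (Nat.succ_ne_zero j), hσ.map_zero, pow_succ', psOp_mul, psOp_sub, psOp_one,
        psShift_eq_psOp]
      ring
  ext n
  have h1 := X_pow_dvd_psOp_of_dvd d (expS 1 - 1)
    (X_pow_dvd_sum_sub_logSeries d v w 1 n (n + 1) le_rfl)
  have h2 := X_pow_dvd_psOp d (X_pow_dvd_logTrunc_sub_X (n + 1)) v
  have h3 := PowerSeries.X_pow_dvd_iff.1 h1 n (by omega)
  have h4 := PowerSeries.X_pow_dvd_iff.1 h2 n (by omega)
  have h5 : psOp d (expS 1 - 1) (∑ j ∈ Finset.range (n + 1), logCoeff j •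
      iterDiff (psShift d) v w (j + 1) (-((1 : ℕ) : ℤ))) = psOp d (logTrunc (n + 1)) v := by
    simp only [hx, map_sum, psOp_map_smul, ← psOp_mul, ← pow_succ']
    rw [logTrunc]
    generalize n + 1 = J
    induction J with
    | zero =>
      have h0 := psOp_sub d 0 0 v
      rw [sub_self, sub_self] at h0
      simp [h0]
    | succ J ih => rw [Finset.sum_range_succ, Finset.sum_range_succ, psOp_add, psOp_smul, ih]
  rw [map_sub, h5, map_sub, sub_eq_zero] at h3
  rw [psOp_sub, map_sub, sub_eq_zero] at h4
  rw [← h3, h4]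

theorem laxPowLog_zero : laxPowLog 0 = logLax := by
  funext k
  rw [laxPowLog, opPow, opMul_lambda_left, isShiftAction_shiftR.zero, sub_zero]
  simp

theorem opA_one_zero_of_nonneg (k : ℤ) (hk : 0 ≤ k) : opA Label.one 0 k = (2 : ℂ) • logLax k := by
  simp [opA, opPos, hk, laxPowLog_zero]

theorem opA_one_zero_of_neg (k : ℤ) (hk : k < 0) : opA Label.one 0 k = 0 := by
  simp [opA, opPos, hk]

theorem two_smul_logLax_zero :
    (2 : ℂ) • logLax 0 = psOp totalD todd (PowerSeries.C (jet (JetVar.u 0))) := by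
  rw [logLax_eq, logExplicit, if_neg (lt_irrefl _), if_pos rfl, smul_smul]
  norm_num

theorem psMap_C_jet (i : JetVar) :
    psMap totalD (PowerSeries.C (jet i)) = PowerSeries.C (jet i.succ) := by
  ext1 n
  cases n <;> simp [psMap, PowerSeries.coeff_C, totalD_jet]

theorem divEps_X_mul (f : DiffSeries) : divEps (PowerSeries.X * f) = f := by
  ext1 n
  rw [divEps, PowerSeries.coeff_mk, PowerSeries.coeff_succ_X_mul]

theorem expU_mul_inv : (PowerSeries.C expU.val * PowerSeries.C expU.inv : DiffSeries) = 1 := by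
  rw [← map_mul, expU.val_inv, map_one]

theorem opComm_opA_one_zero :
    opComm shiftR (opA Label.one 0) laxR 0 =
      PowerSeries.X * PowerSeries.C (jet (JetVar.v 1)) := by
  have hσ := isShiftAction_shiftR
  have h1 : opA Label.one 0 1 = logSeries (-totalD) (PowerSeries.C (jet (JetVar.v 0)))
      (shiftR 1 (PowerSeries.C expU.val)) 1 * shiftR 1 (PowerSeries.C expU.inv) := by
    rw [opA_one_zero_of_nonneg 1 zero_le_one, logLax_eq, logExplicit, if_neg (by norm_num),
      if_neg one_ne_zero, smul_smul, q0Ratio_one]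
    norm_num
  have h2 := psOp_logSeries_one (-totalD) (PowerSeries.C (jet (JetVar.v 0)))
    (shiftR 1 (PowerSeries.C expU.val))
  generalize logSeries (-totalD) (PowerSeries.C (jet (JetVar.v 0)))
    (shiftR 1 (PowerSeries.C expU.val)) 1 = f at h1 h2
  have h3 : f - shiftR (-1) f = PowerSeries.X * PowerSeries.C (jet (JetVar.v 1)) := by
    have hneg : ∀ g : DiffSeries, psMap (-totalD : Derivation ℂ DiffPoly DiffPoly) g =
        -psMap totalD g := fun g => by
      ext1 n; simp [psMap]
    rw [psOp_sub, psOp_one, psOp_neg_derivation, rescale_expS, ← shiftR_eq_psOp, psOp_X, hneg,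
      psMap_C_jet] at h2
    change shiftR (-1) f - f = PowerSeries.X * -PowerSeries.C (jet (JetVar.v 1)) at h2
    linear_combination -h2
  have h4 : shiftR 1 (PowerSeries.C expU.inv) * shiftR 1 (PowerSeries.C expU.val) = 1 := by
    rw [← hσ.map_mul, mul_comm, expU_mul_inv, hσ.map_one]
  have h5 : shiftR (-1) (shiftR 1 (PowerSeries.C expU.inv)) = PowerSeries.C expU.inv := by
    rw [hσ.comp]; exact hσ.zero _
  rw [opComm, laxR, hσ.opMul_lax_left, hσ.opMul_lax_right, zero_sub, zero_add, h1,
    opA_one_zero_of_neg (-1) (by norm_num), hσ.map_zero, hσ.zero, hσ.map_mul, h5]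
  linear_combination h3 + f * h4 - shiftR (-1) f * expU_mul_inv

theorem opComm_opA_neg_one :
    opComm shiftR (opA Label.one 0) laxR (-1) * PowerSeries.C expU.inv =
      PowerSeries.X * PowerSeries.C (jet (JetVar.u 1)) := by
  have hσ := isShiftAction_shiftR
  have h0 : opA Label.one 0 0 - shiftR (-1) (opA Label.one 0 0) =
      PowerSeries.X * PowerSeries.C (jet (JetVar.u 1)) := by
    rw [opA_one_zero_of_nonneg 0 le_rfl, two_smul_logLax_zero]
    have h1 := psOp_sub totalD 1 (expS (-1)) (psOp totalD todd (PowerSeries.C (jet (JetVar.u 0))))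
    rw [psOp_one] at h1
    rw [shiftR_eq_psOp, ← h1, ← psOp_mul, mul_comm, todd_mul, psOp_X, psMap_C_jet]
    rfl
  rw [opComm, laxR, hσ.opMul_lax_left, hσ.opMul_lax_right, neg_add_cancel,
    opA_one_zero_of_neg (-1) (by norm_num), opA_one_zero_of_neg (-1 - 1) (by norm_num),
    hσ.map_zero, hσ.zero]
  linear_combination h0 + (opA Label.one 0 0 - shiftR (-1) (opA Label.one 0 0)) * expU_mul_inv

/-- The flow `∂/∂t^{1,0}` is the translation along `x`. -/
theorem flow_one_zero (f : DiffSeries) : flow Label.one 0 f = dxR f := by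
  rw [flow, opComm_opA_one_zero, opComm_opA_neg_one, divEps_X_mul, divEps_X_mul, evolve_translation]

end Flow

/-! ### The functions `Ω_{α,p;1,0}` and tau functions -/

section Omega

theorem IsOmega.unique {α β : Label} {p q : ℕ} {f g : DiffSeries} (hf : IsOmega α p β q f)
    (hg : IsOmega α p β q g) : f = g := by
  have h1 : psOp totalD (expS 1 - 1) (f - g) = 0 := by
    rw [psOp_sub, psOp_one, ← shiftR_eq_psOp, isShiftAction_shiftR.map_sub]
    linear_combination hf.eq - hg.eq
  have h2 : psOp totalD PowerSeries.X (f - g) = 0 := by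
    rw [← mul_one PowerSeries.X, ← expDiv_mul_inv, ← mul_assoc, X_mul_expDiv, mul_comm, psOp_mul,
      h1, map_zero]
  rw [psOp_X] at h2
  rw [← sub_eq_zero]
  ext k n m
  have h3 : totalD (PowerSeries.coeff k (f - g)) = 0 := by
    have := congrArg (PowerSeries.coeff (k + 1)) h2
    rwa [PowerSeries.coeff_succ_X_mul, psMap, PowerSeries.coeff_mk, map_zero] at this
  by_contra h4
  obtain ⟨rfl, rfl⟩ := coeff_eq_zero_of_totalD _ h3 n m h4
  apply h4
  rw [map_sub, AddMonoidAlgebra.coeff_sub, Finsupp.sub_apply, MvPolynomial.coeff_sub,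
    hf.noConstant k, hg.noConstant k]
  simp

theorem hamPred_graded (α : Label) (p : ℕ) : ∃ (d : ℤ) (b : Prop),
    hamPred α p ∈ gradedSeries d b ∧ (d ≠ 0 ∨ ¬b) ∧
      (d : ℚ) = p + (0 : ℕ) + 1 + mu α + mu Label.one := by
  cases α with
  | one =>
    refine ⟨p, p ≠ 0, ?_, ?_, by simp [mu]; ring⟩
    · rw [hamPred]
      refine Submodule.smul_mem _ _ ?_
      rcases eq_or_ne p 0 with rfl | hp
      · have h : laxPowLog 0 0 = (1 / 2 : ℂ) • ((2 : ℂ) • logLax 0) := by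
          rw [laxPowLog_zero, smul_smul]; norm_num
        rw [h, two_smul_logLax_zero]
        exact Submodule.smul_mem _ _
          (psOp_mem_gradedSeries (jet_mem_gradedSeries (JetVar.u 0) _) _)
      · exact gradedSeries_mono (by ring) (fun _ => hp) (laxPowLog_mem_gradedSeries p 0)
    · rcases eq_or_ne p 0 with hp | hp
      · exact Or.inr fun h => h hp
      · exact Or.inl (by exact_mod_cast hp)
  | two =>
    refine ⟨p + 1, True, ?_, Or.inl (by omega), by simp [mu]; ring⟩
    rw [hamPred]
    exact Submodule.smul_mem _ _ (gradedSeries_mono (by push_cast; ring) id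
      (opPow_laxR_mem_gradedSeries (p + 1) 0))

/-- `Ω_{α,p;1,0} = (ε ∂ₓ / (Λ - 1)) h_{α,p-1}`. -/
theorem Omega_one_zero (α : Label) (p : ℕ) :
    Omega α p Label.one 0 = psOp totalD expDiv⁻¹ (hamPred α p) := by
  obtain ⟨d, b, hmem, hdb, hd⟩ := hamPred_graded α p
  have h : IsOmega α p Label.one 0 (psOp totalD expDiv⁻¹ (hamPred α p)) := by
    refine ⟨?_, ?_, noConstantTerm_of_mem (psOp_mem_gradedSeries hmem _) hdb⟩
    · have h1 := psOp_sub totalD (expS 1) 1 (psOp totalD expDiv⁻¹ (hamPred α p))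
      rw [psOp_one] at h1
      rw [shiftR_eq_psOp, ← h1, ← psOp_mul, ← X_mul_expDiv, mul_assoc, expDiv_mul_inv, mul_one,
        psOp_X, flow_one_zero, dxR_eq]
    · rw [← hd]
      exact isHomogeneous_of_mem (psOp_mem_gradedSeries hmem _)
  have hΩ : IsOmega α p Label.one 0 (Omega α p Label.one 0) := Classical.epsilon_spec ⟨_, h⟩
  exact hΩ.unique h

theorem hamPred_two_zero : hamPred Label.two 0 = PowerSeries.C (jet (JetVar.v 0)) := by
  have h : opPow shiftR laxR (0 + 1) 0 = PowerSeries.C (jet (JetVar.v 0)) := by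
    rw [opPow, opPow, isShiftAction_shiftR.opMul_lambda_right, sub_zero]
    simp [laxR, lax]
  rw [hamPred, h]
  simp

theorem hamPred_one_zero :
    hamPred Label.one 0 = psOp totalD todd (PowerSeries.C (jet (JetVar.u 0))) := by
  rw [hamPred, laxPowLog_zero, ← two_smul_logLax_zero]
  simp

end Omega

end ExtToda

open ExtToda in
theorem corollary4p3 {A : Type*} [CommRing A] [Algebra ℂ A] (dx : Derivation ℂ A A)
    (dt : Label → ℕ → Derivation ℂ A A)
    (hdx : ∀ α p f, dt α p (dx f) = dx (dt α p f))
    (hdt : ∀ α p β q f, dt α p (dt β q f) = dt β q (dt α p f))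
    (v u : PowerSeries A) (E : (PowerSeries A)ˣ) (hsol : IsSolution dx dt v u E)
    (τ : FormalExp A) (hτ : IsTau dx dt v u E τ) :
    (∀ α p, toLS (evalR dx v u E (hamPred α p)) =
      lsEps A * (lsShift dx 1 (lsMap (dt α p) (FormalExp.log τ)) -
        lsMap (dt α p) (FormalExp.log τ))) ∧
    toLS v = lsEps A * lsMap (dt Label.two 0)
      (FormalExp.log (FormalExp.shift dx 1 τ / τ)) ∧
    toLS u = FormalExp.log (FormalExp.shift dx 1 τ * FormalExp.shift dx (-1) τ / τ ^ 2) := by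
  have hE := hsol.exp_dx
  have hev := evalHom_psOp dx v u E hE
  have hXU : PowerSeries.X * expDiv = expS 1 - 1 := X_mul_expDiv
  have key : ∀ α p, toLS (evalR dx v u E (hamPred α p)) =
      lsEps A * (lsShift dx 1 (lsMap (dt α p) (FormalExp.log τ)) -
        lsMap (dt α p) (FormalExp.log τ)) := by
    intro α p
    have h1 := hτ.omega_eq α p Label.one 0
    rw [Omega_one_zero, ← evalHom_apply, hev, ← lsOp_toLS, hτ.dt_one_zero,
      show lsMap (dt α p) (lsMap dx (FormalExp.log τ)) =
        lsMap dx (lsMap (dt α p) (FormalExp.log τ)) by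
          ext i; exact hdx α p _, pow_two, mul_assoc, ← lsOp_X] at h1
    -- invert `ε ∂ₓ / (Λ - 1)` by applying `(Λ - 1) / (ε ∂ₓ)`
    have h2 := congrArg (lsOp dx expDiv) h1
    rw [← lsOp_mul, expDiv_mul_inv, lsOp_one, lsOp_eps_mul, ← lsOp_mul, mul_comm expDiv, hXU,
      lsOp_sub, lsOp_one, ← lsShift_eq_lsOp] at h2
    rw [← evalHom_apply, h2]
  refine ⟨key, ?_, ?_⟩
  · have h1 := key Label.two 0
    rw [hamPred_two_zero, ← evalHom_apply, evalHom_v] at h1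
    have h2 : FormalExp.log (FormalExp.shift dx 1 τ / τ) =
        lsShift dx 1 (FormalExp.log τ) - FormalExp.log τ := rfl
    have h3 : lsMap (dt Label.two 0) (lsShift dx 1 (FormalExp.log τ) - FormalExp.log τ) =
        lsMap (dt Label.two 0) (lsShift dx 1 (FormalExp.log τ)) -
          lsMap (dt Label.two 0) (FormalExp.log τ) := by
      ext i; simp [lsMap]
    rw [h1, h2, h3, lsShift_eq_lsOp, lsShift_eq_lsOp, lsMap_lsOp _ _ (hdx Label.two 0)]
  · have h1 := key Label.one 0
    rw [hamPred_one_zero, ← evalHom_apply, hev, evalHom_u, ← lsOp_toLS, hτ.dt_one_zero, mul_sub,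
      ← lsShift_eps_mul, ← lsOp_X, lsShift_eq_lsOp] at h1
    have h2 : expS (-1) * expS 1 = 1 := by rw [← expS_add, ← expS_zero]; rfl
    have h3 := lsOp_sub dx (expS 1) 1 (lsOp dx PowerSeries.X (FormalExp.log τ))
    rw [lsOp_one] at h3
    -- `expDiv * expS (-1)` is the inverse of `todd`
    have h4 := congrArg (lsOp dx (expDiv * expS (-1))) (h1.trans h3.symm)
    have h5 : expDiv * expS (-1) * todd = 1 := by
      rw [todd]
      linear_combination expDiv * expDiv⁻¹ * h2 + expDiv_mul_inv
    have h6 : expDiv * expS (-1) * (expS 1 - 1) * PowerSeries.X =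
        expS 1 - 1 - (1 - expS (-1)) := by
      linear_combination expS (-1) * (expS 1 - 1) * hXU + (expS 1 - 2) * h2
    rw [← lsOp_mul, ← lsOp_mul, ← lsOp_mul, h5, h6, lsOp_one, lsOp_sub, lsOp_sub, lsOp_sub,
      lsOp_one, ← lsShift_eq_lsOp, ← lsShift_eq_lsOp] at h4
    have h7 : FormalExp.log (FormalExp.shift dx 1 τ * FormalExp.shift dx (-1) τ / τ ^ 2) =
        lsShift dx 1 (FormalExp.log τ) + lsShift dx (-1) (FormalExp.log τ) -
          2 • FormalExp.log τ := rfl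
    rw [h4, h7, two_smul]
    abel
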